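/- **Setting.** Work on $L^2(\mathbb R^2)$. For $b>0$ let $a_b(x)=\frac b2(-x_2,x_1)$ and $-\Delta_{a_b}=-(\nabla-ia_b)^2$. Let $v\in L^1(\mathbb R^2)\cap L^\infty(\mathbb R^2)$ be a real even pair potential and $\mu\in\mathbb R$ the chemical potential. Write $\bar A=\mathcal C A\mathcal C$, where $\mathcal C$ is complex conjugation, and $$\Gamma(\gamma,\alpha)=\begin{pmatrix}\gamma&\alpha\\ \alpha^*&1-\bar\gamma\end{pmatrix}.$$ *Normal states.* A normal state at temperature $T>0$ and field $b$ is $(\Gamma(\gamma,0),a_b)$, where $\gamma$ is a bounded operator with continuous integral kernel $\gamma(x,y)$, is invariant under all magnetic translations $u\mapsto e^{-i\chi_s}u(\cdot+s)$, $\chi_s(x)=\frac b2(s_1x_2-s_2x_1)$, and satisfies (exchange term dropped) $$\gamma=\big(1+e^{2h/T}\big)^{-1},\qquad h=-\Delta_{a_b}-\mu+v*d_\gamma,\qquad d_\gamma(x)=\gamma(x,x).$$ *$\alpha$-perturbations* of a normal state are Hilbert–Schmidt operators $\alpha$ with symmetric kernel, $\alpha(x,y)=\alpha(y,x)$, such that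 $(-\Delta_{a_b})\alpha$ is Hilbert–Schmidt and $\alpha\alpha^*\le C[\gamma(1-\gamma)]^2$ for some $C$. *Free energy.* Let $F_T=E-sTS-\mu N$ with $S(\Gamma)=-\mathrm{Tr}(\Gamma\ln\Gamma)$, where the trace of an operator matrix is the sum of the traces of its diagonal blocks, and where $s>0$ is an arbitrary fixed normalization of the entropy ($s=1$ is the plain free energy, while $s=\frac12$ is the normalization for which the normal state above is stationary). Replacing $\alpha=0$ by $\alpha$ changes neither $\gamma$ nor $a_b$, so the change of the free energy is $$\Delta F(\alpha)=\tfrac12\iint v(x-y)|\alpha(x,y)|^2\,dx\,dy+sT\,\mathrm{Tr}\big(\Gamma(\gamma,\alpha)\ln\Gamma(\gamma,\alpha)-\Gamma(\gamma,0)\ln\Gamma(\gamma,0)\big)\in(-\infty,\infty].$$ *Stability.* A normal state is energetically stable if for every $\alpha$-perturbation $\alpha\ne0$ one has $\Delta F(\varepsilon\alpha)>0$ for all sufficiently small real $\varepsilon\ne0$. It is energetically unstable if for some $\alpha$-perturbation $\alpha$ one has $\Delta F(\varepsilon\alpha)<0$ for all sufficiently small real $\varepsilon\ne0$. We say that "the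 normal state is stable (unstable) at $(T,b)$" if a normal state exists there and every normal state there is stable (unstable). *Critical temperatures.* In $[0,\infty]$ put $$T_c(b)=\sup\{T:\ \text{the normal state is unstable at }(t,b)\text{ for all }0<t<T\},$$ $$T_c'(b)=\inf\{T:\ \text{the normal state is stable at }(t,b)\text{ for all }t>T\}.$$ **Statement.** There is an absolute constant $\kappa>0$ such that the following holds whenever $v\le0$ a.e., $v$ is not a.e. zero, and $|\int v|<\kappa$, for every $\mu\in\mathbb R$ and every $s>0$: 1. if $\mu\ge0$, there is $b_0>0$ such that $T_c(b)>0$ for all $0<b<b_0$; 2. there is $b_1>0$ such that $T_c'(b)=0$ for all $b>b_1$. -/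

import Mathlib

open MeasureTheory
open scoped ContDiff InnerProductSpace ENNReal ComplexConjugate

namespace BdG

noncomputable section

/-- The physical space `ℝ²` with its Euclidean structure and Lebesgue measure. -/
abbrev Plane : Type := EuclideanSpace ℝ (Fin 2)

/-- The one-particle space `L²(ℝ²; ℂ)`. -/
abbrev OneSp : Type := Lp ℂ 2 (volume : Measure Plane)

/-- The doubled (particle-hole) space `L² ⊕ L²`, on which the density matrices `Γ` act. -/
abbrev DoubledSp : Type := WithLp 2 (OneSp × OneSp)

/-- `f(A)` for a bounded self-adjoint operator `A` on a Hilbert space (Mathlib's continuous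
functional calculus). -/
def opFun {H : Type} [NormedAddCommGroup H] [InnerProductSpace ℂ H] [CompleteSpace H]
    (f : ℝ → ℝ) (A : H →L[ℂ] H) : H →L[ℂ] H := cfc f A

/-- Test functions: smooth, complex valued, compactly supported. -/
def IsTest (φ : Plane → ℂ) : Prop := ContDiff ℝ ∞ φ ∧ HasCompactSupport φ

theorem IsTest.memLp {φ : Plane → ℂ} (h : IsTest φ) : MemLp φ 2 (volume : Measure Plane) :=
  h.1.continuous.memLp_of_hasCompactSupport h.2

/-! ### The magnetic Laplacian -/

/-- The components of the vector potential `a_b(x) = (b/2)(-x₂, x₁)`, for which `curl a_b = b`. -/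
def vecPot (b : ℝ) (j : Fin 2) (x : Plane) : ℝ :=
  if j = 0 then -(b / 2) * x 1 else (b / 2) * x 0

/-- The covariant derivative `∂_j - i (a_b)_j`. -/
def covDeriv (b : ℝ) (j : Fin 2) (φ : Plane → ℂ) (x : Plane) : ℂ :=
  fderiv ℝ φ x (EuclideanSpace.single j 1) - Complex.I * (vecPot b j x : ℂ) * φ x

/-- `-Δ_{a_b} φ = -∑_j (∂_j - i (a_b)_j)² φ`. -/
def magLap (b : ℝ) (φ : Plane → ℂ) (x : Plane) : ℂ :=
  -∑ j : Fin 2, covDeriv b j (covDeriv b j φ) x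

/-- `R` inverts `-Δ_{a_b} + W`: for every `u ∈ L²`, the function `R u` is an `L²` weak
solution of `(-Δ_{a_b} + W) (R u) = u`. For bounded `W` the operator `-Δ_{a_b} + W` is
essentially self-adjoint on test functions, so that a bounded self-adjoint `R` with this property
is the inverse of its self-adjoint realisation. -/
def IsInverseOf (b : ℝ) (W : Plane → ℝ) (R : OneSp →L[ℂ] OneSp) : Prop :=
  ∀ φ : Plane → ℂ, IsTest φ → ∀ u : OneSp,
    ∫ x, conj (magLap b φ x + (W x : ℂ) * φ x) * (R u) x = ∫ x, conj (φ x) * u x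

/-- The Fermi-Dirac function `(1 + exp (2 h / T))⁻¹`, written in terms of the value
`r = 1 / (h + c)` of the inverse of `h + c > 0` (with its limit `0` at `r = 0`, that is `h = ∞`). -/
def fermiOfInverse (T c r : ℝ) : ℝ :=
  if r ≤ 0 then 0 else (1 + Real.exp (2 * (1 / r - c) / T))⁻¹

/-- `γ = (1 + exp (2 h / T))⁻¹` for the self-adjoint, semi-bounded operator `h = -Δ_{a_b} + W`.
The functional calculus of the unbounded `h` is that of its bounded inverse `R = (h + c)⁻¹ ≥ 0`,
where `c` is any constant with `h + c > 0`; the result does not depend on the choice of `c`. -/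
def IsFermiDirac (b : ℝ) (W : Plane → ℝ) (T : ℝ) (γ : OneSp →L[ℂ] OneSp) : Prop :=
  ∃ (c : ℝ) (R : OneSp →L[ℂ] OneSp), R.IsPositive ∧ IsInverseOf b (fun x => W x + c) R ∧
    γ = opFun (fermiOfInverse T c) R

/-! ### Integral kernels and normal states -/

/-- `k` is the integral kernel of the bounded operator `A`. -/
def HasKernel (A : OneSp →L[ℂ] OneSp) (k : Plane × Plane → ℂ) : Prop :=
  ∀ (φ ψ : Plane → ℂ), IsTest φ → ∀ hψ : IsTest ψ,
    ∫ x, conj (φ x) * (A (hψ.memLp.toLp ψ)) x =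
      ∫ p : Plane × Plane, conj (φ p.1) * k p * ψ p.2

/-- `χ_s(x) = (b/2) s ∧ x`, the phase of the magnetic translation by `s`. -/
def magPhase (b : ℝ) (s x : Plane) : ℝ := (b / 2) * (s 0 * x 1 - s 1 * x 0)

/-- The operator with kernel `k` is invariant under conjugation by all the magnetic translations
`u ↦ e^{-i χ_s} u(· + s)`. -/
def IsMagneticInvariant (b : ℝ) (k : Plane × Plane → ℂ) : Prop :=
  ∀ s x y : Plane, Complex.exp (-Complex.I * (magPhase b s x : ℂ)) * k (x + s, y + s) *
    Complex.exp (Complex.I * (magPhase b s y : ℂ)) = k (x, y)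

/-- The direct interaction potential `(v * d_γ)(x) = ∫ v(x - y) γ(y, y) dy`. -/
def directPot (v : Plane → ℝ) (k : Plane × Plane → ℂ) (x : Plane) : ℝ :=
  ∫ y, v (x - y) * (k (y, y)).re

/-- `γ`, with continuous kernel `k`, is the diagonal part of a magnetically translation invariant
normal state `(Γ_{Tb}, a_b)` at temperature `T` and magnetic field `b`: it solves
`γ = (1 + exp (2 h / T))⁻¹`, `h = -Δ_{a_b} - μ + v * d_γ`. -/
structure IsNormalState (v : Plane → ℝ) (μ T b : ℝ) (γ : OneSp →L[ℂ] OneSp)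
    (k : Plane × Plane → ℂ) : Prop where
  continuous_kernel : Continuous k
  hasKernel : HasKernel γ k
  magneticInvariant : IsMagneticInvariant b k
  fermiDirac : IsFermiDirac b (fun x => directPot v k x - μ) T γ

/-! ### The density matrix `Γ` -/

/-- Complex conjugation on `L²`. -/
def conjL2 : OneSp →L⋆[ℂ] OneSp :=
  LinearMap.mkContinuous
    { toFun := fun f => star f
      map_add' := fun f g => by
        apply Lp.ext
        filter_upwards [Lp.coeFn_star (f + g), Lp.coeFn_star f, Lp.coeFn_star g,
          Lp.coeFn_add f g, Lp.coeFn_add (star f) (star g)] with x h1 h2 h3 h4 h5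
        rw [h1, h5, Pi.add_apply, h2, h3, Pi.star_apply, h4]
        simp
      map_smul' := fun c f => by
        apply Lp.ext
        filter_upwards [Lp.coeFn_star (c • f), Lp.coeFn_star f, Lp.coeFn_smul c f,
          Lp.coeFn_smul (conj c) (star f)] with x h1 h2 h3 h4
        rw [h1, h4, Pi.smul_apply, h2, Pi.star_apply, h3]
        simp }
    1 (fun f => by
      rw [one_mul]
      apply Lp.norm_le_norm_of_ae_le
      filter_upwards [Lp.coeFn_star f] with x h1
      simp [h1])

/-- `Ā = C A C`, with `C` the complex conjugation. -/
def conjOp (A : OneSp →L[ℂ] OneSp) : OneSp →L[ℂ] OneSp := conjL2.comp (A.comp conjL2)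

/-- The operator matrix with rows `(A, B)` and `(C, D)`. -/
def blockOp (A B C D : OneSp →L[ℂ] OneSp) : DoubledSp →L[ℂ] DoubledSp :=
  ((WithLp.prodContinuousLinearEquiv 2 ℂ OneSp OneSp).symm :
      OneSp × OneSp →L[ℂ] DoubledSp).comp
    (((A.coprod B).prod (C.coprod D)).comp
      ((WithLp.prodContinuousLinearEquiv 2 ℂ OneSp OneSp : DoubledSp ≃L[ℂ] OneSp × OneSp) :
        DoubledSp →L[ℂ] OneSp × OneSp))

/-- `Γ` with rows `(γ, α)` and `(α*, 1 - γ̄)`. -/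
def densityMatrix (γ α : OneSp →L[ℂ] OneSp) : DoubledSp →L[ℂ] DoubledSp :=
  blockOp γ α (ContinuousLinearMap.adjoint α) (1 - conjOp γ)

/-! ### Perturbations and the free energy -/

/-- Admissible `α`-perturbations of the normal state `γ`: `α` is a Hilbert-Schmidt operator with
kernel `k`, `α* = ᾱ` (that is, `k` is symmetric), `(-Δ_{a_b}) α` is again Hilbert-Schmidt (with
some kernel `w`; by the symmetry of `k` the same holds for the product in the other order), and
`α α* ≤ C [γ (1 - γ)]²` for some constant `C`. -/
structure IsAlphaPerturbation (b : ℝ) (γ α : OneSp →L[ℂ] OneSp) (k : Plane × Plane → ℂ) :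
    Prop where
  memLp : MemLp k 2 volume
  hasKernel : HasKernel α k
  symm : ∀ᵐ p : Plane × Plane, k p.swap = k p
  smooth : ∃ w : Plane × Plane → ℂ, MemLp w 2 volume ∧
    ∀ φ ψ : Plane → ℂ, IsTest φ → IsTest ψ →
      ∫ p : Plane × Plane, conj (magLap b φ p.1) * k p * ψ p.2 =
        ∫ p : Plane × Plane, conj (φ p.1) * w p * ψ p.2
  bound : ∃ C : ℝ, ∀ u : OneSp,
    ‖ContinuousLinearMap.adjoint α u‖ ^ 2 ≤ C * ‖(γ * (1 - γ)) u‖ ^ 2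

/-- The trace, in `[0, ∞]`, of a non-negative operator. -/
def posTrace (P : OneSp →L[ℂ] OneSp) : ℝ≥0∞ :=
  ⨆ (n : ℕ) (e : Fin n → OneSp) (_ : Orthonormal ℂ e),
    ∑ i, ENNReal.ofReal (RCLike.re ⟪e i, P (e i)⟫_ℂ)

/-- The upper left block of an operator matrix. -/
def block11 (G : DoubledSp →L[ℂ] DoubledSp) : OneSp →L[ℂ] OneSp :=
  (WithLp.fstL 2 ℂ OneSp OneSp).comp
    (G.comp (((WithLp.prodContinuousLinearEquiv 2 ℂ OneSp OneSp).symm :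
      OneSp × OneSp →L[ℂ] DoubledSp).comp (ContinuousLinearMap.inl ℂ OneSp OneSp)))

/-- The lower right block of an operator matrix. -/
def block22 (G : DoubledSp →L[ℂ] DoubledSp) : OneSp →L[ℂ] OneSp :=
  (WithLp.sndL 2 ℂ OneSp OneSp).comp
    (G.comp (((WithLp.prodContinuousLinearEquiv 2 ℂ OneSp OneSp).symm :
      OneSp × OneSp →L[ℂ] DoubledSp).comp (ContinuousLinearMap.inr ℂ OneSp OneSp)))

/-- `Γ ln Γ`. -/
def xlogx (G : DoubledSp →L[ℂ] DoubledSp) : DoubledSp →L[ℂ] DoubledSp := opFun (fun x : ℝ => x * Real.log x) G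

/-- `S(Γ₀) - S(Γ) = Tr (Γ ln Γ - Γ₀ ln Γ₀)` for a block diagonal `Γ₀` and a `Γ` with the same
diagonal blocks, `0 ≤ Γ, Γ₀ ≤ 1`. The trace of an operator matrix is the sum of the traces of its
diagonal blocks; these blocks are non-negative operators here, because `x ln x` is operator
convex. -/
def entropyLoss (G₀ G : DoubledSp →L[ℂ] DoubledSp) : ℝ≥0∞ :=
  posTrace (block11 (xlogx G - xlogx G₀)) + posTrace (block22 (xlogx G - xlogx G₀))

/-- The pair interaction energy `(1/2) Tr (α* v^♯ α)`, for `α` with kernel `k`. -/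
def pairEnergy (v : Plane → ℝ) (k : Plane × Plane → ℂ) : ℝ :=
  (1 / 2) * ∫ p : Plane × Plane, v (p.1 - p.2) * ‖k p‖ ^ 2

/-- The change `F_T(Γ, a_b) - F_T(Γ₀, a_b)` of the free energy `F_T = E - s T S - μ N` when the
off-diagonal part `0` of the normal state is replaced by `α` (with kernel `k`). As `γ` and `a_b`
are unchanged, all the terms of `E - μ N` except for the pair interaction energy are equal in the
two states and cancel. -/
def freeEnergyChange (v : Plane → ℝ) (s T : ℝ) (γ α : OneSp →L[ℂ] OneSp)
    (k : Plane × Plane → ℂ) : EReal :=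
  (pairEnergy v k : EReal) +
    ((ENNReal.ofReal (s * T) * entropyLoss (densityMatrix γ 0) (densityMatrix γ α) : ℝ≥0∞) : EReal)

/-- Energetic stability of the normal state `γ` under `α`-perturbations. -/
def IsEnergeticallyStable (v : Plane → ℝ) (s T b : ℝ) (γ : OneSp →L[ℂ] OneSp) : Prop :=
  ∀ (α : OneSp →L[ℂ] OneSp) (k : Plane × Plane → ℂ), IsAlphaPerturbation b γ α k → α ≠ 0 →
    ∃ ε₀ > 0, ∀ ε : ℝ, 0 < |ε| → |ε| < ε₀ →
      0 < freeEnergyChange v s T γ ((ε : ℂ) • α) (fun p => (ε : ℂ) * k p)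

/-- Energetic instability of the normal state `γ` under `α`-perturbations. -/
def IsEnergeticallyUnstable (v : Plane → ℝ) (s T b : ℝ) (γ : OneSp →L[ℂ] OneSp) : Prop :=
  ∃ (α : OneSp →L[ℂ] OneSp) (k : Plane × Plane → ℂ), IsAlphaPerturbation b γ α k ∧
    ∃ ε₀ > 0, ∀ ε : ℝ, 0 < |ε| → |ε| < ε₀ →
      freeEnergyChange v s T γ ((ε : ℂ) • α) (fun p => (ε : ℂ) * k p) < 0

/-- At temperature `T` and field `b` there is a normal state, and it (that is, every one, should
there be several) is energetically stable. -/
def NormalStable (v : Plane → ℝ) (μ s T b : ℝ) : Prop :=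
  (∃ γ k, IsNormalState v μ T b γ k) ∧
    ∀ γ k, IsNormalState v μ T b γ k → IsEnergeticallyStable v s T b γ

/-- At temperature `T` and field `b` there is a normal state, and it (that is, every one, should
there be several) is energetically unstable. -/
def NormalUnstable (v : Plane → ℝ) (μ s T b : ℝ) : Prop :=
  (∃ γ k, IsNormalState v μ T b γ k) ∧
    ∀ γ k, IsNormalState v μ T b γ k → IsEnergeticallyUnstable v s T b γ

/-- `T_c(b) ∈ [0, ∞]`: the largest temperature below which the normal state is energetically
unstable. -/
def criticalTemp (v : Plane → ℝ) (μ s b : ℝ) : ℝ≥0∞ :=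
  sSup {T : ℝ≥0∞ | ∀ t : ℝ, 0 < t → ENNReal.ofReal t < T → NormalUnstable v μ s t b}

/-- `T_c'(b) ∈ [0, ∞]`: the smallest temperature above which the normal state is energetically
stable. -/
def stabilityTemp (v : Plane → ℝ) (μ s b : ℝ) : ℝ≥0∞ :=
  sInf {T : ℝ≥0∞ | ∀ t : ℝ, 0 < t → T < ENNReal.ofReal t → NormalStable v μ s t b}

end

end BdG

open MeasureTheory
open scoped ContDiff InnerProductSpace ENNReal ComplexConjugate

namespace BdG

noncomputable section

/-! In a constant field everything is diagonal in the Landau levels. Magnetic invariance makes the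
density of a normal state constant, so the direct potential only shifts the chemical potential: `γ`
is diagonal in `landauBasis`, with occupations `fermi T (b * (2 * n + 1) - ν)`, where `ν` solves a
scalar equation (`IsNormalState.exists_levels`). For `|∫ v| < 1` this equation has a solution
(`exists_density_fixedPoint`), and every solution obeys `μ ≤ ν ≤ 2|μ| + b/4 + T/4`
(`density_fixedPoint_bounds`). The spectral theory behind this (completeness of the Landau
functions, kernels of the level projections) is built from ladder operators acting on entire
functions times a Gaussian.

The entropy is handled entry by entry. Let `ψ` be an eigenvector of `Γ(γ, 0)` with eigenvalue `p`,
supported in one block. Since `Γ = Γ(γ, α)` has the same diagonal blocks, `⟨ψ, Γ ψ⟩ = p ‖ψ‖²`, and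
the diagonal entry of the entropy difference at `ψ` equals that of `relEnt p` applied to `Γ`. A
scalar bound of `relEnt p x` by `h(x) (x - p)²`, from above or below, thus bounds this entry by `⟨w,
h(Γ) w⟩` with `w = (Γ - p) ψ`, the image of `ψ` under the off-diagonal part. Operator convexity of
`x ln x`, applied to a pinching, makes the diagonal blocks of the difference non-negative, so that
their traces are bounded by sums over a basis.

Strong fields (`exists_stabilityTemp_eq_zero`). `relEnt p x` is bounded below by `(x - p)²` times a
constant and also times a multiple of `-log p`. For large `b` all levels lie above `ν` by at least
`b/4` when `T ≤ b`, so `T` times the second constant is of order `b`; for `T > b` the first constant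
suffices. In both cases the entropy beats the interaction, which is at most `‖v‖_∞/2` times the
squared Hilbert-Schmidt norm of `α`.

Weak fields (`exists_criticalTemp_pos`). This is the logarithm of Cooper's argument. The trial pairs
have their centre of mass in the lowest Landau state and a radial relative motion in the level `N =
2 n₀ + d`, where `n₀` is the first level at or above `ν`; they are superposed with weights `1/d`.
Let `L = ∑ 1/d`. For `b d` small the relative wave functions nearly coincide on bounded sets,
because they are values of one jointly continuous `profile` at the parameters `(b, b N)`; they
therefore interfere constructively and the attraction gains a multiple of `L²/b`. The entropy costs
about `b (1 + d)` per pair, which with the squared weights sums to order `L/b`. Pairs with a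
particle below `n₀` are dropped, since the entropy bound needs occupations at most `1/2`; the levels
of the two particles are binomially distributed, so Chebyshev's inequality shows that the loss is
also of order `L/b`. A range of `d` with `L` large, available once `b` is small (`exists_scales`),
gives instability for every `T < b`. -/

/-! ### Entire functions of exponential type -/

/-- Entire functions of exponential type. -/
def ExpType (f : ℂ → ℂ) : Prop :=
  Differentiable ℂ f ∧ ∃ C A : ℝ, 0 ≤ C ∧ 0 ≤ A ∧ ∀ w, ‖f w‖ ≤ C * Real.exp (A * ‖w‖)

/-- Cauchy's estimate on a unit circle costs only a factor `exp A`. This class of functions is used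
because it contains the monomials, is stable under derivatives and under the exponential factors of
magnetic translations, and is tamed by every Gaussian. -/
theorem ExpType.deriv {f : ℂ → ℂ} (hf : ExpType f) : ExpType (deriv f) := by
  obtain ⟨hd, C, A, hC, hA, hb⟩ := hf
  have hd' : Differentiable ℂ (_root_.deriv f) :=
    (hd.contDiff (n := 2)).differentiable_deriv_two
  refine ⟨hd', C * Real.exp A, A, by positivity, hA, fun w => ?_⟩
  have := Complex.norm_deriv_le_of_forall_mem_sphere_norm_le (c := w) (R := 1) (f := f)
    (C := C * Real.exp A * Real.exp (A * ‖w‖)) one_pos hd.diffContOnCl ?_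
  · simpa using this
  · intro u hu
    refine (hb u).trans ?_
    rw [mul_assoc, ← Real.exp_add]
    have hu' : ‖u - w‖ = 1 := by simpa [dist_eq_norm] using hu
    have : ‖u‖ ≤ 1 + ‖w‖ := by
      calc ‖u‖ = ‖(u - w) + w‖ := by ring_nf
        _ ≤ ‖u - w‖ + ‖w‖ := norm_add_le _ _
        _ = _ := by rw [hu']
    gcongr
    nlinarith

theorem ExpType.mul {f g : ℂ → ℂ} (hf : ExpType f) (hg : ExpType g) :
    ExpType (fun w => f w * g w) := by
  obtain ⟨hd, C, A, hC, hA, hb⟩ := hf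
  obtain ⟨hd', C', A', hC', hA', hb'⟩ := hg
  refine ⟨hd.mul hd', C * C', A + A', by positivity, by positivity, fun w => ?_⟩
  rw [norm_mul, add_mul, Real.exp_add]
  calc _ ≤ (C * Real.exp (A * ‖w‖)) * (C' * Real.exp (A' * ‖w‖)) := by
        gcongr
        exacts [hb w, hb' w]
    _ = _ := by ring

theorem expType_const (c : ℂ) : ExpType (fun _ => c) :=
  ⟨differentiable_const _, ‖c‖, 0, norm_nonneg _, le_rfl, fun w => by simp⟩

theorem expType_id : ExpType (fun w => w) := by
  refine ⟨differentiable_id, 1, 1, zero_le_one, zero_le_one, fun w => ?_⟩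
  have := Real.add_one_le_exp ‖w‖
  simp only [one_mul]
  linarith

theorem ExpType.const_mul {f : ℂ → ℂ} (hf : ExpType f) (c : ℂ) : ExpType (fun w => c * f w) :=
  (expType_const c).mul hf

theorem ExpType.pow {f : ℂ → ℂ} (hf : ExpType f) (m : ℕ) : ExpType (fun w => f w ^ m) := by
  induction m with
  | zero => simpa using expType_const 1
  | succ m ih => simpa only [pow_succ] using ih.mul hf

theorem expType_pow (m : ℕ) : ExpType (fun w => w ^ m) := expType_id.pow m

theorem expType_exp (c : ℂ) : ExpType (fun w => Complex.exp (c * w)) := by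
  refine ⟨by fun_prop, 1, ‖c‖, zero_le_one, norm_nonneg _, fun w => ?_⟩
  rw [Complex.norm_exp, one_mul]
  exact Real.exp_le_exp.2 ((Complex.re_le_norm _).trans (norm_mul_le _ _))

theorem ExpType.comp_add {f : ℂ → ℂ} (hf : ExpType f) (z : ℂ) : ExpType (fun w => f (z + w)) := by
  obtain ⟨hd, C, A, hC, hA, hb⟩ := hf
  refine ⟨hd.comp (by fun_prop), C * Real.exp (A * ‖z‖), A, by positivity, hA, fun w => ?_⟩
  refine (hb _).trans ?_
  rw [mul_assoc, ← Real.exp_add, ← mul_add]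
  gcongr
  exact norm_add_le _ _

/-! ### The complex coordinate and the Gaussian -/

/-- The complex coordinate `x₁ + i x₂`. -/
def zc (x : Plane) : ℂ := (x 0 : ℂ) + (x 1 : ℂ) * Complex.I

@[simp] theorem zc_re (x : Plane) : (zc x).re = x 0 := by simp [zc]
@[simp] theorem zc_im (x : Plane) : (zc x).im = x 1 := by simp [zc]

@[simp] theorem zc_add (x y : Plane) : zc (x + y) = zc x + zc y := by
  apply Complex.ext <;> simp
@[simp] theorem zc_sub (x y : Plane) : zc (x - y) = zc x - zc y := by
  apply Complex.ext <;> simp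
@[simp] theorem zc_zero : zc 0 = 0 := by apply Complex.ext <;> simp
@[simp] theorem zc_smul (t : ℝ) (x : Plane) : zc (t • x) = t * zc x := by
  apply Complex.ext <;> simp

theorem plane_norm_sq (x : Plane) : ‖x‖ ^ 2 = x 0 ^ 2 + x 1 ^ 2 := by
  rw [EuclideanSpace.norm_sq_eq, Fin.sum_univ_two]; simp

theorem norm_zc (x : Plane) : ‖zc x‖ = ‖x‖ := by
  rw [← sq_eq_sq₀ (norm_nonneg _) (norm_nonneg _), plane_norm_sq, Complex.sq_norm,
    Complex.normSq_apply]
  simp; ring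

/-- The complex coordinate as a continuous linear map. -/
def zcL : Plane →L[ℝ] ℂ := LinearMap.toContinuousLinearMap
  { toFun := zc
    map_add' := zc_add
    map_smul' := fun t x => by simp }

@[simp] theorem zcL_apply (x : Plane) : zcL x = zc x := rfl

/-- The conjugate coordinate as a continuous linear map. -/
def zbL : Plane →L[ℝ] ℂ := (Complex.conjCLE : ℂ →L[ℝ] ℂ).comp zcL

@[simp] theorem zbL_apply (x : Plane) : zbL x = conj (zc x) := rfl

/-- The Gaussian `exp (-b |x|² / 4)`. -/
def gauss (b : ℝ) (x : Plane) : ℂ := Complex.exp (-(b / 4 : ℝ) * (zc x * conj (zc x)))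

theorem gauss_eq (b : ℝ) (x : Plane) : gauss b x = (Real.exp (-(b / 4) * ‖x‖ ^ 2) : ℝ) := by
  rw [gauss, Complex.mul_conj, Complex.normSq_eq_norm_sq, norm_zc]
  push_cast; rfl

theorem norm_gauss (b : ℝ) (x : Plane) : ‖gauss b x‖ = Real.exp (-(b / 4) * ‖x‖ ^ 2) := by
  rw [gauss_eq, Complex.norm_real, Real.norm_of_nonneg (Real.exp_pos _).le]

theorem hasFDerivAt_zc (x : Plane) : HasFDerivAt zc zcL x := zcL.hasFDerivAt
theorem hasFDerivAt_zb (x : Plane) : HasFDerivAt (fun y => conj (zc y)) zbL x := zbL.hasFDerivAt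

theorem hasFDerivAt_gauss (b : ℝ) (x : Plane) : HasFDerivAt (gauss b)
    ((-(b / 4 : ℂ) * conj (zc x) * gauss b x) • zcL + (-(b / 4 : ℂ) * zc x * gauss b x) • zbL)
    x := by
  have h := (((hasFDerivAt_zc x).mul (hasFDerivAt_zb x)).const_mul (-(b / 4 : ℝ) : ℂ)).cexp
  refine h.congr_fderiv ?_
  ext v
  simp [gauss]
  ring

/-! ### Landau functions -/

/-- The function `(A*)ⁿ (f G)` of the `n`-th Landau level, where `A*` is the raising operator. -/
def landau (b : ℝ) : ℕ → (ℂ → ℂ) → Plane → ℂ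
  | 0, f => fun x => f (zc x) * gauss b x
  | n + 1, f => fun x => b * conj (zc x) * landau b n f x - 2 * landau b n (deriv f) x

theorem landau_zero (b : ℝ) (f : ℂ → ℂ) (x : Plane) :
    landau b 0 f x = f (zc x) * gauss b x := rfl

theorem landau_succ (b : ℝ) (n : ℕ) (f : ℂ → ℂ) (x : Plane) : landau b (n + 1) f x =
    b * conj (zc x) * landau b n f x - 2 * landau b n (deriv f) x := rfl

theorem landau_add (b : ℝ) (n : ℕ) {f g : ℂ → ℂ} (hf : ExpType f) (hg : ExpType g) (x : Plane) :
    landau b n (fun w => f w + g w) x = landau b n f x + landau b n g x := by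
  induction n generalizing f g with
  | zero => simp only [landau_zero]; ring
  | succ n ih =>
    have : deriv (fun w => f w + g w) = fun w => deriv f w + deriv g w := by
      funext w; exact deriv_add (hf.1 w) (hg.1 w)
    simp only [landau_succ, this, ih hf hg, ih hf.deriv hg.deriv]
    ring

theorem landau_const_mul (b : ℝ) (n : ℕ) {f : ℂ → ℂ} (c : ℂ) (hf : ExpType f) (x : Plane) :
    landau b n (fun w => c * f w) x = c * landau b n f x := by
  induction n generalizing f with
  | zero => simp only [landau_zero]; ring
  | succ n ih =>
    have : deriv (fun w => c * f w) = fun w => c * deriv f w := by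
      funext w; exact deriv_const_mul c (hf.1 w)
    simp only [landau_succ, this, ih hf, ih hf.deriv]
    ring

/-- The coefficient of `zcL` is the derivative in `z`, that of `zbL` the derivative in the conjugate
of `z`. Up to the Gaussian terms the first differentiates `f` and the second lowers the level. At
level zero the truncated `n - 1` is harmless, since its factor `n` vanishes. -/
theorem hasFDerivAt_landau (b : ℝ) (n : ℕ) {f : ℂ → ℂ} (hf : ExpType f) (x : Plane) :
    HasFDerivAt (landau b n f)
      ((landau b n (deriv f) x - (b / 4 : ℂ) * conj (zc x) * landau b n f x) • zcL +
        (b * n * landau b (n - 1) f x - (b / 4 : ℂ) * zc x * landau b n f x) • zbL) x := by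
  induction n generalizing f with
  | zero =>
    have h1 : HasFDerivAt (fun y => f (zc y)) (deriv f (zc x) • zcL) x := by
      have := (hf.1 (zc x)).hasDerivAt.complexToReal_fderiv.comp x (hasFDerivAt_zc x)
      refine this.congr_fderiv ?_
      ext v; simp 
    refine (h1.mul (hasFDerivAt_gauss b x)).congr_fderiv ?_
    ext v
    simp [landau_zero]
    ring
  | succ n ih =>
    have h1 := (((hasFDerivAt_zb x).const_mul (b : ℂ)).mul (ih hf)).sub
      ((ih hf.deriv).const_mul (2 : ℂ))
    refine h1.congr_fderiv ?_
    ext v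
    rcases n with _ | n
    · simp [landau_succ]
      ring
    · simp [landau_succ]
      ring

theorem contDiff_landau (b : ℝ) (n : ℕ) {f : ℂ → ℂ} (hf : ExpType f) :
    ContDiff ℝ ∞ (landau b n f) := by
  have hz : ContDiff ℝ ∞ zc := zcL.contDiff
  have hzb : ContDiff ℝ ∞ (fun x => conj (zc x)) := zbL.contDiff
  induction n generalizing f with
  | zero =>
    have h1 : ContDiff ℝ ∞ f := (hf.1.contDiff).restrict_scalars ℝ
    exact (h1.comp hz).mul ((contDiff_const.mul (hz.mul hzb)).cexp)
  | succ n ih => exact ((contDiff_const.mul hzb).mul (ih hf)).sub (contDiff_const.mul (ih hf.deriv))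

theorem continuous_landau (b : ℝ) (n : ℕ) {f : ℂ → ℂ} (hf : ExpType f) :
    Continuous (landau b n f) := (contDiff_landau b n hf).continuous

theorem zc_single_zero : zc (EuclideanSpace.single 0 1) = 1 := by
  apply Complex.ext <;> simp
theorem zc_single_one : zc (EuclideanSpace.single 1 1) = Complex.I := by
  apply Complex.ext <;> simp

/-- Both covariant derivatives are combinations of one raising and one lowering step, so that
`magLap_landau` becomes the algebra of a harmonic oscillator: the terms changing the level by two
cancel between the two directions. -/
theorem covDeriv_zero_landau (b : ℝ) (n : ℕ) {f : ℂ → ℂ} (hf : ExpType f) (x : Plane) :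
    covDeriv b 0 (landau b n f) x =
      -(1 / 2) * landau b (n + 1) f x + b * n * landau b (n - 1) f x := by
  have hx : (x 1 : ℂ) = (zc x - conj (zc x)) * (-Complex.I / 2) := by
    apply Complex.ext <;> simp; ring
  rw [covDeriv, (hasFDerivAt_landau b n hf x).fderiv]
  simp only [vecPot, if_true, landau_succ, add_apply,
    smul_apply, zcL_apply, zbL_apply, zc_single_zero, smul_eq_mul]
  push_cast
  rw [hx]
  simp only [map_one]
  linear_combination (-(b / 4) * (zc x - conj (zc x)) * landau b n f x) * Complex.I_sq

theorem covDeriv_one_landau (b : ℝ) (n : ℕ) {f : ℂ → ℂ} (hf : ExpType f) (x : Plane) :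
    covDeriv b 1 (landau b n f) x =
      -Complex.I * (1 / 2 * landau b (n + 1) f x + b * n * landau b (n - 1) f x) := by
  have hx : (x 0 : ℂ) = (zc x + conj (zc x)) * (1 / 2) := by
    apply Complex.ext <;> simp; ring
  rw [covDeriv, (hasFDerivAt_landau b n hf x).fderiv]
  simp only [vecPot, one_ne_zero, if_false, landau_succ, add_apply,
    smul_apply, zcL_apply, zbL_apply, zc_single_one, smul_eq_mul]
  push_cast
  rw [hx]
  simp only [Complex.conj_I]
  ring

theorem covDeriv_lin (b : ℝ) (j : Fin 2) {φ ψ : Plane → ℂ} {x : Plane}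
    (hφ : DifferentiableAt ℝ φ x) (hψ : DifferentiableAt ℝ ψ x) (c d : ℂ) :
    covDeriv b j (fun y => c * φ y + d * ψ y) x = c * covDeriv b j φ x + d * covDeriv b j ψ x := by
  have := ((hφ.hasFDerivAt.const_mul c).add (hψ.hasFDerivAt.const_mul d)).fderiv
  simp only [covDeriv]
  have h2 : fderiv ℝ (fun y => c * φ y + d * ψ y) x = c • fderiv ℝ φ x + d • fderiv ℝ ψ x := this
  rw [h2]
  simp
  ring

theorem magLap_landau (b : ℝ) (n : ℕ) {f : ℂ → ℂ} (hf : ExpType f) (x : Plane) :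
    magLap b (landau b n f) x = (b * (2 * n + 1) : ℝ) * landau b n f x := by
  have hd : ∀ m, DifferentiableAt ℝ (landau b m f) x := fun m =>
    (hasFDerivAt_landau b m hf x).differentiableAt
  have e0 : covDeriv b 0 (landau b n f) =
      fun y => -(1 / 2) * landau b (n + 1) f y + b * n * landau b (n - 1) f y :=
    funext fun y => covDeriv_zero_landau b n hf y
  have e1 : covDeriv b 1 (landau b n f) = fun y => (-Complex.I * (1 / 2)) * landau b (n + 1) f y +
      (-Complex.I * (b * n)) * landau b (n - 1) f y := by
    funext y; rw [covDeriv_one_landau b n hf y]; ring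
  rw [magLap, Fin.sum_univ_two, e0, e1, covDeriv_lin b 0 (hd _) (hd _),
    covDeriv_lin b 1 (hd _) (hd _), covDeriv_zero_landau b _ hf, covDeriv_one_landau b _ hf,
    covDeriv_zero_landau b _ hf, covDeriv_one_landau b _ hf]
  -- The lowering step contains a truncated `n - 1`; level zero, where it is absent, is treated
  -- separately.
  rcases n with _ | n
  · simp
    linear_combination (-(1 / 4) * landau b 2 f x - (b / 2) * landau b 0 f x) * Complex.I_sq
  · simp only [Nat.add_sub_cancel]
    push_cast
    linear_combination (-(1 / 2) * (1 / 2 * landau b (n + 1 + 1 + 1) f x + b * (n + 1 + 1) *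
      landau b (n + 1) f x) - b * (n + 1) * (1 / 2 * landau b (n + 1) f x + b * n *
      landau b (n - 1) f x)) * Complex.I_sq

/-! ### Functions of Gaussian decay -/

/-- Continuous functions that decay like a Gaussian. -/
def GaussDecay (φ : Plane → ℂ) : Prop :=
  Continuous φ ∧ ∃ C δ : ℝ, 0 ≤ C ∧ 0 < δ ∧ ∀ x, ‖φ x‖ ≤ C * Real.exp (-δ * ‖x‖ ^ 2)

theorem integrable_gauss {δ : ℝ} (hδ : 0 < δ) :
    Integrable (fun x : Plane => Real.exp (-δ * ‖x‖ ^ 2)) := by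
  have := (GaussianFourier.integrable_cexp_neg_mul_sq_norm_add (V := Plane) (b := δ)
    (by simpa using hδ) 0 0).norm
  refine this.congr (Filter.Eventually.of_forall fun x => ?_)
  simp only [Complex.norm_exp]
  congr 1
  simp [← Complex.ofReal_pow]

namespace GaussDecay

variable {φ ψ : Plane → ℂ}

theorem conjugate (h : GaussDecay φ) : GaussDecay (fun x => conj (φ x)) := by
  obtain ⟨hc, C, δ, hC, hδ, hb⟩ := h
  exact ⟨Complex.continuous_conj.comp hc, C, δ, hC, hδ, fun x => by simpa using hb x⟩

theorem const_mul (h : GaussDecay φ) (c : ℂ) : GaussDecay (fun x => c * φ x) := by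
  obtain ⟨hc, C, δ, hC, hδ, hb⟩ := h
  refine ⟨continuous_const.mul hc, ‖c‖ * C, δ, by positivity, hδ, fun x => ?_⟩
  rw [norm_mul, mul_assoc]
  exact mul_le_mul_of_nonneg_left (hb x) (norm_nonneg _)

theorem add (h : GaussDecay φ) (h' : GaussDecay ψ) : GaussDecay (fun x => φ x + ψ x) := by
  obtain ⟨hc, C, δ, hC, hδ, hb⟩ := h
  obtain ⟨hc', C', δ', hC', hδ', hb'⟩ := h'
  refine ⟨hc.add hc', C + C', min δ δ', by positivity, lt_min hδ hδ', fun x => ?_⟩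
  refine (norm_add_le _ _).trans ?_
  rw [add_mul]
  refine add_le_add ((hb x).trans ?_) ((hb' x).trans ?_) <;> gcongr
  · exact min_le_left _ _
  · exact min_le_right _ _

theorem sub (h : GaussDecay φ) (h' : GaussDecay ψ) : GaussDecay (fun x => φ x - ψ x) := by
  simpa [sub_eq_add_neg] using h.add (h'.const_mul (-1))

theorem mul (h : GaussDecay φ) (h' : GaussDecay ψ) : GaussDecay (fun x => φ x * ψ x) := by
  obtain ⟨hc, C, δ, hC, hδ, hb⟩ := h
  obtain ⟨hc', C', δ', hC', hδ', hb'⟩ := h'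
  refine ⟨hc.mul hc', C * C', δ + δ', by positivity, by positivity, fun x => ?_⟩
  rw [norm_mul, neg_add, add_mul, Real.exp_add]
  calc _ ≤ (C * Real.exp (-δ * ‖x‖ ^ 2)) * (C' * Real.exp (-δ' * ‖x‖ ^ 2)) := by
        gcongr
        exacts [hb x, hb' x]
    _ = _ := by ring

theorem zc_mul (h : GaussDecay φ) : GaussDecay (fun x => zc x * φ x) := by
  obtain ⟨hc, C, δ, hC, hδ, hb⟩ := h
  refine ⟨zcL.continuous.mul hc, C * (1 + 2 / δ), δ / 2, by positivity, by positivity,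
    fun x => ?_⟩
  rw [norm_mul, norm_zc]
  have h1 : ‖x‖ ≤ (1 + 2 / δ) * Real.exp (δ / 2 * ‖x‖ ^ 2) := by
    have := Real.add_one_le_exp (δ / 2 * ‖x‖ ^ 2)
    have h2 : ‖x‖ ≤ 1 + ‖x‖ ^ 2 := by nlinarith [sq_nonneg (‖x‖ - 1), sq_nonneg ‖x‖]
    calc ‖x‖ ≤ 1 + ‖x‖ ^ 2 := h2
      _ ≤ (1 + 2 / δ) * (δ / 2 * ‖x‖ ^ 2 + 1) := by
          have : (1 + 2 / δ) * (δ / 2 * ‖x‖ ^ 2 + 1) =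
            1 + ‖x‖ ^ 2 + δ / 2 * ‖x‖ ^ 2 + 2 / δ := by field_simp; ring
          rw [this]
          have : 0 ≤ δ / 2 * ‖x‖ ^ 2 := by positivity
          have : 0 ≤ 2 / δ := by positivity
          linarith
      _ ≤ _ := by gcongr
  calc ‖x‖ * ‖φ x‖ ≤ ((1 + 2 / δ) * Real.exp (δ / 2 * ‖x‖ ^ 2)) *
        (C * Real.exp (-δ * ‖x‖ ^ 2)) := by
        gcongr
        exact hb x
    _ = C * (1 + 2 / δ) * (Real.exp (δ / 2 * ‖x‖ ^ 2) * Real.exp (-δ * ‖x‖ ^ 2)) := by ring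
    _ = _ := by rw [← Real.exp_add]; ring_nf

theorem conj_zc_mul (h : GaussDecay φ) :
    GaussDecay (fun x => (starRingEnd ℂ) (zc x) * φ x) := by
  simpa using h.conjugate.zc_mul.conjugate

theorem integrable (h : GaussDecay φ) : Integrable φ := by
  obtain ⟨hc, C, δ, hC, hδ, hb⟩ := h
  exact ((integrable_gauss hδ).const_mul C).mono' hc.aestronglyMeasurable
    (Filter.Eventually.of_forall hb)

theorem memLp_two (h : GaussDecay φ) : MemLp φ 2 (volume : Measure Plane) := by
  rw [memLp_two_iff_integrable_sq_norm h.1.aestronglyMeasurable]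
  have := (h.mul h.conjugate).integrable.norm
  refine this.congr (Filter.Eventually.of_forall fun x => ?_)
  simp [sq]

end GaussDecay

theorem gaussDecay_landau {b : ℝ} (hb : 0 < b) (n : ℕ) {f : ℂ → ℂ} (hf : ExpType f) :
    GaussDecay (landau b n f) := by
  induction n generalizing f with
  | zero =>
    refine ⟨continuous_landau b 0 hf, ?_⟩
    obtain ⟨hd, C, A, hC, hA, hbd⟩ := hf
    refine ⟨C * Real.exp (2 * A ^ 2 / b), b / 8, by positivity, by positivity, fun x => ?_⟩
    rw [landau_zero, norm_mul, norm_gauss]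
    calc _ ≤ (C * Real.exp (A * ‖zc x‖)) * Real.exp (-(b / 4) * ‖x‖ ^ 2) := by
          gcongr; exact hbd _
      _ = C * Real.exp (A * ‖x‖ + -(b / 4) * ‖x‖ ^ 2) := by
          rw [norm_zc, mul_assoc, ← Real.exp_add]
      _ ≤ C * Real.exp (2 * A ^ 2 / b + -(b / 8) * ‖x‖ ^ 2) := by
          refine mul_le_mul_of_nonneg_left (Real.exp_le_exp.2 ?_) hC
          have : 2 * A ^ 2 / b + b / 8 * ‖x‖ ^ 2 - A * ‖x‖ = (b / 8) * (‖x‖ - 4 * A / b) ^ 2 := by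
            field_simp; ring
          have : 0 ≤ (b / 8) * (‖x‖ - 4 * A / b) ^ 2 := by positivity
          linarith
      _ = _ := by rw [mul_assoc, ← Real.exp_add]
  | succ n ih =>
    have := ((ih hf).conj_zc_mul.const_mul b).sub ((ih hf.deriv).const_mul 2)
    simp only [← mul_assoc] at this
    exact this

/-! ### Integration by parts -/

theorem integral_fderiv_apply_eq_zero {h : Plane → ℂ} (v : Plane) (hd : Differentiable ℝ h)
    (hi : Integrable h) (hi' : Integrable (fun x => fderiv ℝ h x v)) :
    ∫ x, fderiv ℝ h x v = 0 := by
  have := integral_mul_fderiv_eq_neg_fderiv_mul_of_integrable (μ := (volume : Measure Plane))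
    (f := h) (g := fun _ => (1 : ℂ)) (v := v) (by simpa using hi') (by simp) (by simpa using hi)
    (fun x _ => hd x) (fun x _ => differentiableAt_const _)
  simpa [eq_comm] using this

theorem integral_wirtinger_eq_zero {h A B : Plane → ℂ}
    (hd : ∀ x, HasFDerivAt h (A x • zcL + B x • zbL) x) (hi : Integrable h)
    (hA : Integrable A) (hB : Integrable B) : ∫ x, A x = 0 ∧ ∫ x, B x = 0 := by
  have hd' : Differentiable ℝ h := fun x => (hd x).differentiableAt
  have e0 : ∀ x, fderiv ℝ h x (EuclideanSpace.single 0 1) = A x + B x := fun x => by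
    rw [(hd x).fderiv]; simp [zc_single_zero]
  have e1 : ∀ x, fderiv ℝ h x (EuclideanSpace.single 1 1) = (A x - B x) * Complex.I := fun x => by
    rw [(hd x).fderiv]; simp [zc_single_one]; ring
  have h0 := integral_fderiv_apply_eq_zero (EuclideanSpace.single 0 1) hd' hi
    (by simp only [e0]; exact hA.add hB)
  have h1 := integral_fderiv_apply_eq_zero (EuclideanSpace.single 1 1) hd' hi
    (by simp only [e1]; exact (hA.sub hB).mul_const _)
  simp only [e0, e1] at h0 h1
  rw [integral_add hA hB] at h0
  rw [integral_mul_const, integral_sub hA hB, mul_eq_zero, or_iff_left Complex.I_ne_zero] at h1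
  constructor
  · linear_combination h0 / 2 + h1 / 2
  · linear_combination h0 / 2 - h1 / 2

/-! ### Ladder relations and orthogonality of the Landau functions. -/

theorem hasFDerivAt_conj_mul_landau (b : ℝ) (n m : ℕ) {f g : ℂ → ℂ} (hg : ExpType g)
    (hf : ExpType f) (x : Plane) :
    HasFDerivAt (fun x => conj (landau b n g x) * landau b m f x)
      ((conj (b * n * landau b (n - 1) g x - (b / 4 : ℂ) * zc x * landau b n g x) * landau b m f x +
        conj (landau b n g x) * (landau b m (deriv f) x - (b / 4 : ℂ) * conj (zc x) *
          landau b m f x)) • zcL +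
       (conj (landau b n (deriv g) x - (b / 4 : ℂ) * conj (zc x) * landau b n g x) *
          landau b m f x + conj (landau b n g x) * (b * m * landau b (m - 1) f x -
          (b / 4 : ℂ) * zc x * landau b m f x)) • zbL) x := by
  have h1 : HasFDerivAt (fun x => conj (landau b n g x)) _ x :=
    (Complex.conjCLE : ℂ →L[ℝ] ℂ).hasFDerivAt.comp x (hasFDerivAt_landau b n hg x)
  refine (h1.mul (hasFDerivAt_landau b m hf x)).congr_fderiv ?_
  ext v
  simp
  ring

section
variable {b : ℝ} (hb : 0 < b) {f g : ℂ → ℂ} (hg : ExpType g) (hf : ExpType f)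
include hb hg hf

theorem integrable_conj_mul_landau (n m : ℕ) :
    Integrable (fun x => conj (landau b n g x) * landau b m f x) :=
  ((gaussDecay_landau hb n hg).conjugate.mul (gaussDecay_landau hb m hf)).integrable

theorem landau_wirtinger (n m : ℕ) :
    (∫ x, (conj (b * n * landau b (n - 1) g x - (b / 4 : ℂ) * zc x * landau b n g x) *
        landau b m f x + conj (landau b n g x) * (landau b m (deriv f) x - (b / 4 : ℂ) *
          conj (zc x) * landau b m f x)) = 0) ∧
    (∫ x, (conj (landau b n (deriv g) x - (b / 4 : ℂ) * conj (zc x) * landau b n g x) *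
          landau b m f x + conj (landau b n g x) * (b * m * landau b (m - 1) f x -
          (b / 4 : ℂ) * zc x * landau b m f x)) = 0) := by
  have d := fun n => gaussDecay_landau hb n hf
  have e := fun n => gaussDecay_landau hb n hg
  have d' := gaussDecay_landau hb m hf.deriv
  have e' := gaussDecay_landau hb n hg.deriv
  refine integral_wirtinger_eq_zero (fun x => hasFDerivAt_conj_mul_landau b n m hg hf x)
    ((e n).conjugate.mul (d m)).integrable (GaussDecay.integrable ?_) (GaussDecay.integrable ?_)
  · refine ((((e (n - 1)).const_mul (b * n)).sub ?_).conjugate.mul (d m)).add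
      ((e n).conjugate.mul (d'.sub ?_))
    · simpa only [mul_assoc] using (e n).zc_mul.const_mul (b / 4)
    · simpa only [mul_assoc] using (d m).conj_zc_mul.const_mul (b / 4)
  · refine ((e'.sub ?_).conjugate.mul (d m)).add
      ((e n).conjugate.mul (((d (m - 1)).const_mul (b * m)).sub ?_))
    · simpa only [mul_assoc] using (e n).conj_zc_mul.const_mul (b / 4)
    · simpa only [mul_assoc] using (d m).zc_mul.const_mul (b / 4)

/-- The integral of a derivative of the product in the conjugate variable vanishes; this says that
lowering is the adjoint of raising, up to the factor `2 b m`. -/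
theorem integral_landau_raise (n m : ℕ) :
    ∫ x, conj (landau b (n + 1) g x) * landau b m f x =
      2 * b * m * ∫ x, conj (landau b n g x) * landau b (m - 1) f x := by
  have h := (landau_wirtinger hb hg hf n m).2
  have i1 := integrable_conj_mul_landau hb hg hf (n + 1) m
  have i2 := integrable_conj_mul_landau hb hg hf n (m - 1)
  have : ∀ x, (conj (landau b n (deriv g) x - (b / 4 : ℂ) * conj (zc x) * landau b n g x) *
          landau b m f x + conj (landau b n g x) * (b * m * landau b (m - 1) f x -
          (b / 4 : ℂ) * zc x * landau b m f x)) =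
      (-(1 / 2)) * (conj (landau b (n + 1) g x) * landau b m f x) +
        (b * m) * (conj (landau b n g x) * landau b (m - 1) f x) := by
    intro x
    simp [landau_succ, map_ofNat]
    ring
  simp only [this] at h
  rw [integral_add (i1.const_mul _) (i2.const_mul _), integral_const_mul, integral_const_mul] at h
  linear_combination -2 * h

/-- This is the Fock space adjunction: against the Gaussian, multiplication by `z` is adjoint to
`2/b` times differentiation. It comes from the vanishing integral of the `z`-derivative. -/
theorem integral_landau_zero_mul :
    ∫ x, conj (landau b 0 (fun w => w * g w) x) * landau b 0 f x =
      2 / b * ∫ x, conj (landau b 0 g x) * landau b 0 (deriv f) x := by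
  have h := (landau_wirtinger hb hg hf 0 0).1
  have i1 := integrable_conj_mul_landau hb (expType_id.mul hg) hf 0 0
  have i2 := integrable_conj_mul_landau hb hg hf.deriv 0 0
  have : ∀ x, (conj (b * (0 : ℕ) * landau b (0 - 1) g x - (b / 4 : ℂ) * zc x * landau b 0 g x) *
        landau b 0 f x + conj (landau b 0 g x) * (landau b 0 (deriv f) x - (b / 4 : ℂ) *
          conj (zc x) * landau b 0 f x)) =
      (-(b / 2)) * (conj (landau b 0 (fun w => w * g w) x) * landau b 0 f x) +
        (conj (landau b 0 g x) * landau b 0 (deriv f) x) := by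
    intro x
    simp [landau_zero, map_ofNat]
    ring
  simp only [this] at h
  rw [integral_add (i1.const_mul _) i2, integral_const_mul] at h
  have hb' : (b : ℂ) ≠ 0 := by exact_mod_cast hb.ne'
  field_simp
  linear_combination -2 * h

/-- Moving raising steps across the inner product lowers both levels together until one of them is
exhausted. -/
theorem integral_landau_level_ne {n m : ℕ} (h : n ≠ m) :
    ∫ x, conj (landau b n g x) * landau b m f x = 0 := by
  induction n generalizing m with
  | zero =>
    obtain ⟨m, rfl⟩ := Nat.exists_eq_succ_of_ne_zero h.symm
    have := integral_landau_raise hb hf hg m 0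
    rw [Nat.cast_zero, mul_zero, zero_mul] at this
    have h2 := congrArg conj this
    rw [← integral_conj] at h2
    simpa [mul_comm] using h2
  | succ n ih =>
    rw [integral_landau_raise hb hg hf]
    rcases m with _ | m
    · simp
    · rw [Nat.add_sub_cancel, ih (by omega), mul_zero]

theorem integral_landau_level (n : ℕ) :
    ∫ x, conj (landau b n g x) * landau b n f x =
      (2 * b) ^ n * n.factorial * ∫ x, conj (landau b 0 g x) * landau b 0 f x := by
  induction n with
  | zero => simp
  | succ n ih =>
    rw [integral_landau_raise hb hg hf, Nat.add_sub_cancel, ih, Nat.factorial_succ]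
    push_cast
    ring

end

/-- Division by `w` stays in the class. It lets the mean value property follow from the Fock
adjunction: `w * h` is orthogonal to the constants, whose derivative is zero. -/
theorem ExpType.exists_eq_mul_add {f : ℂ → ℂ} (hf : ExpType f) :
    ∃ h, ExpType h ∧ ∀ w, f w = w * h w + f 0 := by
  obtain ⟨hd, C, A, hC, hA, hb⟩ := hf
  have hh : Differentiable ℂ (dslope f 0) := by
    rw [← differentiableOn_univ] at hd ⊢
    exact (Complex.differentiableOn_dslope Filter.univ_mem).2 hd
  refine ⟨dslope f 0, ⟨hh, ?_⟩, fun w => ?_⟩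
  · obtain ⟨K, hK⟩ := (isCompact_closedBall (0 : ℂ) 1).exists_bound_of_continuousOn
      hh.continuous.continuousOn
    have hK0 : 0 ≤ K := (norm_nonneg _).trans (hK 0 (by simp))
    refine ⟨K + 2 * C, A, by positivity, hA, fun w => ?_⟩
    have he : 1 ≤ Real.exp (A * ‖w‖) := Real.one_le_exp (by positivity)
    rcases le_total ‖w‖ 1 with h | h
    · refine (hK w (by simpa using h)).trans ?_
      nlinarith
    · have hw : w ≠ 0 := fun h0 => by simp [h0] at h; linarith
      rw [dslope_of_ne _ hw, slope_def_field, sub_zero, norm_div, div_le_iff₀ (by linarith)]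
      have h0 := hb 0
      simp only [norm_zero, mul_zero, Real.exp_zero, mul_one] at h0
      calc ‖f w - f 0‖ ≤ ‖f w‖ + ‖f 0‖ := norm_sub_le _ _
        _ ≤ C * Real.exp (A * ‖w‖) + C := add_le_add (hb w) h0
        _ ≤ (K + 2 * C) * Real.exp (A * ‖w‖) := by nlinarith
        _ ≤ _ := le_mul_of_one_le_right (by positivity) h
  · have := sub_smul_dslope f 0 w
    simp only [sub_zero, smul_eq_mul] at this
    rw [this]; ring

theorem integral_gauss_sq {b : ℝ} (hb : 0 < b) :
    ∫ x, conj (landau b 0 (fun _ => 1) x) * landau b 0 (fun _ => 1) x =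
      ((2 * Real.pi / b : ℝ) : ℂ) := by
  have h := GaussianFourier.integral_rexp_neg_mul_sq_norm (V := Plane) (b := b / 2) (by positivity)
  rw [show (Module.finrank ℝ Plane : ℝ) / 2 = 1 by simp, Real.rpow_one] at h
  rw [show 2 * Real.pi / b = Real.pi / (b / 2) by field_simp, ← h, ← integral_complex_ofReal]
  refine integral_congr_ae (Filter.Eventually.of_forall fun x => ?_)
  simp only [landau_zero, one_mul, gauss_eq, Complex.conj_ofReal]
  rw [← Complex.ofReal_mul, ← Real.exp_add]
  congr 2; ring

/-- The mean value property. -/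
theorem integral_landau_zero_one {b : ℝ} (hb : 0 < b) {f : ℂ → ℂ} (hf : ExpType f) :
    ∫ x, conj (landau b 0 (fun _ => 1) x) * landau b 0 f x = ((2 * Real.pi / b : ℝ) : ℂ) * f 0 := by
  obtain ⟨h, hh, e⟩ := hf.exists_eq_mul_add
  have h1 := expType_const 1
  have e1 : f = fun w => w * h w + f 0 * 1 := by funext w; rw [e w]; ring
  have h0 : ∫ x, conj (landau b 0 (fun _ => 1) x) * landau b 0 (fun w => w * h w) x = 0 := by
    have := integral_landau_zero_mul hb hh h1
    simp only [deriv_const'] at this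
    have z : ∀ x, landau b 0 (fun _ => 0) x = 0 := fun x => by simp [landau_zero]
    simp only [z, mul_zero, integral_zero] at this
    have h2 := congrArg conj this
    rw [← integral_conj] at h2
    simpa [mul_comm] using h2
  have : ∀ x, conj (landau b 0 (fun _ => 1) x) * landau b 0 f x =
      conj (landau b 0 (fun _ => 1) x) * landau b 0 (fun w => w * h w) x +
      f 0 * (conj (landau b 0 (fun _ => 1) x) * landau b 0 (fun _ => 1) x) := by
    intro x
    conv_lhs => rw [e1]
    simp only [landau_zero]
    ring
  simp only [this]
  rw [integral_add (integrable_conj_mul_landau hb h1 (expType_id.mul hh) 0 0)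
    ((integrable_conj_mul_landau hb h1 h1 0 0).const_mul _), integral_const_mul, h0,
    integral_gauss_sq hb]
  ring

theorem integral_landau_zero_pow {b : ℝ} (hb : 0 < b) (m : ℕ) {f : ℂ → ℂ} (hf : ExpType f) :
    ∫ x, conj (landau b 0 (fun w => w ^ m) x) * landau b 0 f x =
      (2 / b) ^ m * (((2 * Real.pi / b : ℝ) : ℂ) * deriv^[m] f 0) := by
  induction m generalizing f with
  | zero => simpa using integral_landau_zero_one hb hf
  | succ m ih =>
    simp only [pow_succ' _ m]
    rw [integral_landau_zero_mul hb (expType_pow m) hf, ih hf.deriv, Function.iterate_succ_apply]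
    ring

theorem iterate_deriv_pow_zero (m k : ℕ) :
    deriv^[k] (fun w : ℂ => w ^ m) 0 = if k = m then (m.factorial : ℂ) else 0 := by
  rw [iter_deriv_pow]
  split_ifs with h
  · subst h
    rw [Nat.sub_self, pow_zero, mul_one, ← Nat.descFactorial_self, Nat.descFactorial_eq_prod_range]
    push_cast
    refine Finset.prod_congr rfl fun i hi => ?_
    rw [Nat.cast_sub (Finset.mem_range.1 hi).le]
  · rcases lt_or_gt_of_ne h with h | h
    · rw [zero_pow (by omega), mul_zero]
    · rw [Finset.prod_eq_zero (Finset.mem_range.2 h) (sub_self _), zero_mul]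

/-- The square of the norm of the `(n, m)`-th Landau function. -/
def landauNormSq (b : ℝ) (n m : ℕ) : ℝ :=
  (2 * b) ^ n * n.factorial * ((2 / b) ^ m * m.factorial * (2 * Real.pi / b))

theorem landauNormSq_pos {b : ℝ} (hb : 0 < b) (n m : ℕ) : 0 < landauNormSq b n m := by
  have := Real.pi_pos
  unfold landauNormSq; positivity

theorem integral_landau_pow {b : ℝ} (hb : 0 < b) (n m n' m' : ℕ) :
    ∫ x, conj (landau b n (fun w => w ^ m) x) * landau b n' (fun w => w ^ m') x =
      if n = n' ∧ m = m' then (landauNormSq b n m : ℂ) else 0 := by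
  by_cases hn : n = n'
  · subst hn
    rw [integral_landau_level hb (expType_pow m) (expType_pow m'),
      integral_landau_zero_pow hb m (expType_pow m'), iterate_deriv_pow_zero]
    by_cases hm : m = m'
    · subst hm
      simp only [landauNormSq, and_self, if_true]
      push_cast
      ring
    · simp [hm]
  · rw [integral_landau_level_ne hb (expType_pow m) (expType_pow m') hn]
    simp [hn]

theorem landau_apply_zero (b : ℝ) (n : ℕ) (f : ℂ → ℂ) :
    landau b n f 0 = (-2) ^ n * deriv^[n] f 0 := by
  induction n generalizing f with
  | zero => simp [landau_zero, gauss]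
  | succ n ih => simp [landau_succ, ih]; ring

/-- The radial function of the `n`-th Landau level, normalised by `1` at the origin. -/
def radial (b : ℝ) (n : ℕ) (x : Plane) : ℂ :=
  ((-2 : ℂ) ^ n * n.factorial)⁻¹ * landau b n (fun w => w ^ n) x

/-- Both sides only see the `n`-th derivative of `f` at the origin. So `radial b n` reproduces, up
to `2π/b`, the value at the origin of functions in its level and kills the other levels; a magnetic
translation turns it into the kernel of the level projection. -/
theorem integral_radial_mul_landau {b : ℝ} (hb : 0 < b) (n m : ℕ) {f : ℂ → ℂ} (hf : ExpType f) :
    ∫ x, conj (radial b n x) * landau b m f x =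
      if n = m then ((2 * Real.pi / b : ℝ) : ℂ) * landau b n f 0 else 0 := by
  have e : ∀ x, conj (radial b n x) * landau b m f x = conj (((-2 : ℂ) ^ n * n.factorial)⁻¹) *
      (conj (landau b n (fun w => w ^ n) x) * landau b m f x) := fun x => by
    rw [radial, map_mul]; ring
  simp only [e]
  rw [integral_const_mul]
  split_ifs with h
  · subst h
    rw [integral_landau_level hb (expType_pow n) hf, integral_landau_zero_pow hb n hf,
      landau_apply_zero]
    have hb' : (b : ℂ) ≠ 0 := by exact_mod_cast hb.ne'
    have hf' : (n.factorial : ℂ) ≠ 0 := by exact_mod_cast n.factorial_ne_zero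
    have h2 : (2 * (b : ℂ)) ^ n * (2 / b) ^ n = (-2) ^ n * (-2) ^ n := by
      rw [← mul_pow, ← mul_pow]; congr 1; field_simp
    simp only [map_inv₀, map_mul, map_pow, map_neg, map_natCast, map_ofNat]
    have h3 : ((-2 : ℂ) ^ n) ≠ 0 := pow_ne_zero _ (by norm_num)
    field_simp
    linear_combination (((2 * Real.pi / b : ℝ) : ℂ) * deriv^[n] f 0) * h2
  · rw [integral_landau_level_ne hb (expType_pow n) hf h, mul_zero]

theorem radial_zero (b : ℝ) (n : ℕ) : radial b n 0 = 1 := by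
  rw [radial, landau_apply_zero, iterate_deriv_pow_zero, if_pos rfl]
  have hf' : (n.factorial : ℂ) ≠ 0 := by exact_mod_cast n.factorial_ne_zero
  have h3 : ((-2 : ℂ) ^ n) ≠ 0 := pow_ne_zero _ (by norm_num)
  field_simp

/-! ### Injectivity of the Fourier transform on integrable functions -/

open scoped FourierTransform in
-- Every test function is the Fourier transform of a Schwartz function, so moving the transform onto
-- `F` shows that `F` integrates to zero against it.
theorem ae_eq_zero_of_fourier_eq_zero {F : Plane → ℂ} (hF : Integrable F)
    (h : ∀ ξ : Plane, 𝓕 F ξ = 0) : ∀ᵐ x, F x = 0 := by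
  refine ae_eq_zero_of_integral_contDiff_smul_eq_zero hF.locallyIntegrable fun g hg hgs => ?_
  have hg' : ContDiff ℝ ∞ (fun x => (g x : ℂ)) := Complex.ofRealCLM.contDiff.comp hg
  have hgs' : HasCompactSupport (fun x => (g x : ℂ)) :=
    hgs.comp_left (g := ((↑) : ℝ → ℂ)) Complex.ofReal_zero
  let S : SchwartzMap Plane ℂ := hgs'.toSchwartzMap hg'
  let h' : SchwartzMap Plane ℂ := 𝓕⁻ S
  have e1 : 𝓕 h' = S := by simp [h']
  have e2 : ∀ x, 𝓕 (⇑h') x = (g x : ℂ) := fun x => by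
    rw [← SchwartzMap.fourier_coe, e1]; rfl
  have key := VectorFourier.integral_fourierIntegral_smul_eq_flip (e := Real.fourierChar)
    (L := innerₗ Plane) (μ := (volume : Measure Plane)) (ν := (volume : Measure Plane))
    (f := F) (g := ⇑h') Real.continuous_fourierChar
    continuous_inner hF h'.integrable
  have l : ∀ ξ, VectorFourier.fourierIntegral Real.fourierChar volume (innerₗ Plane) F ξ = 0 := h
  have r : ∀ x, VectorFourier.fourierIntegral Real.fourierChar volume (innerₗ Plane).flip
      (⇑h') x = (g x : ℂ) := fun x => by
    rw [flip_innerₗ]; exact e2 x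
  simp only [l, r, smul_eq_mul, zero_mul, integral_zero] at key
  rw [key]
  refine integral_congr_ae (Filter.Eventually.of_forall fun x => ?_)
  simp [mul_comm]

/-! ### The orthonormal basis of Landau functions -/

theorem inner_toLp {φ : Plane → ℂ} (hφ : MemLp φ 2 (volume : Measure Plane)) (u : OneSp) :
    ⟪hφ.toLp φ, u⟫_ℂ = ∫ x, conj (φ x) * u x := by
  rw [L2.inner_def]
  refine integral_congr_ae ?_
  filter_upwards [hφ.coeFn_toLp] with x hx
  rw [hx, RCLike.inner_apply, mul_comm]

theorem inner_toLp_toLp {φ ψ : Plane → ℂ} (hφ : MemLp φ 2 (volume : Measure Plane))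
    (hψ : MemLp ψ 2 (volume : Measure Plane)) :
    ⟪hφ.toLp φ, hψ.toLp ψ⟫_ℂ = ∫ x, conj (φ x) * ψ x := by
  rw [inner_toLp]
  refine integral_congr_ae ?_
  filter_upwards [hψ.coeFn_toLp] with x hx
  rw [hx]

theorem integrable_conj_mul_Lp {φ : Plane → ℂ} (hφ : MemLp φ 2 (volume : Measure Plane))
    (u : OneSp) : Integrable (fun x => conj (φ x) * u x) :=
  MemLp.integrable_mul (p := 2) (q := 2) (hφ.star) (Lp.memLp u)

/-- The normalised Landau functions. -/
def landauN (b : ℝ) (i : ℕ × ℕ) (x : Plane) : ℂ :=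
  ((Real.sqrt (landauNormSq b i.1 i.2))⁻¹ : ℝ) * landau b i.1 (fun w => w ^ i.2) x

theorem landauN_gaussDecay {b : ℝ} (hb : 0 < b) (i : ℕ × ℕ) : GaussDecay (landauN b i) :=
  (gaussDecay_landau hb i.1 (expType_pow i.2)).const_mul _

theorem integral_landauN {b : ℝ} (hb : 0 < b) (i j : ℕ × ℕ) :
    ∫ x, conj (landauN b i x) * landauN b j x = if i = j then 1 else 0 := by
  have e : ∀ x, conj (landauN b i x) * landauN b j x =
      (((Real.sqrt (landauNormSq b i.1 i.2))⁻¹ : ℝ) * ((Real.sqrt (landauNormSq b j.1 j.2))⁻¹ : ℝ))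
      * (conj (landau b i.1 (fun w => w ^ i.2) x) * landau b j.1 (fun w => w ^ j.2) x) := by
    intro x
    simp only [landauN, map_mul, Complex.conj_ofReal]
    ring
  simp only [e]
  rw [integral_const_mul, integral_landau_pow hb]
  by_cases h : i = j
  · subst h
    rw [if_pos ⟨rfl, rfl⟩, if_pos rfl, ← Complex.ofReal_mul, ← Complex.ofReal_mul, ← mul_inv,
      Real.mul_self_sqrt (landauNormSq_pos hb _ _).le,
      inv_mul_cancel₀ (landauNormSq_pos hb _ _).ne', Complex.ofReal_one]
  · rw [if_neg h, if_neg (fun h' => h (Prod.ext h'.1 h'.2)), mul_zero]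

/-- The normalised Landau functions as elements of `L²`. -/
def landauVec {b : ℝ} (hb : 0 < b) (i : ℕ × ℕ) : OneSp :=
  (landauN_gaussDecay hb i).memLp_two.toLp (landauN b i)

theorem orthonormal_landauVec {b : ℝ} (hb : 0 < b) : Orthonormal ℂ (landauVec hb) := by
  rw [orthonormal_iff_ite]
  intro i j
  rw [landauVec, landauVec, inner_toLp_toLp, integral_landauN hb]

theorem gaussDecay_conj_pow_mul (k : ℕ) {φ : Plane → ℂ} (hφ : GaussDecay φ) :
    GaussDecay (fun x => conj (zc x) ^ k * φ x) := by
  induction k with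
  | zero => simpa using hφ
  | succ k ih => simpa only [pow_succ', mul_assoc] using ih.conj_zc_mul

theorem continuous_gauss (b : ℝ) : Continuous (gauss b) := by
  have := continuous_landau b 0 (expType_const 1)
  simpa [landau, Function.comp_def] using this

theorem gaussDecay_exp_norm {b : ℝ} (hb : 0 < b) (c : ℝ) :
    GaussDecay (fun x => (Real.exp (c * ‖x‖) : ℂ) * gauss b x) := by
  refine ⟨?_, Real.exp (2 * c ^ 2 / b), b / 8, by positivity, by positivity, fun x => ?_⟩
  · have := continuous_gauss b
    fun_prop
  · rw [norm_mul, norm_gauss, Complex.norm_real, Real.norm_of_nonneg (Real.exp_pos _).le,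
      ← Real.exp_add, ← Real.exp_add, Real.exp_le_exp]
    have : 2 * c ^ 2 / b + b / 8 * ‖x‖ ^ 2 - c * ‖x‖ = (b / 8) * (‖x‖ - 4 * c / b) ^ 2 := by
      field_simp; ring
    have : 0 ≤ (b / 8) * (‖x‖ - 4 * c / b) ^ 2 := by positivity
    linarith

section completeness

variable {b : ℝ} (hb : 0 < b) {u : OneSp}
  (hu : ∀ n m : ℕ, ∫ x, conj (landau b n (fun w => w ^ m) x) * u x = 0)
include hb hu

/-- The raising recursion, solved for its first term, expresses the conjugate coordinate times a
Landau function through Landau functions, so factors of the conjugate coordinate can be removed one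
at a time. -/
theorem integral_conj_pow_mul_landau (k n m : ℕ) :
    ∫ x, conj (conj (zc x) ^ k * landau b n (fun w => w ^ m) x) * u x = 0 := by
  have hb' : (b : ℂ) ≠ 0 := by exact_mod_cast hb.ne'
  induction k generalizing n m with
  | zero => simpa using hu n m
  | succ k ih =>
    have e : ∀ x, conj (conj (zc x) ^ (k + 1) * landau b n (fun w => w ^ m) x) * u x =
        (b : ℂ)⁻¹ * (conj (conj (zc x) ^ k * landau b (n + 1) (fun w => w ^ m) x) * u x) +
        (2 * m * (b : ℂ)⁻¹) * (conj (conj (zc x) ^ k * landau b n (fun w => w ^ (m - 1)) x) *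
          u x) := by
      intro x
      have : deriv (fun w : ℂ => w ^ m) = fun w => (m : ℂ) * w ^ (m - 1) := by
        funext w; simp
      rw [landau_succ, this, landau_const_mul b n _ (expType_pow _)]
      simp only [map_mul, map_pow, map_sub, Complex.conj_conj, Complex.conj_ofReal, map_natCast,
        map_ofNat]
      field_simp
      ring
    simp only [e]
    have hi : ∀ n m, Integrable (fun x => conj (conj (zc x) ^ k * landau b n (fun w => w ^ m) x) *
        u x) := fun n m => integrable_conj_mul_Lp
      (gaussDecay_conj_pow_mul k (gaussDecay_landau hb n (expType_pow m))).memLp_two u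
    rw [integral_add ((hi _ _).const_mul _) ((hi _ _).const_mul _), integral_const_mul,
      integral_const_mul, ih, ih]
    simp

theorem integral_pow_mul_gauss (c : ℂ) (k : ℕ) :
    ∫ x, conj ((c * zc x - conj (c * zc x)) ^ k * gauss b x) * u x = 0 := by
  have e : ∀ x, conj ((c * zc x - conj (c * zc x)) ^ k * gauss b x) * u x =
      ∑ j ∈ Finset.range (k + 1), (conj c ^ j * (-c) ^ (k - j) * (k.choose j : ℂ)) *
        (conj (conj (zc x) ^ (k - j) * landau b 0 (fun w => w ^ j) x) * u x) := by
    intro x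
    rw [sub_eq_add_neg, add_pow]
    simp only [map_mul, map_sum, Finset.sum_mul, map_pow, landau_zero, map_neg, Complex.conj_conj,
      map_natCast]
    refine Finset.sum_congr rfl fun j _ => ?_
    rw [neg_pow (c * zc x), neg_pow c]
    ring
  simp only [e]
  rw [integral_finsetSum]
  · refine Finset.sum_eq_zero fun j _ => ?_
    rw [integral_const_mul, integral_conj_pow_mul_landau hb hu, mul_zero]
  · intro j _
    exact (integrable_conj_mul_Lp (gaussDecay_conj_pow_mul _
      (gaussDecay_landau hb 0 (expType_pow j))).memLp_two u).const_mul _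

/-- The exponential series is integrated term by term; the dominating function `exp (2 ‖c‖ ‖x‖)`
times the Gaussian is square integrable and pairs with `u`. -/
theorem integral_cexp_mul_gauss (c : ℂ) :
    ∫ x, conj (Complex.exp (c * zc x - conj (c * zc x)) * gauss b x) * u x = 0 := by
  have hg := continuous_gauss b
  have hz : Continuous zc := zcL.continuous
  have hs := hasSum_integral_of_dominated_convergence (μ := (volume : Measure Plane))
    (F := fun (k : ℕ) x => (k.factorial : ℂ)⁻¹ *
      (conj ((c * zc x - conj (c * zc x)) ^ k * gauss b x) * u x))
    (f := fun x => conj (Complex.exp (c * zc x - conj (c * zc x)) * gauss b x) * u x)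
    (fun (k : ℕ) x => (2 * ‖c‖ * ‖x‖) ^ k / k.factorial * (‖gauss b x‖ * ‖u x‖)) ?_ ?_ ?_ ?_ ?_
  · simp only [integral_const_mul, integral_pow_mul_gauss hb hu, mul_zero] at hs
    exact hs.unique hasSum_zero
  · intro k
    refine (AEStronglyMeasurable.mul ?_ (Lp.aestronglyMeasurable u)).const_mul _
    refine Continuous.aestronglyMeasurable ?_
    fun_prop
  · intro k
    refine Filter.Eventually.of_forall fun x => ?_
    rw [norm_mul, norm_inv, Complex.norm_natCast, norm_mul, RCLike.norm_conj, norm_mul, norm_pow,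
      div_eq_inv_mul, mul_assoc, mul_assoc]
    gcongr
    calc ‖c * zc x - conj (c * zc x)‖ ≤ ‖c * zc x‖ + ‖conj (c * zc x)‖ := norm_sub_le _ _
      _ = 2 * ‖c‖ * ‖x‖ := by rw [RCLike.norm_conj, norm_mul, norm_zc]; ring
  · exact Filter.Eventually.of_forall fun x => (Real.summable_pow_div_factorial _).mul_right _
  · have : ∀ x, ∑' k : ℕ, (2 * ‖c‖ * ‖x‖) ^ k / k.factorial * (‖gauss b x‖ * ‖u x‖) =
        ‖conj ((Real.exp (2 * ‖c‖ * ‖x‖) : ℂ) * gauss b x) * u x‖ := by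
      intro x
      have he : ∑' k : ℕ, (2 * ‖c‖ * ‖x‖) ^ k / k.factorial = Real.exp (2 * ‖c‖ * ‖x‖) := by
        rw [Real.exp_eq_exp_ℝ, NormedSpace.exp_eq_tsum_div]
      rw [tsum_mul_right, he, norm_mul, RCLike.norm_conj, norm_mul, ← mul_assoc, Complex.norm_real,
        Real.norm_of_nonneg (Real.exp_pos _).le]
    simp only [this]
    exact (integrable_conj_mul_Lp
      (gaussDecay_exp_norm hb (2 * ‖c‖)).memLp_two u).norm
  · refine Filter.Eventually.of_forall fun x => ?_
    have := (NormedSpace.expSeries_div_hasSum_exp (c * zc x - conj (c * zc x)))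
    rw [← Complex.exp_eq_exp_ℂ] at this
    have h2 := ((Complex.hasSum_conj'.2 this).mul_right (conj (gauss b x))).mul_right (u x)
    have e : (fun k : ℕ => (k.factorial : ℂ)⁻¹ *
        (conj ((c * zc x - conj (c * zc x)) ^ k * gauss b x) * u x)) = fun k : ℕ =>
        conj ((c * zc x - conj (c * zc x)) ^ k / (k.factorial : ℂ)) * conj (gauss b x) * u x := by
      funext k
      simp only [map_mul, map_pow, map_div₀, map_natCast]
      ring
    rw [e, map_mul _ (Complex.exp _)]
    exact h2

theorem eq_zero_of_forall_integral_landau : u = 0 := by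
  have hg : Integrable (fun x => conj (gauss b x) * u x) := by
    have := integrable_conj_mul_Lp (gaussDecay_landau hb 0 (expType_const 1)).memLp_two u
    simpa [landau_zero] using this
  have := ae_eq_zero_of_fourier_eq_zero hg fun ξ => by
    rw [Real.fourier_eq']
    -- With this `c`, the exponent is `2πi` times the real inner product of `ξ` and `x`; its
    -- conjugate gives the Fourier character.
    have h := integral_cexp_mul_gauss hb hu (Real.pi * ((ξ 1 : ℂ) + ξ 0 * Complex.I))
    rw [← h]
    refine integral_congr_ae (Filter.Eventually.of_forall fun x => ?_)
    simp only [smul_eq_mul, map_mul, ← Complex.exp_conj]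
    rw [← mul_assoc]
    congr 3
    simp only [map_sub, map_mul, map_add, Complex.conj_ofReal, Complex.conj_I, Complex.conj_conj]
    rw [PiLp.inner_apply, Fin.sum_univ_two]
    simp only [zc, map_add, map_mul, Complex.conj_ofReal, Complex.conj_I]
    simp
    ring
  rw [Lp.eq_zero_iff_ae_eq_zero]
  filter_upwards [this] with x hx
  rcases mul_eq_zero.1 hx with h | h
  · rw [map_eq_zero] at h
    exact absurd h (Complex.exp_ne_zero _)
  · exact h

end completeness

/-- The Hilbert basis of normalised Landau functions. -/
def landauBasis {b : ℝ} (hb : 0 < b) : HilbertBasis (ℕ × ℕ) ℂ OneSp :=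
  HilbertBasis.mkOfOrthogonalEqBot (orthonormal_landauVec hb) (by
    rw [Submodule.eq_bot_iff]
    intro u hu
    refine eq_zero_of_forall_integral_landau hb fun n m => ?_
    have h1 : ⟪landauVec hb (n, m), u⟫_ℂ = 0 :=
      (Submodule.mem_orthogonal _ _).1 hu _ (Submodule.subset_span ⟨_, rfl⟩)
    rw [landauVec, inner_toLp] at h1
    have e : ∀ x, conj (landauN b (n, m) x) * u x = ((Real.sqrt (landauNormSq b n m))⁻¹ : ℝ) *
        (conj (landau b n (fun w => w ^ m) x) * u x) := fun x => by
      simp only [landauN, map_mul, Complex.conj_ofReal]; ring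
    simp only [e] at h1
    rw [integral_const_mul, mul_eq_zero] at h1
    refine h1.resolve_left ?_
    have := Real.sqrt_pos.2 (landauNormSq_pos hb n m)
    exact_mod_cast (inv_pos.2 this).ne')

theorem landauBasis_apply {b : ℝ} (hb : 0 < b) (i : ℕ × ℕ) :
    landauBasis hb i = landauVec hb i := by
  simp [landauBasis]

/-! ### The kernels of the Landau projections -/

/-- The wedge product of two vectors in the plane. -/
def wedge (x y : Plane) : ℝ := x 0 * y 1 - x 1 * y 0

theorem gauss_add (b : ℝ) (x w : Plane) :
    Complex.exp (-Complex.I * (b / 2 * wedge x w : ℝ)) * gauss b (x + w) =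
      gauss b x * (Complex.exp (-(b / 2 : ℂ) * conj (zc x) * zc w) * gauss b w) := by
  simp only [gauss, ← Complex.exp_add]
  congr 1
  apply Complex.ext <;> simp [wedge, zc] <;> ring

/-- The entire function by which a magnetic translation by `x` changes `f`. -/
def magShift (b : ℝ) (x : Plane) (f : ℂ → ℂ) (w : ℂ) : ℂ :=
  f (zc x + w) * Complex.exp (-(b / 2 : ℂ) * conj (zc x) * w)

theorem ExpType.magShift {f : ℂ → ℂ} (hf : ExpType f) (b : ℝ) (x : Plane) :
    ExpType (magShift b x f) :=
  (hf.comp_add (zc x)).mul (expType_exp _)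

/-- Magnetic translations commute with the raising operator: the shift of the conjugate coordinate
in the recursion is compensated by the derivative of the exponential in `magShift`. Hence they
preserve the level and only change the entire function. -/
theorem landau_magShift (b : ℝ) (n : ℕ) {f : ℂ → ℂ} (hf : ExpType f) (x w : Plane) :
    Complex.exp (-Complex.I * (b / 2 * wedge x w : ℝ)) * landau b n f (x + w) =
      gauss b x * landau b n (magShift b x f) w := by
  induction n generalizing f with
  | zero =>
    simp only [landau_zero, magShift]
    rw [zc_add]
    linear_combination (f (zc x + zc w)) * gauss_add b x w
  | succ n ih =>
    have hd : deriv (magShift b x f) = fun u => magShift b x (deriv f) u +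
        (-(b / 2 : ℂ) * conj (zc x)) * magShift b x f u := by
      funext u
      have h1 : HasDerivAt (fun u => f (zc x + u)) (deriv f (zc x + u)) u :=
        (hf.1 _).hasDerivAt.comp_const_add _ _
      have h2 : HasDerivAt (fun u => Complex.exp (-(b / 2 : ℂ) * conj (zc x) * u))
          (Complex.exp (-(b / 2 : ℂ) * conj (zc x) * u) * (-(b / 2 : ℂ) * conj (zc x))) u := by
        simpa using ((hasDerivAt_id u).const_mul (-(b / 2 : ℂ) * conj (zc x))).cexp
      have h3 : HasDerivAt (magShift b x f) _ u := h1.mul h2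
      rw [h3.deriv]
      simp only [magShift]
      ring
    rw [landau_succ, landau_succ, hd, landau_add b n (hf.deriv.magShift b x)
      ((hf.magShift b x).const_mul _), landau_const_mul b n _ (hf.magShift b x), zc_add, map_add]
    linear_combination (b * (conj (zc x) + conj (zc w))) * ih hf - 2 * ih hf.deriv

/-- The integral kernel of the projection on the `n`-th Landau level. -/
def projKer (b : ℝ) (n : ℕ) (x y : Plane) : ℂ :=
  (b / (2 * Real.pi) : ℝ) * (Complex.exp (-Complex.I * (b / 2 * wedge x y : ℝ)) *
    conj (radial b n (y - x)))

theorem radial_gaussDecay {b : ℝ} (hb : 0 < b) (n : ℕ) : GaussDecay (radial b n) :=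
  (gaussDecay_landau hb n (expType_pow n)).const_mul _

theorem wedge_self_add (x w : Plane) : wedge x (x + w) = wedge x w := by simp [wedge]; ring

/-- A magnetic translation moves `x` to the origin, where `radial b n` is reproducing. -/
theorem integral_projKer_mul_landau {b : ℝ} (hb : 0 < b) (n m : ℕ) {f : ℂ → ℂ} (hf : ExpType f)
    (x : Plane) : ∫ y, projKer b n x y * landau b m f y = if n = m then landau b n f x else 0 := by
  rw [← integral_add_left_eq_self _ x]
  have e : ∀ w, projKer b n x (x + w) * landau b m f (x + w) = ((b / (2 * Real.pi) : ℝ) *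
      gauss b x) * (conj (radial b n w) * landau b m (magShift b x f) w) := by
    intro w
    rw [projKer, add_sub_cancel_left, wedge_self_add]
    linear_combination ((b / (2 * Real.pi) : ℝ) * conj (radial b n w)) *
      landau_magShift b m hf x w
  simp only [e]
  rw [integral_const_mul, integral_radial_mul_landau hb n m (hf.magShift b x)]
  split_ifs with h
  · subst h
    have := landau_magShift b n hf x 0
    rw [add_zero] at this
    have h0 : wedge x 0 = 0 := by simp [wedge]
    rw [h0] at this
    simp only [mul_zero, Complex.ofReal_zero, Complex.exp_zero, one_mul] at this
    rw [this]
    have hb' : (b : ℂ) ≠ 0 := by exact_mod_cast hb.ne'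
    have hp : (Real.pi : ℂ) ≠ 0 := by exact_mod_cast Real.pi_ne_zero
    push_cast
    field_simp
  · simp

theorem continuous_radial (b : ℝ) (n : ℕ) : Continuous (radial b n) :=
  continuous_const.mul (continuous_landau b n (expType_pow n))

theorem continuous_projKer (b : ℝ) (n : ℕ) :
    Continuous (fun p : Plane × Plane => projKer b n p.1 p.2) := by
  have := continuous_radial b n
  unfold projKer wedge
  fun_prop

/-- The radial function reproduces its own value `1` at the origin. -/
theorem integral_norm_sq_radial {b : ℝ} (hb : 0 < b) (n : ℕ) :
    ∫ x, ‖radial b n x‖ ^ 2 = 2 * Real.pi / b := by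
  have hf : ExpType fun w => (((-2 : ℂ) ^ n * n.factorial)⁻¹) * w ^ n := (expType_pow n).const_mul _
  have e : ∀ x, landau b n (fun w => (((-2 : ℂ) ^ n * n.factorial)⁻¹) * w ^ n) x = radial b n x :=
    fun x => by rw [landau_const_mul b n _ (expType_pow n), radial]
  have h := integral_radial_mul_landau hb n n hf
  simp only [e, if_true, radial_zero, mul_one] at h
  have e2 : ∀ x, conj (radial b n x) * radial b n x = ((‖radial b n x‖ ^ 2 : ℝ) : ℂ) := fun x => by
    rw [mul_comm, Complex.mul_conj, Complex.normSq_eq_norm_sq]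
  simp only [e2] at h
  rw [integral_complex_ofReal] at h
  exact_mod_cast h

theorem norm_exp_neg_I_mul (t : ℝ) : ‖Complex.exp (-Complex.I * (t : ℂ))‖ = 1 := by
  rw [Complex.norm_exp]; simp

theorem norm_projKer {b : ℝ} (hb : 0 < b) (n : ℕ) (x y : Plane) :
    ‖projKer b n x y‖ = b / (2 * Real.pi) * ‖radial b n (y - x)‖ := by
  have := Real.pi_pos
  rw [projKer, norm_mul, norm_mul, norm_exp_neg_I_mul, one_mul, RCLike.norm_conj,
    Complex.norm_real, Real.norm_of_nonneg (by positivity)]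

theorem memLp_radial_sub {b : ℝ} (hb : 0 < b) (n : ℕ) (x : Plane) :
    MemLp (fun y => radial b n (y - x)) 2 (volume : Measure Plane) := by
  have h := (radial_gaussDecay hb n).memLp_two
  have h2 := measurePreserving_sub_right (volume : Measure Plane) x
  exact MemLp.comp_measurePreserving (g := radial b n) (f := fun y => y - x) h h2

theorem continuous_projKer_right (b : ℝ) (n : ℕ) (x : Plane) :
    Continuous (fun y => projKer b n x y) := by
  have := continuous_projKer b n
  fun_prop

theorem memLp_projKer {b : ℝ} (hb : 0 < b) (n : ℕ) (x : Plane) :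
    MemLp (fun y => conj (projKer b n x y)) 2 (volume : Measure Plane) := by
  have hpi := Real.pi_pos
  have h1 := (memLp_radial_sub hb n x).const_mul (((b / (2 * Real.pi) : ℝ) : ℂ))
  refine h1.mono ?_ ?_
  · exact (Complex.continuous_conj.comp (continuous_projKer_right b n x)).aestronglyMeasurable
  · refine Filter.Eventually.of_forall fun y => ?_
    rw [RCLike.norm_conj, norm_projKer hb, norm_mul, Complex.norm_real,
      Real.norm_of_nonneg (by positivity)]

theorem norm_sq_toLp {φ : Plane → ℂ} (hφ : MemLp φ 2 (volume : Measure Plane)) :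
    ‖hφ.toLp φ‖ ^ 2 = ∫ x, ‖φ x‖ ^ 2 := by
  have h := inner_self_eq_norm_sq (𝕜 := ℂ) (hφ.toLp φ)
  rw [inner_toLp_toLp] at h
  have e2 : ∀ x, conj (φ x) * φ x = ((‖φ x‖ ^ 2 : ℝ) : ℂ) := fun x => by
    rw [mul_comm, Complex.mul_conj, Complex.normSq_eq_norm_sq]
  simp only [e2] at h
  rw [integral_complex_ofReal] at h
  rw [← h]
  exact Complex.ofReal_re _

/-- The function `y ↦ conj Π_n(x, y)` as an element of `L²`. -/
def projVec {b : ℝ} (hb : 0 < b) (n : ℕ) (x : Plane) : OneSp := (memLp_projKer hb n x).toLp _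

theorem norm_projVec {b : ℝ} (hb : 0 < b) (n : ℕ) (x : Plane) :
    ‖projVec hb n x‖ ^ 2 = b / (2 * Real.pi) := by
  rw [projVec, norm_sq_toLp]
  have e : ∀ y, ‖conj (projKer b n x y)‖ ^ 2 = (b / (2 * Real.pi)) ^ 2 * ‖radial b n (y - x)‖ ^ 2 :=
    fun y => by rw [RCLike.norm_conj, norm_projKer hb]; ring
  simp only [e]
  rw [integral_const_mul, integral_sub_right_eq_self (fun y => ‖radial b n y‖ ^ 2),
    integral_norm_sq_radial hb]
  have := Real.pi_pos
  field_simp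

theorem inner_projVec {b : ℝ} (hb : 0 < b) (n : ℕ) (x : Plane) (u : OneSp) :
    ⟪projVec hb n x, u⟫_ℂ = ∫ y, projKer b n x y * u y := by
  rw [projVec, inner_toLp]; simp

theorem inner_projVec_landauBasis {b : ℝ} (hb : 0 < b) (n : ℕ) (x : Plane) (i : ℕ × ℕ) :
    ⟪projVec hb n x, landauBasis hb i⟫_ℂ = if n = i.1 then landauN b i x else 0 := by
  rw [landauBasis_apply, landauVec, projVec, inner_toLp_toLp]
  have e : ∀ y, conj (conj (projKer b n x y)) * landauN b i y =
      ((Real.sqrt (landauNormSq b i.1 i.2))⁻¹ : ℝ) *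
      (projKer b n x y * landau b i.1 (fun w => w ^ i.2) y) := fun y => by
    rw [Complex.conj_conj, landauN]; ring
  simp only [e]
  rw [integral_const_mul, integral_projKer_mul_landau hb n i.1 (expType_pow _)]
  split_ifs with h
  · subst h; rfl
  · simp

/-- Cauchy-Schwarz in the reproducing formula: the norms of the kernel and of the radial function
are `√(b/2π)` and `√(2π/b)`, with product exactly one. -/
theorem norm_radial_le {b : ℝ} (hb : 0 < b) (n : ℕ) (x : Plane) : ‖radial b n x‖ ≤ 1 := by
  have hf : ExpType fun w => (((-2 : ℂ) ^ n * n.factorial)⁻¹) * w ^ n := (expType_pow n).const_mul _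
  have e : ∀ x, landau b n (fun w => (((-2 : ℂ) ^ n * n.factorial)⁻¹) * w ^ n) x = radial b n x :=
    fun x => by rw [landau_const_mul b n _ (expType_pow n), radial]
  have h := integral_projKer_mul_landau hb n n hf x
  simp only [e, if_true] at h
  set v : OneSp := (radial_gaussDecay hb n).memLp_two.toLp _ with hv
  have h2 : ⟪projVec hb n x, v⟫_ℂ = radial b n x := by
    rw [projVec, inner_toLp_toLp, ← h]; simp
  have h3 := norm_inner_le_norm (𝕜 := ℂ) (projVec hb n x) v
  rw [h2] at h3
  have h4 : ‖v‖ ^ 2 = 2 * Real.pi / b := by rw [hv, norm_sq_toLp, integral_norm_sq_radial hb]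
  have h5 := norm_projVec hb n x
  have h6 : (‖projVec hb n x‖ * ‖v‖) ^ 2 = 1 := by
    rw [mul_pow, h4, h5]
    have := Real.pi_pos
    field_simp
  have h7 : ‖projVec hb n x‖ * ‖v‖ = 1 := by
    rw [← Real.sqrt_one, ← h6, Real.sqrt_sq (by positivity)]
  exact h3.trans_eq h7

theorem norm_projKer_le {b : ℝ} (hb : 0 < b) (n : ℕ) (x y : Plane) :
    ‖projKer b n x y‖ ≤ b / (2 * Real.pi) := by
  rw [norm_projKer hb]
  have := Real.pi_pos
  exact mul_le_of_le_one_right (by positivity) (norm_radial_le hb _ _)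

theorem IsTest.integrable {φ : Plane → ℂ} (h : IsTest φ) : Integrable φ :=
  h.1.continuous.integrable_of_hasCompactSupport h.2

theorem IsTest.conj {φ : Plane → ℂ} (h : IsTest φ) : IsTest (fun x => conj (φ x)) :=
  ⟨(Complex.conjCLE : ℂ →L[ℝ] ℂ).contDiff.comp h.1, h.2.comp_left (g := fun z => (starRingEnd ℂ) z) (map_zero _)⟩

/-- The integral is a bounded functional of `u`, so it may be evaluated term by term on the Landau
expansion, where only the level `n` survives. This identifies `projKer` as the kernel of the level
projection without any convergence of kernels. -/
theorem hasSum_integral_inner_projVec {b : ℝ} (hb : 0 < b) (n : ℕ) {φ : Plane → ℂ} (hφ : IsTest φ)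
    (u : OneSp) : HasSum (fun m => ⟪hφ.memLp.toLp φ, landauBasis hb (n, m)⟫_ℂ *
      ⟪landauBasis hb (n, m), u⟫_ℂ) (∫ x, conj (φ x) * ⟪projVec hb n x, u⟫_ℂ) := by
  have hm : ∀ u : OneSp, Integrable (fun x => conj (φ x) * ⟪projVec hb n x, u⟫_ℂ) := by
    intro u
    have h1 : AEStronglyMeasurable (fun x => ⟪projVec hb n x, u⟫_ℂ) (volume : Measure Plane) := by
      simp only [inner_projVec]
      refine AEStronglyMeasurable.integral_prod_right'
        (f := fun p : Plane × Plane => projKer b n p.1 p.2 * u p.2) ?_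
      exact (continuous_projKer b n).aestronglyMeasurable.mul
        (Lp.aestronglyMeasurable u).comp_snd
    refine Integrable.mono (hφ.integrable.norm.mul_const (Real.sqrt (b / (2 * Real.pi)) * ‖u‖))
      (hφ.conj.integrable.aestronglyMeasurable.mul h1) (Filter.Eventually.of_forall fun x => ?_)
    rw [norm_mul, RCLike.norm_conj, norm_mul, norm_norm,
      Real.norm_of_nonneg (by positivity : 0 ≤ Real.sqrt (b / (2 * Real.pi)) * ‖u‖)]
    gcongr
    refine (norm_inner_le_norm _ _).trans_eq ?_
    rw [← norm_projVec hb n x, Real.sqrt_sq (norm_nonneg _)]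
  let Λ : OneSp →L[ℂ] ℂ := LinearMap.mkContinuous
    { toFun := fun u => ∫ x, conj (φ x) * ⟪projVec hb n x, u⟫_ℂ
      map_add' := fun u v => by
        simp only [inner_add_right, mul_add]
        exact integral_add (hm u) (hm v)
      map_smul' := fun c u => by
        simp only [inner_smul_right, RingHom.id_apply, smul_eq_mul, ← integral_const_mul]
        refine integral_congr_ae (Filter.Eventually.of_forall fun x => ?_)
        simp only []
        ring }
    ((∫ x, ‖φ x‖) * Real.sqrt (b / (2 * Real.pi))) (fun u => by
      simp only [LinearMap.coe_mk, AddHom.coe_mk]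
      refine (norm_integral_le_integral_norm _).trans ?_
      rw [mul_assoc, ← integral_mul_const]
      refine integral_mono (hm u).norm (hφ.integrable.norm.mul_const _) fun x => ?_
      simp only [norm_mul, RCLike.norm_conj]
      gcongr
      refine (norm_inner_le_norm _ _).trans_eq ?_
      rw [← norm_projVec hb n x, Real.sqrt_sq (norm_nonneg _)])
  have hΛ : ∀ u, Λ u = ∫ x, conj (φ x) * ⟪projVec hb n x, u⟫_ℂ := fun u => rfl
  have h1 := ((landauBasis hb).hasSum_repr u).mapL Λ
  rw [← hΛ]
  have hinj : Function.Injective (fun m : ℕ => (n, m)) := fun a c h => (Prod.ext_iff.1 h).2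
  have e : ∀ i : ℕ × ℕ, Λ ((landauBasis hb).repr u i • landauBasis hb i) =
      if n = i.1 then ⟪hφ.memLp.toLp φ, landauBasis hb i⟫_ℂ * ⟪landauBasis hb i, u⟫_ℂ else 0 := by
    intro i
    rw [map_smul, hΛ, HilbertBasis.repr_apply_apply]
    simp only [inner_projVec_landauBasis]
    split_ifs with h
    · have : ⟪hφ.memLp.toLp φ, landauBasis hb i⟫_ℂ = ∫ x, conj (φ x) * landauN b i x := by
        rw [landauBasis_apply, landauVec, inner_toLp_toLp]
      rw [this, smul_eq_mul, mul_comm]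
    · simp
  simp only [e] at h1
  rw [← hinj.hasSum_iff] at h1
  · simpa [Function.comp_def] using h1
  · intro i hi
    rw [if_neg]
    rintro rfl
    exact hi ⟨i.2, rfl⟩

/-! ### Integration by parts for the covariant derivatives -/

theorem fderiv_conj_apply {φ : Plane → ℂ} {x : Plane} (hφ : DifferentiableAt ℝ φ x) (v : Plane) :
    fderiv ℝ (fun y => conj (φ y)) x v = conj (fderiv ℝ φ x v) := by
  have h : HasFDerivAt (fun y => conj (φ y)) _ x :=
    (Complex.conjCLE : ℂ →L[ℝ] ℂ).hasFDerivAt.comp x hφ.hasFDerivAt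
  rw [h.fderiv]
  simp

theorem contDiff_vecPot (b : ℝ) (j : Fin 2) : ContDiff ℝ ∞ (fun x => (vecPot b j x : ℂ)) := by
  refine Complex.ofRealCLM.contDiff.comp (f := vecPot b j) ?_
  have : vecPot b j = fun x => if j = 0 then -(b / 2) * x 1 else (b / 2) * x 0 := rfl
  rw [this]
  fin_cases j <;> simp <;> fun_prop

theorem contDiff_covDeriv (b : ℝ) (j : Fin 2) {φ : Plane → ℂ} (h : ContDiff ℝ ∞ φ) :
    ContDiff ℝ ∞ (covDeriv b j φ) := by
  have h1 : ContDiff ℝ ∞ (fun x => fderiv ℝ φ x (EuclideanSpace.single j 1)) :=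
    (h.fderiv_right (m := ∞) (by simp)).clm_apply contDiff_const
  exact h1.sub ((contDiff_const.mul (contDiff_vecPot b j)).mul h)

theorem IsTest.covDeriv {φ : Plane → ℂ} (h : IsTest φ) (b : ℝ) (j : Fin 2) :
    IsTest (covDeriv b j φ) := by
  refine ⟨contDiff_covDeriv b j h.1, ?_⟩
  refine HasCompactSupport.intro h.2 fun x hx => ?_
  have h1 : φ x = 0 := image_eq_zero_of_notMem_tsupport hx
  have h2 : fderiv ℝ φ x = 0 := by
    by_contra h3
    exact hx (support_fderiv_subset ℝ h3)
  simp [BdG.covDeriv, h1, h2]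

theorem IsTest.mul_left {φ ψ : Plane → ℂ} (h : IsTest φ) (hψ : ContDiff ℝ ∞ ψ) :
    IsTest (fun x => φ x * ψ x) :=
  ⟨h.1.mul hψ, h.2.mul_right⟩

theorem IsTest.neg_sum {φ ψ : Plane → ℂ} (h : IsTest φ) (h' : IsTest ψ) :
    IsTest (fun x => -(φ x + ψ x)) :=
  ⟨(h.1.add h'.1).neg, (h.2.add h'.2).comp_left (g := fun z => -z) neg_zero⟩

theorem IsTest.magLap {φ : Plane → ℂ} (h : IsTest φ) (b : ℝ) : IsTest (magLap b φ) := by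
  have := ((h.covDeriv b 0).covDeriv b 0).neg_sum ((h.covDeriv b 1).covDeriv b 1)
  refine cast (congrArg IsTest (funext fun x => ?_)) this
  simp [BdG.magLap, Fin.sum_univ_two]

theorem integral_conj_covDeriv (b : ℝ) (j : Fin 2) {φ ψ : Plane → ℂ} (hφ : IsTest φ)
    (hψ : ContDiff ℝ ∞ ψ) :
    ∫ x, conj (covDeriv b j φ x) * ψ x = -∫ x, conj (φ x) * covDeriv b j ψ x := by
  have i1 : Integrable (fun x => conj (covDeriv b j φ x) * ψ x) :=
    ((hφ.covDeriv b j).conj.mul_left hψ).integrable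
  have i2 : Integrable (fun x => conj (φ x) * covDeriv b j ψ x) :=
    (hφ.conj.mul_left (contDiff_covDeriv b j hψ)).integrable
  have ht := hφ.conj.mul_left hψ
  have e : ∀ x, fderiv ℝ (fun y => conj (φ y) * ψ y) x (EuclideanSpace.single j 1) =
      conj (covDeriv b j φ x) * ψ x + conj (φ x) * covDeriv b j ψ x := by
    intro x
    have d1 := hφ.1.differentiable (by simp) x
    have d2 := hφ.conj.1.differentiable (by simp) x
    have d3 := hψ.differentiable (by simp) x
    have h := (d2.hasFDerivAt.mul d3.hasFDerivAt).fderiv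
    have h' : fderiv ℝ (fun y => conj (φ y) * ψ y) x = _ := h
    rw [h']
    simp only [add_apply, smul_apply, smul_eq_mul, fderiv_conj_apply d1, covDeriv, map_sub, map_mul, Complex.conj_I,
      Complex.conj_ofReal]
    ring
  have h0 := integral_fderiv_apply_eq_zero (EuclideanSpace.single j 1)
    (ht.1.differentiable (by simp)) ht.integrable (by simp only [e]; exact i1.add i2)
  simp only [e] at h0
  rw [integral_add i1 i2] at h0
  exact eq_neg_of_add_eq_zero_left h0

theorem integral_conj_magLap (b : ℝ) {φ ψ : Plane → ℂ} (hφ : IsTest φ) (hψ : ContDiff ℝ ∞ ψ) :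
    ∫ x, conj (magLap b φ x) * ψ x = ∫ x, conj (φ x) * magLap b ψ x := by
  have h1 : ∀ j, ∫ x, conj (covDeriv b j (covDeriv b j φ) x) * ψ x =
      ∫ x, conj (φ x) * covDeriv b j (covDeriv b j ψ) x := fun j => by
    rw [integral_conj_covDeriv b j (hφ.covDeriv b j) hψ,
      integral_conj_covDeriv b j hφ (contDiff_covDeriv b j hψ), neg_neg]
  have i1 : ∀ j, Integrable (fun x => conj (covDeriv b j (covDeriv b j φ) x) * ψ x) := fun j =>
    (((hφ.covDeriv b j).covDeriv b j).conj.mul_left hψ).integrable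
  have i2 : ∀ j, Integrable (fun x => conj (φ x) * covDeriv b j (covDeriv b j ψ) x) := fun j =>
    (hφ.conj.mul_left (contDiff_covDeriv b j (contDiff_covDeriv b j hψ))).integrable
  simp only [magLap, Fin.sum_univ_two, map_neg, map_add, neg_mul, mul_neg, add_mul, mul_add]
  rw [integral_neg, integral_neg, integral_add (i1 0) (i1 1), integral_add (i2 0) (i2 1), h1, h1]

theorem contDiff_landauN (b : ℝ) (i : ℕ × ℕ) : ContDiff ℝ ∞ (landauN b i) :=
  contDiff_const.mul (contDiff_landau b i.1 (expType_pow i.2))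

theorem covDeriv_const_mul (b : ℝ) (j : Fin 2) {φ : Plane → ℂ} (hφ : Differentiable ℝ φ) (c : ℂ) :
    covDeriv b j (fun y => c * φ y) = fun x => c * covDeriv b j φ x := by
  funext x
  have := covDeriv_lin b j (hφ x) (hφ x) c 0
  simpa using this

theorem magLap_landauN (b : ℝ) (i : ℕ × ℕ) (x : Plane) :
    magLap b (landauN b i) x = (b * (2 * i.1 + 1) : ℝ) * landauN b i x := by
  have h := magLap_landau b i.1 (expType_pow i.2) x
  have hs := contDiff_landau b i.1 (expType_pow i.2)
  have e : landauN b i = fun x => ((Real.sqrt (landauNormSq b i.1 i.2))⁻¹ : ℝ) *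
    landau b i.1 (fun w => w ^ i.2) x := rfl
  simp only [magLap, Fin.sum_univ_two] at h ⊢
  rw [e, covDeriv_const_mul b 0 (hs.differentiable (by simp)),
    covDeriv_const_mul b 1 (hs.differentiable (by simp)),
    covDeriv_const_mul b 0 ((contDiff_covDeriv b 0 hs).differentiable (by simp)),
    covDeriv_const_mul b 1 ((contDiff_covDeriv b 1 hs).differentiable (by simp))]
  linear_combination ((Real.sqrt (landauNormSq b i.1 i.2))⁻¹ : ℝ) * h

theorem integral_conj_magLap_landauN (b : ℝ) {φ : Plane → ℂ} (hφ : IsTest φ) (i : ℕ × ℕ) :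
    ∫ x, conj (magLap b φ x) * landauN b i x =
      (b * (2 * i.1 + 1) : ℝ) * ∫ x, conj (φ x) * landauN b i x := by
  rw [integral_conj_magLap b hφ (contDiff_landauN b i), ← integral_const_mul]
  simp only [magLap_landauN, mul_left_comm]

/-! ### Extension of the weak equation to Landau functions -/

theorem covDeriv_mul (b : ℝ) (j : Fin 2) {g ψ : Plane → ℂ} (hg : Differentiable ℝ g)
    (hψ : Differentiable ℝ ψ) : covDeriv b j (fun y => g y * ψ y) = fun x =>
      fderiv ℝ g x (EuclideanSpace.single j 1) * ψ x + g x * covDeriv b j ψ x := by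
  funext x
  have h : fderiv ℝ (fun y => g y * ψ y) x = _ :=
    ((hg x).hasFDerivAt.mul (hψ x).hasFDerivAt).fderiv
  simp only [covDeriv]
  rw [h]
  simp only [add_apply, smul_apply, smul_eq_mul]
  ring

theorem covDeriv_covDeriv_dilate_mul (b : ℝ) (j : Fin 2) {χ ψ : Plane → ℂ} (hχ : ContDiff ℝ ∞ χ)
    (hψ : ContDiff ℝ ∞ ψ) (c : ℝ) (x : Plane) :
    covDeriv b j (covDeriv b j (fun y => χ (c • y) * ψ y)) x =
      (c ^ 2 : ℝ) * fderiv ℝ (fun y => fderiv ℝ χ y (EuclideanSpace.single j 1)) (c • x)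
        (EuclideanSpace.single j 1) * ψ x +
      2 * (c * fderiv ℝ χ (c • x) (EuclideanSpace.single j 1)) * covDeriv b j ψ x +
      χ (c • x) * covDeriv b j (covDeriv b j ψ) x := by
  set v : Plane := EuclideanSpace.single j 1
  have dil : ∀ {g : Plane → ℂ}, ContDiff ℝ ∞ g → ∀ y, HasFDerivAt (fun y => g (c • y))
      (c • fderiv ℝ g (c • y)) y := by
    intro g hg y
    have h1 := (hg.differentiable (by simp) (c • y)).hasFDerivAt
    have h2 : HasFDerivAt (fun y : Plane => c • y) (c • ContinuousLinearMap.id ℝ Plane) y :=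
      (ContinuousLinearMap.id ℝ Plane).hasFDerivAt.const_smul c
    refine (h1.comp y h2).congr_fderiv ?_
    ext w
    simp
  have hχ' : ContDiff ℝ ∞ (fun y => fderiv ℝ χ y v) :=
    (hχ.fderiv_right (m := ∞) (by simp)).clm_apply contDiff_const
  have hd1 : Differentiable ℝ (fun y => χ (c • y)) := fun y => (dil hχ y).differentiableAt
  have hd2 : Differentiable ℝ ψ := hψ.differentiable (by simp)
  have hd3 : Differentiable ℝ (fun y => fderiv ℝ χ (c • y) v) :=
    fun y => (dil hχ' y).differentiableAt
  have hd4 : Differentiable ℝ (covDeriv b j ψ) := (contDiff_covDeriv b j hψ).differentiable (by simp)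
  have e1 : covDeriv b j (fun y => χ (c • y) * ψ y) = fun y =>
      (c : ℂ) * (fderiv ℝ χ (c • y) v * ψ y) + 1 * (χ (c • y) * covDeriv b j ψ y) := by
    rw [covDeriv_mul b j hd1 hd2]
    funext y
    rw [(dil hχ y).fderiv]
    simp [v]
    ring
  rw [e1, covDeriv_lin b j (φ := fun y => fderiv ℝ χ (c • y) v * ψ y)
    (ψ := fun y => χ (c • y) * covDeriv b j ψ y) ((hd3 x).mul (hd2 x)) ((hd1 x).mul (hd4 x)),
    covDeriv_mul b j hd3 hd2, covDeriv_mul b j hd1 hd4]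
  simp only []
  rw [(dil hχ x).fderiv, (dil hχ' x).fderiv]
  simp [v]
  ring

theorem exists_cutoff : ∃ χ : Plane → ℂ, IsTest χ ∧ ∀ x, ‖x‖ ≤ 1 → χ x = 1 := by
  let f : ContDiffBump (0 : Plane) := ⟨1, 2, one_pos, one_lt_two⟩
  refine ⟨fun x => (f x : ℂ), ⟨Complex.ofRealCLM.contDiff.comp f.contDiff,
    f.hasCompactSupport.comp_left (g := fun z : ℝ => (z : ℂ)) Complex.ofReal_zero⟩, fun x hx => ?_⟩
  change ((f x : ℝ) : ℂ) = 1
  rw [f.one_of_mem_closedBall (by simpa using hx), Complex.ofReal_one]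

theorem IsTest.dilate {χ : Plane → ℂ} (h : IsTest χ) {c : ℝ} (hc : c ≠ 0) :
    IsTest (fun x => χ (c • x)) :=
  ⟨h.1.comp (contDiff_const_smul c), h.2.comp_smul hc⟩

theorem IsTest.exists_norm_le {χ : Plane → ℂ} (h : IsTest χ) : ∃ C, ∀ x, ‖χ x‖ ≤ C :=
  h.2.exists_bound_of_continuous h.1.continuous

theorem GaussDecay.covDeriv_landau {b : ℝ} (hb : 0 < b) (n : ℕ) {f : ℂ → ℂ} (hf : ExpType f)
    (j : Fin 2) : GaussDecay (covDeriv b j (landau b n f)) := by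
  have h1 := gaussDecay_landau hb (n + 1) hf
  have h2 := gaussDecay_landau hb (n - 1) hf
  fin_cases j
  · have e : covDeriv b 0 (landau b n f) = _ := funext fun y => covDeriv_zero_landau b n hf y
    exact e ▸ (h1.const_mul _).add (h2.const_mul _)
  · have e : covDeriv b 1 (landau b n f) = _ := funext fun y => covDeriv_one_landau b n hf y
    exact e ▸ ((h1.const_mul _).add (h2.const_mul _)).const_mul _

/-- The weak equation is only given on test functions. It is tested with dilated cutoffs times the
Landau function; the commutator terms carry factors `c` or `c²`, which tend to zero, and Gaussian
decay dominates everything. This replaces an argument for essential self-adjointness. -/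
theorem IsInverseOf.integral_landau {b w : ℝ} (hb : 0 < b) {R : OneSp →L[ℂ] OneSp}
    (hR : IsInverseOf b (fun _ => w) R) (n : ℕ) {f : ℂ → ℂ} (hf : ExpType f) (u : OneSp) :
    (b * (2 * n + 1) + w : ℝ) * ∫ x, conj (landau b n f x) * R u x =
      ∫ x, conj (landau b n f x) * u x := by
  obtain ⟨χ, hχ, hχ1⟩ := exists_cutoff
  set ψ := landau b n f
  have hψ : ContDiff ℝ ∞ ψ := contDiff_landau b n hf
  have gψ : GaussDecay ψ := gaussDecay_landau hb n hf
  let c : ℕ → ℝ := fun k => 1 / ((k : ℝ) + 1)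
  have hc0 : ∀ k, c k ≠ 0 := fun k => by positivity
  have hc1 : ∀ k, |c k| ≤ 1 := fun k => by
    rw [abs_of_nonneg (by positivity)]
    exact (div_le_one (by positivity)).2 (by linarith [k.cast_nonneg (α := ℝ)])
  have hc : Filter.Tendsto c Filter.atTop (nhds 0) := tendsto_one_div_add_atTop_nhds_zero_nat
  obtain ⟨C, hC⟩ := hχ.exists_norm_le
  have hχj : ∀ j : Fin 2, IsTest (fun y => fderiv ℝ χ y (EuclideanSpace.single j 1)) := fun j =>
    ⟨(hχ.1.fderiv_right (m := ∞) (by simp)).clm_apply contDiff_const, hχ.2.fderiv_apply ℝ _⟩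
  have hχjj : ∀ j : Fin 2, IsTest (fun y => fderiv ℝ
      (fun y => fderiv ℝ χ y (EuclideanSpace.single j 1)) y (EuclideanSpace.single j 1)) := fun j =>
    ⟨((hχj j).1.fderiv_right (m := ∞) (by simp)).clm_apply contDiff_const,
      (hχj j).2.fderiv_apply ℝ _⟩
  choose C₁ hC₁ using fun j => (hχj j).exists_norm_le
  choose C₂ hC₂ using fun j => (hχjj j).exists_norm_le
  have gD := fun j => GaussDecay.covDeriv_landau hb n hf j
  have heq := fun k => hR _ ((hχ.dilate (hc0 k)).mul_left hψ) u
  have ev : ∀ x : Plane, ∀ᶠ k in Filter.atTop, χ (c k • x) = 1 := by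
    intro x
    have : Filter.Tendsto (fun k => |c k| * ‖x‖) Filter.atTop (nhds 0) := by
      simpa using hc.abs.mul_const ‖x‖
    filter_upwards [this.eventually (ge_mem_nhds one_pos)] with k hk
    exact hχ1 _ (by rwa [norm_smul, Real.norm_eq_abs])
  have exp : ∀ k x, magLap b (fun y => χ (c k • y) * ψ y) x =
      χ (c k • x) * ((b * (2 * n + 1) : ℝ) * ψ x) - ∑ j : Fin 2,
        ((c k ^ 2 : ℝ) * fderiv ℝ (fun y => fderiv ℝ χ y (EuclideanSpace.single j 1)) (c k • x)
          (EuclideanSpace.single j 1) * ψ x +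
        2 * (c k * fderiv ℝ χ (c k • x) (EuclideanSpace.single j 1)) * covDeriv b j ψ x) := by
    intro k x
    rw [← magLap_landau b n hf x]
    simp only [magLap, Fin.sum_univ_two, covDeriv_covDeriv_dilate_mul b _ hχ.1 hψ]
    ring
  have t1 : Filter.Tendsto (fun k => ∫ x, conj (χ (c k • x) * ψ x) * u x) Filter.atTop
      (nhds (∫ x, conj (ψ x) * u x)) := by
    refine tendsto_integral_of_dominated_convergence (fun x => C * ‖conj (ψ x) * u x‖) (fun k => ?_)
      ((integrable_conj_mul_Lp gψ.memLp_two u).norm.const_mul C) (fun k => ?_) ?_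
    · exact (((hχ.dilate (hc0 k)).mul_left hψ).conj.1.continuous.aestronglyMeasurable).mul
        (Lp.aestronglyMeasurable u)
    · refine Filter.Eventually.of_forall fun x => ?_
      rw [map_mul, mul_assoc, norm_mul, RCLike.norm_conj]
      gcongr
      exact hC _
    · refine Filter.Eventually.of_forall fun x => tendsto_const_nhds.congr' ?_
      filter_upwards [ev x] with k hk
      rw [hk, one_mul]
  have t2 : Filter.Tendsto (fun k => ∫ x, conj (magLap b (fun y => χ (c k • y) * ψ y) x +
      (w : ℂ) * (χ (c k • x) * ψ x)) * R u x) Filter.atTop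
      (nhds (∫ x, conj ((b * (2 * n + 1) + w : ℝ) * ψ x) * R u x)) := by
    refine tendsto_integral_of_dominated_convergence (fun x =>
      (C * |b * (2 * n + 1)| + |w| * C + ∑ j, C₂ j) * ‖conj (ψ x) * R u x‖ +
        ∑ j : Fin 2, 2 * C₁ j * ‖conj (covDeriv b j ψ x) * R u x‖) (fun k => ?_) ?_ (fun k => ?_) ?_
    · have hk := (hχ.dilate (hc0 k)).mul_left hψ
      refine Continuous.aestronglyMeasurable ?_ |>.mul (Lp.aestronglyMeasurable (R u))
      exact Complex.continuous_conj.comp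
        ((hk.magLap b).1.continuous.add (continuous_const.mul hk.1.continuous))
    · refine ((integrable_conj_mul_Lp gψ.memLp_two _).norm.const_mul _).add
        (integrable_finsetSum _ fun j _ =>
          (integrable_conj_mul_Lp (gD j).memLp_two _).norm.const_mul _)
    · refine Filter.Eventually.of_forall fun x => ?_
      simp only [exp]
      simp only [norm_mul, RCLike.norm_conj, Fin.sum_univ_two, ← mul_assoc]
      rw [← add_mul, ← add_mul]
      refine mul_le_mul_of_nonneg_right ?_ (norm_nonneg _)
      have b1 := hC (c k • x)
      have b2 := fun j => hC₁ j (c k • x)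
      have b3 := fun j => hC₂ j (c k • x)
      have hck : ‖((c k : ℝ) : ℂ)‖ ≤ 1 := by rw [Complex.norm_real]; exact hc1 k
      have hck2 : ‖((c k ^ 2 : ℝ) : ℂ)‖ ≤ 1 := by
        rw [Complex.norm_real, norm_pow]; exact pow_le_one₀ (norm_nonneg _) (hc1 k)
      have q1 : ∀ j : Fin 2, ‖((c k ^ 2 : ℝ) : ℂ) * fderiv ℝ (fun y => fderiv ℝ χ y (EuclideanSpace.single j 1)) (c k • x)
          (EuclideanSpace.single j 1) * ψ x +
        2 * (c k * fderiv ℝ χ (c k • x) (EuclideanSpace.single j 1)) * covDeriv b j ψ x‖ ≤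
          C₂ j * ‖ψ x‖ + 2 * C₁ j * ‖covDeriv b j ψ x‖ := by
        intro j
        refine (norm_add_le _ _).trans ?_
        simp only [norm_mul, Complex.norm_ofNat]
        gcongr
        · calc _ ≤ 1 * C₂ j := mul_le_mul hck2 (b3 j) (norm_nonneg _) zero_le_one
            _ = _ := one_mul _
        · calc _ ≤ 1 * C₁ j := mul_le_mul hck (b2 j) (norm_nonneg _) zero_le_one
            _ = _ := one_mul _
      have q2 : ‖χ (c k • x) * (((b * (2 * n + 1) : ℝ) : ℂ) * ψ x)‖ ≤
          C * |b * (2 * n + 1)| * ‖ψ x‖ := by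
        rw [norm_mul, norm_mul, Complex.norm_real, Real.norm_eq_abs, mul_assoc]
        gcongr
      have q3 : ‖(w : ℂ) * (χ (c k • x) * ψ x)‖ ≤ |w| * C * ‖ψ x‖ := by
        rw [norm_mul, norm_mul, Complex.norm_real, Real.norm_eq_abs, mul_assoc]
        gcongr
      refine (norm_add_le _ _).trans ((add_le_add_left (norm_sub_le _ _) _).trans ?_)
      have q4 := norm_add_le
        (((c k ^ 2 : ℝ) : ℂ) * fderiv ℝ (fun y => fderiv ℝ χ y (EuclideanSpace.single 0 1)) (c k • x)
          (EuclideanSpace.single 0 1) * ψ x +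
        2 * (c k * fderiv ℝ χ (c k • x) (EuclideanSpace.single 0 1)) * covDeriv b 0 ψ x)
        (((c k ^ 2 : ℝ) : ℂ) * fderiv ℝ (fun y => fderiv ℝ χ y (EuclideanSpace.single 1 1)) (c k • x)
          (EuclideanSpace.single 1 1) * ψ x +
        2 * (c k * fderiv ℝ χ (c k • x) (EuclideanSpace.single 1 1)) * covDeriv b 1 ψ x)
      have q50 := q1 0
      have q51 := q1 1
      simp only [← mul_assoc] at q2 q3 q4 q50 q51 ⊢
      linarith
    · refine Filter.Eventually.of_forall fun x => ?_
      refine Filter.Tendsto.mul_const _ ?_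
      refine (Complex.continuous_conj.tendsto _).comp ?_
      simp only [exp]
      have hz : ∀ j : Fin 2, Filter.Tendsto (fun k =>
          ((c k ^ 2 : ℝ) : ℂ) * fderiv ℝ (fun y => fderiv ℝ χ y (EuclideanSpace.single j 1)) (c k • x)
          (EuclideanSpace.single j 1) * ψ x +
        2 * (c k * fderiv ℝ χ (c k • x) (EuclideanSpace.single j 1)) * covDeriv b j ψ x)
          Filter.atTop (nhds 0) := by
        intro j
        have hcx : Filter.Tendsto (fun k => c k • x) Filter.atTop (nhds 0) := by
          simpa using hc.smul_const x
        have hcc : Filter.Tendsto (fun k => (c k : ℂ)) Filter.atTop (nhds 0) := by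
          simpa [Function.comp_def] using (Complex.continuous_ofReal.tendsto 0).comp hc
        have hcc2 : Filter.Tendsto (fun k => ((c k ^ 2 : ℝ) : ℂ)) Filter.atTop (nhds 0) := by
          simpa using hcc.pow 2
        have l1 := (hcc2.mul (((hχjj j).1.continuous.tendsto 0).comp hcx)).mul_const (ψ x)
        have l2 := ((hcc.mul (((hχj j).1.continuous.tendsto 0).comp hcx)).const_mul 2).mul_const
          (covDeriv b j ψ x)
        simpa using l1.add l2
      have hz' := tendsto_finsetSum Finset.univ fun j _ => hz j
      have h1 : Filter.Tendsto (fun k => χ (c k • x)) Filter.atTop (nhds 1) :=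
        tendsto_const_nhds.congr' ((ev x).mono fun k hk => hk.symm)
      have := ((h1.mul_const (((b * (2 * n + 1) : ℝ) : ℂ) * ψ x)).sub hz').add
        ((h1.mul_const (ψ x)).const_mul (w : ℂ))
      convert this using 2
      simp
      ring
  have := tendsto_nhds_unique (t2.congr heq) t1
  rw [← this, ← integral_const_mul]
  simp only [map_mul, Complex.conj_ofReal, mul_assoc]

/-! ### Functional calculus on eigenvectors -/

section Calculus
variable {H : Type} [NormedAddCommGroup H] [InnerProductSpace ℂ H]

theorem aeval_apply_of_eq_smul {A : H →L[ℂ] H} {v : H} {t : ℝ} (hv : A v = (t : ℂ) • v)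
    (q : Polynomial ℝ) : Polynomial.aeval A q v = ((q.eval t : ℝ) : ℂ) • v := by
  induction q using Polynomial.induction_on with
  | C a => simp [Algebra.algebraMap_eq_smul_one]
  | add p q hp hq => simp [hp, hq, add_smul]
  | monomial n a h =>
    rw [pow_succ, ← mul_assoc, map_mul, Polynomial.aeval_X, mul_apply_eq_comp, hv,
      map_smul, h, smul_smul]
    simp only [Polynomial.eval_mul, Polynomial.eval_X, Complex.ofReal_mul]
    rw [mul_comm]

theorem cfc_apply_of_eq_smul [CompleteSpace H] {A : H →L[ℂ] H} (hA : IsSelfAdjoint A) {f : ℝ → ℝ}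
    (hf : Continuous f) {v : H} {t : ℝ} (hv : A v = (t : ℂ) • v) :
    cfc f A v = ((f t : ℝ) : ℂ) • v := by
  rw [← sub_eq_zero, ← norm_le_zero_iff]
  refine le_of_forall_pos_le_add fun ε hε => ?_
  obtain ⟨δ, hδ, hδ'⟩ : ∃ δ > 0, 2 * δ * ‖v‖ ≤ ε :=
    ⟨ε / (2 * (‖v‖ + 1)), by positivity, by
      have : 2 * (ε / (2 * (‖v‖ + 1))) * ‖v‖ = ε * (‖v‖ / (‖v‖ + 1)) := by field_simp
      rw [this]
      exact mul_le_of_le_one_right hε.le ((div_le_one (by positivity)).2 (by linarith))⟩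
  -- The approximation interval contains the spectrum and also `t`, so `t` need not be known to lie
  -- in the spectrum.
  set M := max (‖A‖ * ‖(1 : H →L[ℂ] H)‖) |t|
  obtain ⟨q, hq⟩ := exists_polynomial_near_of_continuousOn (-M) M f hf.continuousOn δ hδ
  have hs : ∀ x ∈ spectrum ℝ A, x ∈ Set.Icc (-M) M := fun x hx => by
    refine abs_le.1 ?_
    exact (spectrum.norm_le_norm_mul_of_mem hx).trans (le_max_left _ _)
  have h1 : ‖cfc f A - Polynomial.aeval A q‖ ≤ δ := by
    rw [← cfc_polynomial q A, ← cfc_sub f q.eval A hf.continuousOn q.continuous.continuousOn]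
    refine norm_cfc_le hδ.le fun x hx => ?_
    rw [norm_sub_rev]
    exact (hq x (hs x hx)).le
  have h2 : |q.eval t - f t| ≤ δ := (hq t (abs_le.1 (le_max_right _ _))).le
  have e : cfc f A v - ((f t : ℝ) : ℂ) • v =
      (cfc f A - Polynomial.aeval A q) v + ((q.eval t - f t : ℝ) : ℂ) • v := by
    rw [sub_apply, aeval_apply_of_eq_smul hv]
    push_cast
    module
  rw [e, zero_add]
  refine (norm_add_le _ _).trans (le_trans ?_ hδ')
  rw [norm_smul, Complex.norm_real, Real.norm_eq_abs]
  have := (cfc f A - Polynomial.aeval A q).le_of_opNorm_le h1 v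
  nlinarith [mul_le_mul_of_nonneg_right h2 (norm_nonneg v)]

/-! ### Diagonal operators -/

variable {ι : Type}

theorem memℓp_mul_of_bounded {d : ι → ℂ} {M : ℝ} (hd : ∀ i, ‖d i‖ ≤ M) (f : ι → ℂ)
    (hf : Memℓp f 2) : Memℓp (fun i => d i * f i) 2 := by
  refine (hf.const_smul (M : ℂ)).mono' fun i => ?_
  simp only [Pi.smul_apply, smul_eq_mul, norm_mul, Complex.norm_real]
  exact mul_le_mul_of_nonneg_right ((hd i).trans (le_abs_self M)) (norm_nonneg _)

/-- The operator that is diagonal in the Hilbert basis `B`, with bounded entries `d`. -/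
def diagOp (B : HilbertBasis ι ℂ H) (d : ι → ℂ) {M : ℝ} (hd : ∀ i, ‖d i‖ ≤ M) : H →L[ℂ] H :=
  LinearMap.mkContinuous
    { toFun := fun u => B.repr.symm ⟨fun i => d i * B.repr u i,
        memℓp_mul_of_bounded hd _ (B.repr u).2⟩
      map_add' := fun u v => by
        rw [← map_add]
        congr 1
        ext i
        change d i * (B.repr (u + v)) i = d i * B.repr u i + d i * B.repr v i
        rw [map_add]
        exact mul_add _ _ _
      map_smul' := fun c u => by
        rw [RingHom.id_apply, ← map_smul]
        congr 1
        ext i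
        change d i * (B.repr (c • u)) i = c * (d i * B.repr u i)
        rw [map_smul]
        exact mul_left_comm _ _ _ }
    |M| (fun u => by
      simp only [LinearMap.coe_mk, AddHom.coe_mk, LinearIsometryEquiv.norm_map]
      rw [← B.repr.norm_map u, ← Real.norm_eq_abs, ← norm_smul]
      refine lp.norm_mono (by simp) fun i => ?_
      simp only [lp.coeFn_smul, Pi.smul_apply, norm_smul, norm_mul, Real.norm_eq_abs]
      exact mul_le_mul_of_nonneg_right ((hd i).trans (le_abs_self M)) (norm_nonneg _))

theorem repr_diagOp (B : HilbertBasis ι ℂ H) (d : ι → ℂ) {M : ℝ} (hd : ∀ i, ‖d i‖ ≤ M) (u : H)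
    (i : ι) : B.repr (diagOp B d hd u) i = d i * B.repr u i := by
  simp [diagOp]

theorem HilbertBasis.ext_repr (B : HilbertBasis ι ℂ H) {u v : H}
    (h : ∀ i, B.repr u i = B.repr v i) : u = v :=
  B.repr.injective (lp.ext (funext h))

theorem HilbertBasis.ext_apply (B : HilbertBasis ι ℂ H) {A A' : H →L[ℂ] H}
    (h : ∀ i, A (B i) = A' (B i)) : A = A' := by
  refine ContinuousLinearMap.ext_on (s := Set.range B) ?_ (by rintro _ ⟨i, rfl⟩; exact h i)
  rw [Submodule.dense_iff_topologicalClosure_eq_top]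
  exact B.dense_span

theorem isSelfAdjoint_diagOp [CompleteSpace H] (B : HilbertBasis ι ℂ H) (d : ι → ℝ) {M : ℝ}
    (hd : ∀ i, ‖(d i : ℂ)‖ ≤ M) : IsSelfAdjoint (diagOp B (fun i => (d i : ℂ)) hd) := by
  rw [ContinuousLinearMap.isSelfAdjoint_iff_isSymmetric]
  intro u v
  simp only [ContinuousLinearMap.coe_coe]
  rw [← B.repr.inner_map_map, ← B.repr.inner_map_map u, lp.inner_eq_tsum, lp.inner_eq_tsum]
  refine tsum_congr fun i => ?_
  rw [repr_diagOp, repr_diagOp]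
  simp only [RCLike.inner_apply, map_mul, Complex.conj_ofReal]
  ring

theorem isPositive_diagOp [CompleteSpace H] (B : HilbertBasis ι ℂ H) (d : ι → ℝ) {M : ℝ}
    (hd : ∀ i, ‖(d i : ℂ)‖ ≤ M) (h0 : ∀ i, 0 ≤ d i) :
    (diagOp B (fun i => (d i : ℂ)) hd).IsPositive := by
  rw [ContinuousLinearMap.isPositive_def]
  refine ⟨isSelfAdjoint_diagOp B d hd |>.isSymmetric, fun u => ?_⟩
  rw [ContinuousLinearMap.reApplyInnerSelf_apply, ← B.repr.inner_map_map]
  have := (lp.hasSum_inner (𝕜 := ℂ) (B.repr (diagOp B (fun i => (d i : ℂ)) hd u)) (B.repr u))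
  have h := (Complex.reCLM.hasSum this)
  refine h.nonneg fun i => ?_
  simp only [Complex.reCLM_apply, repr_diagOp, RCLike.inner_apply, map_mul, Complex.conj_ofReal]
  have e : B.repr u i * ((d i : ℂ) * conj (B.repr u i)) = ((d i * ‖B.repr u i‖ ^ 2 : ℝ) : ℂ) := by
    push_cast
    rw [← Complex.mul_conj']
    ring
  rw [e, Complex.ofReal_re]
  exact mul_nonneg (h0 i) (by positivity)

end Calculus

/-! ### The Fermi-Dirac operator of a constant potential -/

/-- Only the point `0` is delicate; there `y ≤ exp y` with `y = 2/(rT)` gives a bound linear in `r`.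
-/
theorem continuous_fermiOfInverse {T : ℝ} (hT : 0 < T) (c : ℝ) :
    Continuous (fermiOfInverse T c) := by
  have hle : ∀ r, 0 ≤ fermiOfInverse T c r ∧
      fermiOfInverse T c r ≤ Real.exp (2 * c / T) * (T / 2) * |r| := by
    intro r
    rw [fermiOfInverse]
    split_ifs with h
    · exact ⟨le_rfl, by positivity⟩
    · push Not at h
      refine ⟨by positivity, ?_⟩
      rw [abs_of_pos h]
      have h1 : 2 / (r * T) ≤ Real.exp (2 / (r * T)) := by
        linarith [Real.add_one_le_exp (2 / (r * T))]
      have h2 : 2 * (1 / r - c) / T = 2 / (r * T) - 2 * c / T := by field_simp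
      have h3 : Real.exp (2 * (1 / r - c) / T) =
          Real.exp (2 / (r * T)) * (Real.exp (2 * c / T))⁻¹ := by
        rw [h2, Real.exp_sub, div_eq_mul_inv]
      calc (1 + Real.exp (2 * (1 / r - c) / T))⁻¹ ≤ (Real.exp (2 * (1 / r - c) / T))⁻¹ :=
            inv_anti₀ (Real.exp_pos _) (by linarith)
        _ = Real.exp (2 * c / T) * (Real.exp (2 / (r * T)))⁻¹ := by
            rw [h3, mul_inv, inv_inv, mul_comm]
        _ ≤ Real.exp (2 * c / T) * (2 / (r * T))⁻¹ := by gcongr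
        _ = _ := by rw [inv_div]; ring
  rw [continuous_iff_continuousAt]
  intro r
  rcases lt_trichotomy r 0 with h | h | h
  · refine (continuousAt_const (y := (0 : ℝ))).congr ?_
    filter_upwards [Iio_mem_nhds h] with x hx
    rw [fermiOfInverse, if_pos (le_of_lt hx)]
  · subst h
    have h0 : fermiOfInverse T c 0 = 0 := by rw [fermiOfInverse, if_pos le_rfl]
    rw [ContinuousAt, h0]
    refine tendsto_of_tendsto_of_tendsto_of_le_of_le (g := fun _ => (0 : ℝ))
      (h := fun r => Real.exp (2 * c / T) * (T / 2) * |r|) tendsto_const_nhds ?_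
      (fun r => (hle r).1) (fun r => (hle r).2)
    have : Continuous (fun r : ℝ => Real.exp (2 * c / T) * (T / 2) * |r|) := by fun_prop
    simpa using this.tendsto 0
  · have : ContinuousAt (fun r => (1 + Real.exp (2 * (1 / r - c) / T))⁻¹) r := by
      have hr := h.ne'
      refine ContinuousAt.inv₀ (by fun_prop (disch := assumption)) (by positivity)
    refine this.congr ?_
    filter_upwards [Ioi_mem_nhds h] with x hx
    rw [fermiOfInverse, if_neg (not_le.2 hx)]

theorem fermiOfInverse_inv {c e T : ℝ} (h : 0 < e + c) :
    fermiOfInverse T c (e + c)⁻¹ = (1 + Real.exp (2 * e / T))⁻¹ := by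
  rw [fermiOfInverse, if_neg (not_le.2 (inv_pos.2 h)), one_div, inv_inv, add_sub_cancel_right]

section Landau
variable {b w : ℝ} (hb : 0 < b)

theorem inner_landauBasis (i : ℕ × ℕ) (u : OneSp) :
    ⟪landauBasis hb i, u⟫_ℂ = ∫ x, conj (landauN b i x) * u x := by
  rw [landauBasis_apply, landauVec, inner_toLp]

theorem IsInverseOf.inner_landauBasis {R : OneSp →L[ℂ] OneSp}
    (hR : IsInverseOf b (fun _ => w) R) (i : ℕ × ℕ) (u : OneSp) :
    (b * (2 * i.1 + 1) + w : ℝ) * ⟪landauBasis hb i, R u⟫_ℂ = ⟪landauBasis hb i, u⟫_ℂ := by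
  rw [BdG.inner_landauBasis, BdG.inner_landauBasis]
  have := hR.integral_landau hb i.1 (expType_pow i.2) u
  simp only [landauN, map_mul, Complex.conj_ofReal, mul_assoc]
  rw [integral_const_mul, integral_const_mul, ← this]
  ring

include hb in
-- On a basis vector the weak equation says that the level energy times a non-negative number equals
-- one. Thus positivity of `R` forces the shift to exceed minus the lowest energy.
theorem IsInverseOf.pos_of_isPositive {R : OneSp →L[ℂ] OneSp} (hR : IsInverseOf b (fun _ => w) R)
    (hp : R.IsPositive) (i : ℕ × ℕ) : 0 < b * (2 * i.1 + 1) + w := by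
  have h := hR.inner_landauBasis hb i (landauBasis hb i)
  rw [inner_self_eq_one_of_norm_eq_one ((landauBasis hb).orthonormal.1 i)] at h
  have h2 : 0 ≤ (⟪landauBasis hb i, R (landauBasis hb i)⟫_ℂ).re := hp.re_inner_nonneg_right _
  have h3 := congrArg Complex.re h
  rw [Complex.re_ofReal_mul, Complex.one_re] at h3
  by_contra h4
  push Not at h4
  linarith [mul_nonpos_of_nonpos_of_nonneg h4 h2]

theorem IsInverseOf.apply_landauBasis {R : OneSp →L[ℂ] OneSp} (hR : IsInverseOf b (fun _ => w) R)
    (hp : R.IsPositive) (i : ℕ × ℕ) :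
    R (landauBasis hb i) = (((b * (2 * i.1 + 1) + w)⁻¹ : ℝ) : ℂ) • landauBasis hb i := by
  have h0 := hR.pos_of_isPositive hb hp i
  refine ext_inner_right ℂ fun u => ?_
  have hs : ⟪R (landauBasis hb i), u⟫_ℂ = ⟪landauBasis hb i, R u⟫_ℂ :=
    hp.isSelfAdjoint.isSymmetric _ _
  rw [hs, inner_smul_left, Complex.conj_ofReal, ← hR.inner_landauBasis hb i u, ← mul_assoc,
    ← Complex.ofReal_mul, inv_mul_cancel₀ h0.ne', Complex.ofReal_one, one_mul]

theorem IsFermiDirac.apply_landauBasis {T : ℝ} (hT : 0 < T) {γ : OneSp →L[ℂ] OneSp}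
    (h : IsFermiDirac b (fun _ => w) T γ) (i : ℕ × ℕ) :
    γ (landauBasis hb i) =
      (((1 + Real.exp (2 * (b * (2 * i.1 + 1) + w) / T))⁻¹ : ℝ) : ℂ) • landauBasis hb i := by
  obtain ⟨c, R, hp, hR, rfl⟩ := h
  have h1 := hR.apply_landauBasis hb hp i
  have h0 := hR.pos_of_isPositive hb hp i
  rw [opFun, cfc_apply_of_eq_smul hp.isSelfAdjoint (continuous_fermiOfInverse hT c) h1]
  rw [← add_assoc] at h0 ⊢
  rw [fermiOfInverse_inv h0]

include hb in
theorem exists_isInverseOf (hw : 0 < b + w) : ∃ R : OneSp →L[ℂ] OneSp, R.IsPositive ∧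
    IsInverseOf b (fun _ => w) R := by
  have h0 : ∀ i : ℕ × ℕ, b + w ≤ b * (2 * i.1 + 1) + w := fun i => by
    have : 0 ≤ b * i.1 := by positivity
    linarith
  have hd : ∀ i : ℕ × ℕ, ‖(((b * (2 * i.1 + 1) + w)⁻¹ : ℝ) : ℂ)‖ ≤ (b + w)⁻¹ := fun i => by
    rw [Complex.norm_real, Real.norm_of_nonneg (inv_nonneg.2 (hw.le.trans (h0 i)))]
    exact inv_anti₀ hw (h0 i)
  set R := diagOp (landauBasis hb) (fun i => (((b * (2 * i.1 + 1) + w)⁻¹ : ℝ) : ℂ)) hd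
  refine ⟨R, isPositive_diagOp _ _ hd fun i => inv_nonneg.2 (hw.le.trans (h0 i)), ?_⟩
  intro φ hφ u
  have hψ : IsTest (fun x => magLap b φ x + (w : ℂ) * φ x) :=
    ⟨(hφ.magLap b).1.add (contDiff_const.mul hφ.1), (hφ.magLap b).2.add hφ.2.mul_left⟩
  have hs : ∀ x y, ⟪x, R y⟫_ℂ = ⟪R x, y⟫_ℂ := fun x y =>
    ((isSelfAdjoint_diagOp (landauBasis hb) _ hd).isSymmetric x y).symm
  rw [← inner_toLp hψ.memLp, ← inner_toLp hφ.memLp, hs]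
  congr 1
  refine HilbertBasis.ext_repr (landauBasis hb) fun i => ?_
  refine (repr_diagOp (landauBasis hb) _ hd _ i).trans ?_
  have hN := (landauN_gaussDecay hb i).memLp_two
  have key : ∀ {χ : Plane → ℂ} (hχ : IsTest χ), (landauBasis hb).repr (hχ.memLp.toLp χ) i =
      conj (∫ x, conj (χ x) * landauN b i x) := fun hχ => by
    rw [HilbertBasis.repr_apply_apply, ← inner_conj_symm, landauBasis_apply, landauVec,
      inner_toLp_toLp]
  rw [key hψ, key hφ]
  have i1 : Integrable (fun x => conj (magLap b φ x) * landauN b i x) :=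
    ((hφ.magLap b).conj.mul_left (contDiff_landauN b i)).integrable
  have i2 : Integrable (fun x => conj (φ x) * landauN b i x) :=
    (hφ.conj.mul_left (contDiff_landauN b i)).integrable
  have e : ∫ x, conj (magLap b φ x + (w : ℂ) * φ x) * landauN b i x =
      (b * (2 * i.1 + 1) + w : ℝ) * ∫ x, conj (φ x) * landauN b i x := by
    simp only [map_add, map_mul, Complex.conj_ofReal, add_mul, mul_assoc]
    rw [integral_add i1 (i2.const_mul _), integral_conj_magLap_landauN b hφ, integral_const_mul]
    push_cast
    ring
  rw [e, map_mul, Complex.conj_ofReal, ← mul_assoc, ← Complex.ofReal_mul,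
    inv_mul_cancel₀ (hw.trans_le (h0 i)).ne', Complex.ofReal_one, one_mul]

include hb in
theorem exists_isFermiDirac (T w : ℝ) : ∃ γ : OneSp →L[ℂ] OneSp,
    IsFermiDirac b (fun _ => w) T γ := by
  -- The shift makes the lowest eigenvalue equal to one.
  obtain ⟨R, h1, h2⟩ := exists_isInverseOf hb (w := w + (1 - b - w)) (by linarith)
  exact ⟨_, 1 - b - w, R, h1, h2, rfl⟩

end Landau

/-! ### The Fermi-Dirac distribution and the density fixed point -/

/-- The occupation number of a level of energy `h` (relative to the chemical potential). -/
def fermi (T h : ℝ) : ℝ := (1 + Real.exp (2 * h / T))⁻¹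

theorem fermi_pos (T h : ℝ) : 0 < fermi T h := by unfold fermi; positivity

theorem fermi_lt_one (T h : ℝ) : fermi T h < 1 :=
  inv_lt_one_of_one_lt₀ (by linarith [Real.exp_pos (2 * h / T)])

theorem continuous_fermi (T : ℝ) : Continuous (fermi T) := by
  unfold fermi
  exact Continuous.inv₀ (by fun_prop) (fun h => by positivity)

theorem fermi_anti {T : ℝ} (hT : 0 < T) {h h' : ℝ} (hh : h ≤ h') : fermi T h' ≤ fermi T h := by
  unfold fermi
  gcongr

theorem fermi_le_exp (T h : ℝ) : fermi T h ≤ Real.exp (-(2 * h / T)) := by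
  rw [Real.exp_neg]
  exact inv_anti₀ (Real.exp_pos _) (by linarith)

section Density
variable {T b : ℝ} (hT : 0 < T) (hb : 0 < b)
include hT hb

omit hT hb in
theorem fermi_level_le (ν : ℝ) (n : ℕ) : fermi T (b * (2 * n + 1) - ν) ≤
    Real.exp (-(2 * (b - ν) / T)) * Real.exp (-(4 * b / T)) ^ n := by
  refine (fermi_le_exp _ _).trans_eq ?_
  rw [← Real.exp_nat_mul, ← Real.exp_add]
  congr 1
  ring

theorem summable_geometric_fermi : Summable (fun n : ℕ => Real.exp (-(4 * b / T)) ^ n) :=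
  summable_geometric_of_lt_one (Real.exp_pos _).le (Real.exp_lt_one_iff.2 (by
    have : 0 < 4 * b / T := by positivity
    linarith))

theorem summable_fermi (ν : ℝ) : Summable (fun n : ℕ => fermi T (b * (2 * n + 1) - ν)) :=
  Summable.of_nonneg_of_le (fun n => (fermi_pos _ _).le) (fermi_level_le ν)
    ((summable_geometric_fermi hT hb).mul_left _)

theorem continuous_tsum_fermi : Continuous (fun ν : ℝ => ∑' n : ℕ, fermi T (b * (2 * n + 1) - ν)) := by
  rw [continuous_iff_continuousAt]
  intro ν₀
  have : ContinuousOn (fun ν : ℝ => ∑' n : ℕ, fermi T (b * (2 * n + 1) - ν)) (Set.Iic (ν₀ + 1)) := by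
    refine continuousOn_tsum (fun n => Continuous.continuousOn ?_) (summable_fermi hT hb (ν₀ + 1)) ?_
    · exact (continuous_fermi T).comp (by fun_prop)
    · intro n ν hν
      rw [Real.norm_of_nonneg (fermi_pos _ _).le]
      exact fermi_anti hT (by linarith [Set.mem_Iic.1 hν])
  exact this.continuousAt (Iic_mem_nhds (by linarith))

omit hb in
-- The right side is the integral of the decreasing function `fermi T` from `x - d` to `x`. No
-- calculus is needed: exponentiated, the inequality is Jensen's for `exp` with weights `1 - p` and
-- `p`.
theorem fermi_mul_le_log (x d : ℝ) : fermi T x * d ≤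
    T / 2 * (Real.log (1 + Real.exp (-(2 * (x - d) / T))) - Real.log (1 + Real.exp (-(2 * x / T)))) := by
  set p := fermi T x with hp
  set D := 2 * d / T with hD
  have hp0 := fermi_pos T x
  have hp1 := fermi_lt_one T x
  have h1 : Real.exp (p * D) ≤ (1 - p) + p * Real.exp D := by
    have := convexOn_exp.2 (Set.mem_univ (0 : ℝ)) (Set.mem_univ D) (sub_nonneg.2 hp1.le) hp0.le
      (by ring)
    simpa [smul_eq_mul] using this
  have h2 : ((1 - p) + p * Real.exp D) * (1 + Real.exp (-(2 * x / T))) =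
      1 + Real.exp (-(2 * (x - d) / T)) := by
    have e : -(2 * (x - d) / T) = -(2 * x / T) + D := by rw [hD]; ring
    rw [e, Real.exp_add, hp, fermi, Real.exp_neg]
    have := Real.exp_pos (2 * x / T)
    field_simp
    ring
  have h3 : p * D ≤ Real.log (1 + Real.exp (-(2 * (x - d) / T))) -
      Real.log (1 + Real.exp (-(2 * x / T))) := by
    rw [← h2, Real.log_mul (by nlinarith [Real.exp_pos D]) (by positivity), add_sub_cancel_right]
    exact (Real.le_log_iff_exp_le (by nlinarith [Real.exp_pos D])).2 h1
  have h4 : p * d = T / 2 * (p * D) := by rw [hD]; field_simp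
  rw [h4]
  exact mul_le_mul_of_nonneg_left h3 (by positivity)

/-- Comparison of the sum with an integral: consecutive levels differ by `2 b`, so the previous
lemma telescopes. The lowest level is estimated by one, whence the term `b`. -/
theorem tsum_fermi_le (ν : ℝ) : b * ∑' n : ℕ, fermi T (b * (2 * n + 1) - ν) ≤
    b + T / 4 + max (ν - b) 0 / 2 := by
  set L : ℕ → ℝ := fun n => Real.log (1 + Real.exp (-(2 * (b * (2 * n + 1) - ν) / T))) with hL
  have hL0 : ∀ n, 0 ≤ L n := fun n => Real.log_nonneg 
    (le_add_of_nonneg_right (Real.exp_pos _).le)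
  have step : ∀ N : ℕ, b * ∑ n ∈ Finset.range (N + 1), fermi T (b * (2 * n + 1) - ν) ≤
      b + T / 4 * (L 0 - L N) := by
    intro N
    induction N with
    | zero =>
      simp only [zero_add, Finset.sum_range_one, sub_self, mul_zero, add_zero]
      exact mul_le_of_le_one_right hb.le (fermi_lt_one _ _).le
    | succ N ih =>
      rw [Finset.sum_range_succ, mul_add]
      have h := fermi_mul_le_log hT (b * (2 * ((N + 1 : ℕ) : ℝ) + 1) - ν) (2 * b)
      have e : 2 * (b * (2 * ((N + 1 : ℕ) : ℝ) + 1) - ν - 2 * b) / T =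
          2 * (b * (2 * N + 1) - ν) / T := by push_cast; ring
      rw [e] at h
      have : T / 4 * (L 0 - L (N + 1)) = T / 4 * (L 0 - L N) + T / 4 * (L N - L (N + 1)) := by ring
      rw [this]
      have h' : b * fermi T (b * (2 * ((N + 1 : ℕ) : ℝ) + 1) - ν) ≤ T / 4 * (L N - L (N + 1)) := by
        simp only [hL]
        linarith
      linarith
  have hlog : L 0 ≤ 1 + 2 / T * max (ν - b) 0 := by
    have e : L 0 = Real.log (1 + Real.exp (2 * (ν - b) / T)) := by
      simp only [hL]
      congr 3
      push_cast
      ring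
    rw [e, Real.log_le_iff_le_exp (by positivity), Real.exp_add]
    have h1 : 2 ≤ Real.exp 1 := by linarith [Real.add_one_le_exp 1]
    have h2 : Real.exp (2 * (ν - b) / T) ≤ Real.exp (2 / T * max (ν - b) 0) := by
      rw [Real.exp_le_exp, mul_div_right_comm]
      exact mul_le_mul_of_nonneg_left (le_max_left _ _) (by positivity)
    have h3 : 1 ≤ Real.exp (2 / T * max (ν - b) 0) := Real.one_le_exp (by positivity)
    nlinarith
  have hbd : ∀ N : ℕ, ∑ n ∈ Finset.range N, fermi T (b * (2 * n + 1) - ν) ≤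
      (b + T / 4 + max (ν - b) 0 / 2) / b := by
    intro N
    rw [le_div_iff₀ hb, mul_comm]
    have h1 : ∑ n ∈ Finset.range N, fermi T (b * (2 * n + 1) - ν) ≤
        ∑ n ∈ Finset.range (N + 1), fermi T (b * (2 * n + 1) - ν) :=
      Finset.sum_le_sum_of_subset_of_nonneg (by simp) fun _ _ _ => (fermi_pos _ _).le
    have h2 := step N
    have h3 : T / 4 * (L 0 - L N) ≤ T / 4 * (1 + 2 / T * max (ν - b) 0) :=
      mul_le_mul_of_nonneg_left (by linarith [hL0 N]) (by positivity)
    have h4 : T / 4 * (1 + 2 / T * max (ν - b) 0) = T / 4 + max (ν - b) 0 / 2 := by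
      field_simp
      ring
    nlinarith [mul_le_mul_of_nonneg_left h1 hb.le]
  have := Real.tsum_le_of_sum_range_le (fun n => (fermi_pos _ _).le) hbd
  rwa [le_div_iff₀ hb, mul_comm] at this

variable {g μ : ℝ} (hg : 0 ≤ g) (hg1 : g ≤ 1)
include hg hg1

/-- The density grows in `ν` at most with slope `1/(4π)`, which the factor `g ≤ 1` cannot bring up
to one, so the right side starts above the diagonal at `μ` and falls below it at large `ν`. -/
theorem exists_density_fixedPoint :
    ∃ ν, ν = μ + g * (b / (2 * Real.pi) * ∑' n : ℕ, fermi T (b * (2 * n + 1) - ν)) := by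
  set F : ℝ → ℝ := fun ν => μ + g * (b / (2 * Real.pi) * ∑' n : ℕ, fermi T (b * (2 * n + 1) - ν)) - ν
  have hF : Continuous F := by
    have := continuous_tsum_fermi hT hb
    fun_prop
  have hS : ∀ ν, 0 ≤ ∑' n : ℕ, fermi T (b * (2 * n + 1) - ν) := fun ν =>
    tsum_nonneg fun n => (fermi_pos _ _).le
  -- Any sufficiently large multiple would do; the estimate only needs `|μ| + (b + T/4 + ν₁/2)/6 ≤
  -- ν₁`.
  set ν₁ := 2 * (|μ| + b + T)
  have hμ := le_abs_self μ
  have h1 : F ν₁ ≤ 0 := by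
    have h2 := tsum_fermi_le hT hb ν₁
    have h3 : max (ν₁ - b) 0 ≤ ν₁ := max_le (by linarith) (by positivity)
    have h4 : b / (2 * Real.pi) * ∑' n : ℕ, fermi T (b * (2 * n + 1) - ν₁) ≤
        (b + T / 4 + ν₁ / 2) / 6 := by
      rw [div_mul_eq_mul_div, div_le_div_iff₀ (by positivity) (by norm_num)]
      have := Real.pi_gt_three
      have h5 : 0 ≤ b + T / 4 + ν₁ / 2 := by positivity
      nlinarith
    have h6 := mul_le_of_le_one_left (mul_nonneg (by positivity : 0 ≤ b / (2 * Real.pi)) (hS ν₁)) hg1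
    have : F ν₁ = μ + g * (b / (2 * Real.pi) * ∑' n : ℕ, fermi T (b * (2 * n + 1) - ν₁)) - ν₁ := rfl
    have e : ν₁ = 2 * (|μ| + b + T) := rfl
    nlinarith [abs_nonneg μ]
  have h0 : 0 ≤ F μ := by
    have := mul_nonneg hg (mul_nonneg (by positivity : 0 ≤ b / (2 * Real.pi)) (hS μ))
    simp only [F]
    linarith
  have hle : μ ≤ ν₁ := by
    have e : ν₁ = 2 * (|μ| + b + T) := rfl
    nlinarith [abs_nonneg μ]
  obtain ⟨ν, -, hν⟩ := intermediate_value_Icc' hle hF.continuousOn ⟨h1, h0⟩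
  exact ⟨ν, by simp only [F] at hν; linarith⟩

/-- The a priori form of the same comparison. It holds for every solution, which matters because
uniqueness of the normal state is not established and all normal states must be treated. -/
theorem density_fixedPoint_bounds {ν : ℝ}
    (hν : ν = μ + g * (b / (2 * Real.pi) * ∑' n : ℕ, fermi T (b * (2 * n + 1) - ν))) :
    μ ≤ ν ∧ ν ≤ 2 * |μ| + b / 4 + T / 4 := by
  have hS : 0 ≤ ∑' n : ℕ, fermi T (b * (2 * n + 1) - ν) := tsum_nonneg fun n => (fermi_pos _ _).le
  have hρ := mul_nonneg (by positivity : 0 ≤ b / (2 * Real.pi)) hS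
  refine ⟨by linarith [mul_nonneg hg hρ], ?_⟩
  by_contra hc
  push Not at hc
  have hμ := le_abs_self μ
  have hν0 : 0 ≤ ν := le_trans (by positivity) hc.le
  have h2 := tsum_fermi_le hT hb ν
  have h3 : max (ν - b) 0 ≤ ν := max_le (by linarith) hν0
  have h4 : b / (2 * Real.pi) * ∑' n : ℕ, fermi T (b * (2 * n + 1) - ν) ≤
      (b + T / 4 + ν / 2) / 6 := by
    rw [div_mul_eq_mul_div, div_le_div_iff₀ (by positivity) (by norm_num)]
    have := Real.pi_gt_three
    have h5 : 0 ≤ b + T / 4 + ν / 2 := by positivity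
    nlinarith
  have h6 := mul_le_of_le_one_left hρ hg1
  linarith [abs_nonneg μ]

end Density

/-! ### Integral kernels of functions of the Landau level -/

/-- The kernel `∑ₙ p n Πₙ(x, y)`. -/
def levelKer (b : ℝ) (p : ℕ → ℝ) (z : Plane × Plane) : ℂ := ∑' n, (p n : ℂ) * projKer b n z.1 z.2

section LevelKer
variable {b : ℝ} (hb : 0 < b) {p : ℕ → ℝ} (hp : ∀ n, 0 ≤ p n) (hs : Summable p)
include hb hp hs

omit hs in
theorem norm_mul_projKer_le (n : ℕ) (x y : Plane) :
    ‖(p n : ℂ) * projKer b n x y‖ ≤ p n * (b / (2 * Real.pi)) := by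
  rw [norm_mul, Complex.norm_real, Real.norm_of_nonneg (hp n)]
  exact mul_le_mul_of_nonneg_left (norm_projKer_le hb n x y) (hp n)

theorem continuous_levelKer : Continuous (levelKer b p) :=
  continuous_tsum (fun n => continuous_const.mul (continuous_projKer b n))
    (hs.mul_right (b / (2 * Real.pi))) fun n z => norm_mul_projKer_le hb hp n z.1 z.2

theorem hasKernel_levelKer {γ : OneSp →L[ℂ] OneSp}
    (hγ : ∀ i u, ⟪landauBasis hb i, γ u⟫_ℂ = p i.1 * ⟪landauBasis hb i, u⟫_ℂ) :
    HasKernel γ (levelKer b p) := by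
  intro φ ψ hφ hψ
  set u := hψ.memLp.toLp ψ
  rw [← inner_toLp hφ.memLp]
  have h1 : HasSum (fun i : ℕ × ℕ => ⟪hφ.memLp.toLp φ, landauBasis hb i⟫_ℂ *
      ⟪landauBasis hb i, γ u⟫_ℂ) ⟪hφ.memLp.toLp φ, γ u⟫_ℂ :=
    (landauBasis hb).hasSum_inner_mul_inner _ _
  have hi : ∀ n, Integrable (fun z : Plane × Plane => conj (φ z.1) * projKer b n z.1 z.2 * ψ z.2) := by
    intro n
    have hφψ : Integrable (fun z : Plane × Plane => (conj (φ z.1) * ψ z.2)) :=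
      hφ.conj.integrable.mul_prod hψ.integrable
    refine (hφψ.norm.mul_const (b / (2 * Real.pi))).mono ?_ (Filter.Eventually.of_forall fun z => ?_)
    · exact ((hφ.conj.1.continuous.comp continuous_fst).mul (continuous_projKer b n)).mul
        (hψ.1.continuous.comp continuous_snd) |>.aestronglyMeasurable
    · rw [norm_mul, norm_mul, norm_mul, norm_norm, norm_mul,
        Real.norm_of_nonneg (by positivity : 0 ≤ b / (2 * Real.pi)), mul_right_comm]
      gcongr
      exact norm_projKer_le hb n _ _
  have h2 : ∀ n, HasSum (fun m => ⟪hφ.memLp.toLp φ, landauBasis hb (n, m)⟫_ℂ *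
      ⟪landauBasis hb (n, m), γ u⟫_ℂ)
      (p n * ∫ z : Plane × Plane, conj (φ z.1) * projKer b n z.1 z.2 * ψ z.2) := by
    intro n
    have h := (hasSum_integral_inner_projVec hb n hφ u).mul_left (p n : ℂ)
    have e : ∫ x, conj (φ x) * ⟪projVec hb n x, u⟫_ℂ =
        ∫ z : Plane × Plane, conj (φ z.1) * projKer b n z.1 z.2 * ψ z.2 := by
      rw [Measure.volume_eq_prod, integral_prod _ (hi n)]
      refine integral_congr_ae (Filter.Eventually.of_forall fun x => ?_)
      simp only [mul_assoc]
      rw [integral_const_mul, inner_projVec]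
      congr 1
      refine integral_congr_ae ?_
      filter_upwards [hψ.memLp.coeFn_toLp] with y hy
      rw [hy]
    rw [e] at h
    refine (congrArg (fun F => HasSum F _) (funext fun m => ?_)).mp h
    rw [hγ]
    ring
  have h3 := h1.prod_fiberwise h2
  have h4 : HasSum (fun n => ∫ z : Plane × Plane, (p n : ℂ) *
      (conj (φ z.1) * projKer b n z.1 z.2 * ψ z.2))
      (∫ z : Plane × Plane, ∑' n, (p n : ℂ) * (conj (φ z.1) * projKer b n z.1 z.2 * ψ z.2)) := by
    have hφψ : Integrable (fun z : Plane × Plane => (conj (φ z.1) * ψ z.2)) :=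
      hφ.conj.integrable.mul_prod hψ.integrable
    refine hasSum_integral_of_summable_integral_norm (fun n => (hi n).const_mul _) ?_
    refine Summable.of_nonneg_of_le (fun n => integral_nonneg fun z => norm_nonneg _) (fun n => ?_)
      ((hs.mul_right (b / (2 * Real.pi))).mul_right (∫ z : Plane × Plane, ‖conj (φ z.1) * ψ z.2‖))
    rw [← integral_const_mul]
    refine integral_mono ((hi n).const_mul _).norm (hφψ.norm.const_mul _) fun z => ?_
    simp only []
    rw [mul_right_comm (conj (φ z.1)), mul_left_comm, norm_mul, mul_comm]
    exact mul_le_mul_of_nonneg_right (norm_mul_projKer_le hb hp n _ _) (norm_nonneg _)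
  simp only [integral_const_mul] at h4
  rw [h3.unique h4]
  refine integral_congr_ae (Filter.Eventually.of_forall fun z => ?_)
  simp only [levelKer]
  rw [← tsum_mul_left, ← tsum_mul_right]
  exact tsum_congr fun n => by ring

omit hb hp hs in
theorem isMagneticInvariant_levelKer (b : ℝ) (p : ℕ → ℝ) : IsMagneticInvariant b (levelKer b p) := by
  intro s x y
  simp only [levelKer]
  rw [← tsum_mul_left, ← tsum_mul_right]
  refine tsum_congr fun n => ?_
  have h : Complex.exp (-Complex.I * (magPhase b s x : ℂ)) *
      projKer b n (x + s) (y + s) * Complex.exp (Complex.I * (magPhase b s y : ℂ)) =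
      projKer b n x y := by
    have e : Complex.exp (-Complex.I * ((b / 2 * wedge x y : ℝ) : ℂ)) =
        Complex.exp (-Complex.I * (magPhase b s x : ℂ)) *
        Complex.exp (-Complex.I * ((b / 2 * wedge (x + s) (y + s) : ℝ) : ℂ)) *
        Complex.exp (Complex.I * (magPhase b s y : ℂ)) := by
      rw [← Complex.exp_add, ← Complex.exp_add]
      congr 1
      simp only [magPhase, wedge, PiLp.add_apply]
      push_cast
      ring
    simp only [projKer, add_sub_add_right_eq_sub, e]
    ring
  rw [← h]
  ring

omit hp hs hb in
theorem levelKer_self (b : ℝ) (p : ℕ → ℝ) (x : Plane) :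
    levelKer b p (x, x) = (b / (2 * Real.pi) * ∑' n, p n : ℝ) := by
  simp only [levelKer, projKer, sub_self, radial_zero, wedge]
  rw [tsum_mul_right]
  have : (x.ofLp 0 * x.ofLp 1 - x.ofLp 1 * x.ofLp 0) = 0 := by ring
  simp [this, Complex.ofReal_tsum]
  ring

end LevelKer

theorem IsMagneticInvariant.apply_self {b : ℝ} {k : Plane × Plane → ℂ} (h : IsMagneticInvariant b k)
    (x : Plane) : k (x, x) = k (0, 0) := by
  simpa [magPhase] using h x 0 0

/-- Testing with a product of bumps at the origin localises the difference of the kernels, whose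
component along its value `d` stays positive nearby. One point is enough, since magnetic invariance
makes the diagonal constant. -/
theorem HasKernel.eq_of_continuous {A : OneSp →L[ℂ] OneSp} {k k' : Plane × Plane → ℂ}
    (h : HasKernel A k) (h' : HasKernel A k') (hk : Continuous k) (hk' : Continuous k') :
    k (0, 0) = k' (0, 0) := by
  by_contra hne
  set d := k (0, 0) - k' (0, 0) with hd
  have hd0 : d ≠ 0 := sub_ne_zero.2 hne
  set D : Plane × Plane → ℝ := fun z => (conj d * (k z - k' z)).re with hD
  have hDc : Continuous D := by fun_prop
  have hD0 : 0 < D (0, 0) := by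
    have : D (0, 0) = ‖d‖ ^ 2 := by
      simp only [hD, ← hd]
      rw [← Complex.normSq_eq_norm_sq, ← Complex.normSq_eq_conj_mul_self, Complex.ofReal_re]
    rw [this]
    positivity
  obtain ⟨r, hr, hball⟩ := Metric.eventually_nhds_iff_ball.1
    (hDc.continuousAt.eventually (lt_mem_nhds hD0))
  let f : ContDiffBump (0 : Plane) := ⟨r / 3, r / 2, by positivity, by linarith⟩
  set φ : Plane → ℂ := fun x => (f x : ℂ) with hφdef
  have hφ : IsTest φ := ⟨Complex.ofRealCLM.contDiff.comp f.contDiff,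
    f.hasCompactSupport.comp_left (g := fun z : ℝ => (z : ℂ)) Complex.ofReal_zero⟩
  have hi : ∀ {κ : Plane × Plane → ℂ}, Continuous κ →
      Continuous (fun z : Plane × Plane => conj (φ z.1) * κ z * φ z.2) := fun hκ =>
    ((hφ.conj.1.continuous.comp continuous_fst).mul hκ).mul (hφ.1.continuous.comp continuous_snd)
  have hsupp : ∀ {κ : Plane × Plane → ℂ}, 
      HasCompactSupport (fun z : Plane × Plane => conj (φ z.1) * κ z * φ z.2) := by
    intro κ
    refine HasCompactSupport.intro (hφ.2.isCompact.prod hφ.2.isCompact) fun z hz => ?_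
    rw [Set.mem_prod, not_and_or] at hz
    rcases hz with hz | hz
    · simp [image_eq_zero_of_notMem_tsupport hz]
    · simp [image_eq_zero_of_notMem_tsupport hz]
  have heq := (h φ φ hφ hφ).symm.trans (h' φ φ hφ hφ)
  have hzero : ∫ z : Plane × Plane, f z.1 * D z * f z.2 = 0 := by
    have e : ∀ z : Plane × Plane, f z.1 * D z * f z.2 =
        (conj d * (conj (φ z.1) * k z * φ z.2 - conj (φ z.1) * k' z * φ z.2)).re := by
      intro z
      have : conj d * (conj (φ z.1) * k z * φ z.2 - conj (φ z.1) * k' z * φ z.2) =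
          ((f z.1 * f z.2 : ℝ) : ℂ) * (conj d * (k z - k' z)) := by
        simp only [hφdef, Complex.conj_ofReal]
        push_cast
        ring
      rw [this, Complex.re_ofReal_mul]
      simp only [hD]
      ring
    simp only [e]
    have i1 := (hi hk).integrable_of_hasCompactSupport (μ := volume) hsupp
    have i2 := (hi hk').integrable_of_hasCompactSupport (μ := volume) hsupp
    have := integral_re ((i1.sub i2).const_mul (conj d))
    simp only [RCLike.re_eq_complex_re, Pi.sub_apply] at this
    rw [this, integral_const_mul, integral_sub i1 i2, heq]
    simp
  have hpos : 0 < ∫ z : Plane × Plane, f z.1 * D z * f z.2 := by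
    refine Continuous.integral_pos_of_hasCompactSupport_nonneg_nonzero
      (μ := (volume : Measure (Plane × Plane))) (x := (0, 0))
      (((f.continuous.comp continuous_fst).mul hDc).mul (f.continuous.comp continuous_snd)) ?_ ?_ ?_
    · refine HasCompactSupport.intro (f.hasCompactSupport.isCompact.prod
        f.hasCompactSupport.isCompact) fun z hz => ?_
      rw [Set.mem_prod, not_and_or] at hz
      rcases hz with hz | hz
      · simp [image_eq_zero_of_notMem_tsupport hz]
      · simp [image_eq_zero_of_notMem_tsupport hz]
    · intro z
      by_cases h1 : ‖z.1‖ < r / 2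
      · by_cases h2 : ‖z.2‖ < r / 2
        · have : 0 < D z := hball z (by
            rw [Metric.mem_ball, Prod.dist_eq, dist_zero_right, dist_zero_right]
            exact max_lt (by linarith) (by linarith))
          have := f.nonneg' z.1
          have := f.nonneg' z.2
          positivity
        · have : f z.2 = 0 := f.zero_of_le_dist (by simpa using h2)
          simp [this]
      · have : f z.1 = 0 := f.zero_of_le_dist (by simpa using h1)
        simp [this]
    · have : f (0 : Plane) = 1 := f.one_of_mem_closedBall (by simp; positivity)
      simp only [this]
      simpa using hD0.ne'
  exact hpos.ne' hzero

/-! ### Normal states -/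

theorem directPot_of_invariant (v : Plane → ℝ) {b : ℝ} {k : Plane × Plane → ℂ}
    (h : IsMagneticInvariant b k) (x : Plane) : directPot v k x = (∫ y, v y) * (k (0, 0)).re := by
  simp only [directPot, h.apply_self]
  rw [integral_mul_const, integral_sub_left_eq_self v volume x]

theorem IsFermiDirac.isSelfAdjoint {b T : ℝ} {W : Plane → ℝ} {γ : OneSp →L[ℂ] OneSp}
    (h : IsFermiDirac b W T γ) : IsSelfAdjoint γ := by
  obtain ⟨c, R, -, -, rfl⟩ := h
  exact cfc_predicate _ _

theorem IsFermiDirac.inner_landauBasis {b w T : ℝ} (hb : 0 < b) (hT : 0 < T) {γ : OneSp →L[ℂ] OneSp}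
    (h : IsFermiDirac b (fun _ => w) T γ) (i : ℕ × ℕ) (u : OneSp) :
    ⟪landauBasis hb i, γ u⟫_ℂ =
      (fermi T (b * (2 * i.1 + 1) + w) : ℂ) * ⟪landauBasis hb i, u⟫_ℂ := by
  have hs : ⟪γ (landauBasis hb i), u⟫_ℂ = ⟪landauBasis hb i, γ u⟫_ℂ := h.isSelfAdjoint.isSymmetric _ _
  rw [← hs, h.apply_landauBasis hb hT i, inner_smul_left, Complex.conj_ofReal]
  rfl

/-- The potential of an invariant state is a constant, so `γ` is a function of the Landau level
alone. The value of its kernel at the origin is computed a second time from the levels, and the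
comparison closes the equation for `ν`. -/
theorem IsNormalState.exists_levels {v : Plane → ℝ} {μ T b : ℝ} (hb : 0 < b) (hT : 0 < T)
    {γ : OneSp →L[ℂ] OneSp} {k : Plane × Plane → ℂ} (h : IsNormalState v μ T b γ k) :
    ∃ ν : ℝ, ν = μ + (-∫ y, v y) * (b / (2 * Real.pi) * ∑' n : ℕ, fermi T (b * (2 * n + 1) - ν)) ∧
      IsSelfAdjoint γ ∧
      ∀ i, γ (landauBasis hb i) = (fermi T (b * (2 * i.1 + 1) - ν) : ℂ) • landauBasis hb i := by
  have hF := h.fermiDirac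
  simp only [directPot_of_invariant v h.magneticInvariant] at hF
  set w := (∫ y, v y) * (k (0, 0)).re - μ with hw
  have hs := summable_fermi hT hb (-w)
  have hp : ∀ n : ℕ, 0 ≤ fermi T (b * (2 * n + 1) - -w) := fun n => (fermi_pos _ _).le
  have hk := h.hasKernel.eq_of_continuous (hasKernel_levelKer hb hp hs (fun i u => by
    rw [hF.inner_landauBasis hb hT i u, sub_neg_eq_add])) h.continuous_kernel
    (continuous_levelKer hb hp hs)
  rw [levelKer_self] at hk
  refine ⟨-w, ?_, hF.isSelfAdjoint, fun i => ?_⟩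
  · have := congrArg Complex.re hk
    rw [Complex.ofReal_re] at this
    rw [← this, hw]
    ring
  · rw [hF.apply_landauBasis hb hT i, sub_neg_eq_add]
    rfl

theorem exists_isNormalState {v : Plane → ℝ} {μ T b : ℝ} (hb : 0 < b) (hT : 0 < T)
    (h0 : ∫ y, v y ≤ 0) (h1 : -1 ≤ ∫ y, v y) : ∃ γ k, IsNormalState v μ T b γ k := by
  obtain ⟨ν, hν⟩ := exists_density_fixedPoint hT hb (g := -∫ y, v y) (μ := μ)
    (by linarith) (by linarith)
  obtain ⟨γ, hγ⟩ := exists_isFermiDirac hb T (-ν)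
  have hs := summable_fermi hT hb ν
  have hp : ∀ n : ℕ, 0 ≤ fermi T (b * (2 * n + 1) - ν) := fun n => (fermi_pos _ _).le
  refine ⟨γ, levelKer b (fun n => fermi T (b * (2 * n + 1) - ν)), continuous_levelKer hb hp hs,
    hasKernel_levelKer hb hp hs fun i u => ?_, isMagneticInvariant_levelKer _ _, ?_⟩
  · rw [hγ.inner_landauBasis hb hT i u, sub_eq_add_neg]
  · simp only [directPot_of_invariant v (isMagneticInvariant_levelKer b _), levelKer_self,
      Complex.ofReal_re]
    convert hγ using 2
    linarith

/-! ### The relative entropy function -/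

/-- `x ln (x / p) - x + p`. -/
def relEnt (p x : ℝ) : ℝ := x * Real.log x - (1 + Real.log p) * x + p

theorem continuous_relEnt (p : ℝ) : Continuous (relEnt p) := by
  unfold relEnt
  have := Real.continuous_mul_log
  fun_prop

theorem relEnt_eq {p x : ℝ} (hp : 0 < p) (hx : 0 < x) :
    relEnt p x = x * Real.log (x / p) - x + p := by
  rw [relEnt, Real.log_div hx.ne' hp.ne']
  ring

theorem relEnt_le {p x : ℝ} (hp : 0 < p) (hx : 0 ≤ x) : relEnt p x ≤ (x - p) ^ 2 / p := by
  rcases hx.eq_or_lt with rfl | hx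
  · simp [relEnt, sq, hp.ne']
  · rw [relEnt_eq hp hx]
    have h := mul_le_mul_of_nonneg_left (Real.log_le_sub_one_of_pos (div_pos hx hp)) hx.le
    have e : (x - p) ^ 2 / p = x * (x / p - 1) - x + p := by field_simp; ring
    linarith

/-- Relative entropy dominates the Hellinger distance: use `log y ≤ y - 1` at `y = √p/√x`. -/
theorem sq_sqrt_sub_le_relEnt {p x : ℝ} (hp : 0 < p) (hx : 0 ≤ x) :
    (√x - √p) ^ 2 ≤ relEnt p x := by
  rcases hx.eq_or_lt with rfl | hx
  · simp [relEnt, Real.sq_sqrt hp.le]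
  · have hx2 := Real.sqrt_pos.2 hx
    have hp2 := Real.sqrt_pos.2 hp
    rw [relEnt_eq hp hx]
    have h : Real.log (x / p) = -2 * Real.log (√p / √x) := by
      rw [← Real.sqrt_div hp.le, Real.log_sqrt (by positivity), ← inv_div, Real.log_inv]
      ring
    have h1 := Real.log_le_sub_one_of_pos (div_pos hp2 hx2)
    have h2 : x * (√p / √x) = √x * √p := by
      nth_rw 1 [← Real.mul_self_sqrt hx.le]
      field_simp
    have h3 := Real.sq_sqrt hx.le
    have h4 := Real.sq_sqrt hp.le
    rw [h]
    nlinarith [mul_le_mul_of_nonneg_left h1 hx.le]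

theorem relEnt_lower {p x : ℝ} (hp : 0 < p) (hp1 : p ≤ 1) (hx : 0 ≤ x) (hx2 : x ≤ 2) :
    1 / 6 * (x - p) ^ 2 ≤ relEnt p x := by
  refine le_trans ?_ (sq_sqrt_sub_le_relEnt hp hx)
  have h3 := Real.sq_sqrt hx
  have h4 := Real.sq_sqrt hp.le
  have e : (x - p) ^ 2 = (√x - √p) ^ 2 * (√x + √p) ^ 2 := by
    rw [← mul_pow]
    congr 1
    linarith
  rw [e]
  have h5 : √p ≤ 1 := Real.sqrt_le_one.2 hp1
  have h6 : √x ≤ 1.42 := Real.sqrt_le_iff.2 ⟨by norm_num, by norm_num; linarith⟩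
  have h7 : (√x + √p) ^ 2 ≤ 6 := by nlinarith [Real.sqrt_nonneg x, Real.sqrt_nonneg p]
  nlinarith [sq_nonneg (√x - √p)]

/-- The constant must grow like `-log p`: multiplied by `T` it then stays of the order of the level
energy as `T → 0`, where a fixed constant would be lost. For `x` up to `√p` the Hellinger bound
suffices because `√p` times `-log p` is bounded; beyond `√p` at least half of the logarithm survives
in `log x - log p`. -/
theorem relEnt_lower_log {p x : ℝ} (hp : 0 < p) (hp1 : p ≤ 1) (hx : 0 ≤ x) (hx2 : x ≤ 2) :
    -Real.log p / 24 * (x - p) ^ 2 ≤ relEnt p x := by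
  set L := -Real.log p with hL
  -- For `L ≤ 4` the factor `L / 24` is at most the `1 / 6` of `relEnt_lower`.
  rcases le_or_gt L 4 with h | h
  · refine le_trans ?_ (relEnt_lower hp hp1 hx hx2)
    nlinarith [sq_nonneg (x - p)]
  have hpe : p = Real.exp (-L) := by rw [hL, neg_neg, Real.exp_log hp]
  have hsq : √p = Real.exp (-L / 2) := by
    rw [hpe, Real.sqrt_eq_iff_mul_self_eq (by positivity) (by positivity), ← Real.exp_add]
    congr 1; ring
  have hL2 : L / 2 + 1 ≤ Real.exp (L / 2) := Real.add_one_le_exp _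
  have hinv : Real.exp (L / 2) * √p = 1 := by
    rw [hsq, ← Real.exp_add, show L / 2 + -L / 2 = 0 by ring, Real.exp_zero]
  have hs0 : 0 < √p := Real.sqrt_pos.2 hp
  have hps : √p * √p = p := Real.mul_self_sqrt hp.le
  have hs1 : √p ≤ 1 := Real.sqrt_le_one.2 hp1
  rcases le_or_gt x √p with h1 | h1
  · refine le_trans ?_ (sq_sqrt_sub_le_relEnt hp hx)
    have h3 := Real.sq_sqrt hx
    have h4 := Real.sq_sqrt hp.le
    have e : (x - p) ^ 2 = (√x - √p) ^ 2 * (√x + √p) ^ 2 := by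
      rw [← mul_pow]
      congr 1
      linarith
    have h7 : (√x + √p) ^ 2 ≤ 4 * √p := by
      have : (√x + √p) ^ 2 ≤ 2 * (x + p) := by nlinarith [sq_nonneg (√x - √p)]
      nlinarith
    have h8 : L / 24 * (√x + √p) ^ 2 ≤ 1 := by
      have : L / 24 * (√x + √p) ^ 2 ≤ L / 24 * (4 * √p) :=
        mul_le_mul_of_nonneg_left h7 (by linarith)
      nlinarith
    rw [e]
    nlinarith [sq_nonneg (√x - √p)]
  · have hx0 : 0 < x := hs0.trans h1
    rw [relEnt_eq hp hx0, Real.log_div hx0.ne' hp.ne']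
    have h2 : -L / 2 ≤ Real.log x := by
      rw [Real.le_log_iff_exp_le hx0, ← hsq]
      exact h1.le
    have hpx : p ≤ x := by nlinarith
    have h3 : x * (L / 2 - 1) ≤ x * (Real.log x - Real.log p) - x := by
      have : Real.log p = -L := by rw [hL, neg_neg]
      rw [this]
      nlinarith
    have h4 : (x - p) ^ 2 ≤ 2 * x := by nlinarith
    have h5 : L / 24 * (x - p) ^ 2 ≤ L / 24 * (2 * x) := mul_le_mul_of_nonneg_left h4 (by linarith)
    nlinarith

/-- The trivial factor `1/p` would make the trial energy useless; away from small `x` it improves to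
a logarithm. The factor `1/p` is kept only in a term vanishing for `x ≥ 1/2`: the off-diagonal part
maps into eigenspaces of `1 - γ̄` with eigenvalues at least `1/2`, so this term disappears to
leading order (`cfc_defect_apply_eq_zero`). The constant `128` comes from `x - p ≥ 1/8` when `x >
1/4` and `p < 1/8`. -/
theorem relEnt_upper {p x : ℝ} (hp : 0 < p) (hp1 : p ≤ 1) (hx : 0 ≤ x) (hx2 : x ≤ 2) :
    relEnt p x ≤ (128 * (1 - Real.log p) + 4 / p * max 0 (1 / 2 - x)) * (x - p) ^ 2 := by
  have hlog : 0 ≤ -Real.log p := neg_nonneg.2 (Real.log_nonpos hp.le hp1)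
  have hsq := sq_nonneg (x - p)
  have hm : 0 ≤ 4 / p * max 0 (1 / 2 - x) := by positivity
  rcases le_or_gt x (1 / 4) with h | h
  · refine (relEnt_le hp hx).trans ?_
    have h1 : 1 / 4 ≤ max 0 (1 / 2 - x) := le_max_of_le_right (by linarith)
    have h2 : 1 / p ≤ 4 / p * max 0 (1 / 2 - x) := by
      calc 1 / p = 4 / p * (1 / 4) := by ring
        _ ≤ _ := mul_le_mul_of_nonneg_left h1 (by positivity)
    rw [div_eq_mul_one_div, mul_comm]
    refine mul_le_mul_of_nonneg_right ?_ hsq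
    linarith
  · rcases le_or_gt (1 / 8) p with h' | h'
    · refine (relEnt_le hp hx).trans ?_
      have : 1 / p ≤ 8 := by rw [div_le_iff₀ hp]; linarith
      rw [div_eq_mul_one_div, mul_comm]
      refine mul_le_mul_of_nonneg_right ?_ hsq
      linarith
    · have hx0 : 0 < x := by linarith
      have h1 : 1 / 64 ≤ (x - p) ^ 2 := by nlinarith
      have h2 : relEnt p x ≤ 2 * (1 - Real.log p) := by
        rw [relEnt_eq hp hx0, Real.log_div hx0.ne' hp.ne']
        have h3 := Real.log_le_sub_one_of_pos hx0
        have h4 : Real.log x ≤ 1 := by linarith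
        nlinarith
      nlinarith [mul_nonneg hm hsq]

/-! ### Relative entropy and the functional calculus -/

section Calculus
variable {H : Type} [NormedAddCommGroup H] [InnerProductSpace ℂ H] [CompleteSpace H]
  {A : H →L[ℂ] H} (hA : IsSelfAdjoint A)
include hA

/-- `relEnt p` differs from `x log x` by an affine function, whose expectation depends only on that
of `A`. -/
theorem re_inner_cfc_relEnt {p : ℝ} {ψ : H} (hψ : ⟪ψ, A ψ⟫_ℂ = p * ⟪ψ, ψ⟫_ℂ) :
    RCLike.re ⟪ψ, cfc (fun x : ℝ => x * Real.log x) A ψ⟫_ℂ - p * Real.log p * ‖ψ‖ ^ 2 =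
      RCLike.re ⟪ψ, cfc (relEnt p) A ψ⟫_ℂ := by
  have h1 : cfc (relEnt p) A = cfc (fun x : ℝ => x * Real.log x) A - (1 + Real.log p) • A + p • 1 := by
    have e : relEnt p = fun x => (x * Real.log x - (1 + Real.log p) * x) + p := rfl
    have hc := Real.continuous_mul_log
    rw [e, cfc_add (a := A) (fun x => x * Real.log x - (1 + Real.log p) * x) (fun _ => p)
      (hc.sub (by fun_prop)).continuousOn (by fun_prop), cfc_sub (a := A) (fun x => x * Real.log x)
      (fun x => (1 + Real.log p) * x) hc.continuousOn (by fun_prop), cfc_const_mul_id _ A hA,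
      cfc_const p A hA, Algebra.algebraMap_eq_smul_one]
  rw [h1]
  simp only [add_apply, sub_apply, smul_apply, one_apply_eq_self, inner_add_right, inner_sub_right,
    inner_smul_right_eq_smul, hψ, map_add, map_sub]
  rw [← Complex.coe_smul, ← Complex.coe_smul, smul_eq_mul, smul_eq_mul, inner_self_eq_norm_sq_to_K]
  norm_cast
  simp only [RCLike.re_eq_complex_re, Complex.coe_algebraMap, ← Complex.ofReal_mul,
    Complex.ofReal_re]
  ring

theorem cfc_mul_sub_sq (p : ℝ) {h : ℝ → ℝ} (hh : Continuous h) :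
    cfc (fun x : ℝ => h x * (x - p) ^ 2) A = (A - p • 1) * cfc h A * (A - p • 1) := by
  have h1 : cfc (fun x : ℝ => x - p) A = A - p • 1 := by
    rw [cfc_sub (a := A) (fun x => x) (fun _ => p) (by fun_prop) (by fun_prop), cfc_id' ℝ A hA,
      cfc_const p A hA, Algebra.algebraMap_eq_smul_one]
  rw [← h1, ← cfc_mul _ _ A (by fun_prop) (by fun_prop), ← cfc_mul _ _ A (by fun_prop) (by fun_prop)]
  congr 1
  funext x
  ring

/-- The two factors `A - p` are moved onto `ψ`, where they leave only its off-diagonal image. -/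
theorem re_inner_cfc_mul_sub_sq (p : ℝ) {h : ℝ → ℝ} (hh : Continuous h) (ψ : H) :
    RCLike.re ⟪ψ, cfc (fun x : ℝ => h x * (x - p) ^ 2) A ψ⟫_ℂ =
      RCLike.re ⟪A ψ - (p : ℂ) • ψ, cfc h A (A ψ - (p : ℂ) • ψ)⟫_ℂ := by
  have hs : IsSelfAdjoint (A - p • 1) := hA.sub (IsSelfAdjoint.smul (star_trivial p) (.one _))
  have h2 : ∀ x y, ⟪(A - p • 1) x, y⟫_ℂ = ⟪x, (A - p • 1) y⟫_ℂ := hs.isSymmetric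
  have e : A ψ - (p : ℂ) • ψ = (A - p • 1) ψ := by simp
  rw [cfc_mul_sub_sq hA p hh, e, h2]
  simp only [mul_apply_eq_comp]

omit hA in
theorem re_inner_cfc_mono {f g : ℝ → ℝ} (hf : Continuous f) (hg : Continuous g)
    (h : ∀ x ∈ spectrum ℝ A, f x ≤ g x) (ψ : H) :
    RCLike.re ⟪ψ, cfc f A ψ⟫_ℂ ≤ RCLike.re ⟪ψ, cfc g A ψ⟫_ℂ := by
  have h1 : cfc f A ≤ cfc g A := cfc_mono h hf.continuousOn hg.continuousOn
  have h2 := ((ContinuousLinearMap.le_def _ _).1 h1).re_inner_nonneg_right ψ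
  rw [sub_apply, inner_sub_right, map_sub] at h2
  linarith

end Calculus

/-! ### Operator convexity of `x ln x` -/

theorem abs_exp_sub_one_sub_le (s : ℝ) : |Real.exp s - 1 - s| ≤ s ^ 2 * max 1 (Real.exp s) := by
  have h0 := Real.add_one_le_exp s
  rw [abs_of_nonneg (by linarith)]
  have h1 : Real.exp s - 1 - s ≤ s * (Real.exp s - 1) := by
    have := Real.add_one_le_exp (-s)
    have h2 : Real.exp (-s) * Real.exp s = 1 := by rw [← Real.exp_add]; simp
    nlinarith [Real.exp_pos s]
  refine h1.trans ?_
  rcases le_or_gt 0 s with hs | hs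
  · have h3 : Real.exp s - 1 ≤ s * Real.exp s := by
      have := Real.add_one_le_exp (-s)
      have h2 : Real.exp (-s) * Real.exp s = 1 := by rw [← Real.exp_add]; simp
      nlinarith [Real.exp_pos s]
    have h4 : Real.exp s ≤ max 1 (Real.exp s) := le_max_right _ _
    nlinarith [mul_le_mul_of_nonneg_left h3 hs, mul_le_mul_of_nonneg_left h4 (sq_nonneg s)]
  · have h4 : 1 ≤ max 1 (Real.exp s) := le_max_left _ _
    nlinarith [mul_le_mul_of_nonneg_left h4 (sq_nonneg s)]

/-- Taylor expansion of `x ^ (-q) = exp (-q log x)` to first order. For `x ≤ 1` the remainder is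
controlled by `(x ^ (1/4) log x)² ≤ 16`, which uses `q ≤ 1/2`. -/
theorem abs_sub_rpow_sub_mul_log_le {q x : ℝ} (hq : 0 < q) (hq1 : q ≤ 1 / 2) (hx : 0 ≤ x)
    (hx2 : x ≤ 2) : |q⁻¹ * (x - x ^ (1 - q)) - x * Real.log x| ≤ 16 * q := by
  rcases hx.eq_or_lt with rfl | hx
  · rw [Real.zero_rpow (by linarith)]
    simp [hq.le]
  set L := Real.log x with hL
  have e1 : x ^ (1 - q) = x * Real.exp (-q * L) := by
    rw [Real.rpow_sub hx, Real.rpow_one, Real.rpow_def_of_pos hx, ← hL, div_eq_mul_inv,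
      ← Real.exp_neg]
    congr 2
    ring
  have e2 : q⁻¹ * (x - x ^ (1 - q)) - x * L = -(q⁻¹ * x * (Real.exp (-q * L) - 1 - (-q * L))) := by
    rw [e1]
    field_simp
    ring
  rw [e2, abs_neg, abs_mul, abs_of_pos (by positivity : 0 < q⁻¹ * x)]
  have h1 := mul_le_mul_of_nonneg_left (abs_exp_sub_one_sub_le (-q * L)) (by positivity : 0 ≤ q⁻¹ * x)
  refine h1.trans ?_
  have e3 : q⁻¹ * x * ((-q * L) ^ 2 * max 1 (Real.exp (-q * L))) =
      q * (x * L ^ 2 * max 1 (Real.exp (-q * L))) := by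
    field_simp
  rw [e3, mul_comm]
  refine mul_le_mul_of_nonneg_right ?_ hq.le
  rcases le_or_gt x 1 with h | h
  · have hL0 : L ≤ 0 := Real.log_nonpos hx.le h
    have h2 : max 1 (Real.exp (-q * L)) ≤ x ^ (-(1 / 2 : ℝ)) := by
      rw [Real.rpow_def_of_pos hx, ← hL]
      refine max_le (Real.one_le_exp (by nlinarith)) (Real.exp_le_exp.2 (by nlinarith))
    have h3 := Real.abs_log_mul_self_rpow_lt x (1 / 4) hx h (by norm_num)
    have h4 : x * x ^ (-(1 / 2 : ℝ)) = (x ^ (1 / 4 : ℝ)) ^ 2 := by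
      rw [← Real.rpow_natCast, ← Real.rpow_mul hx.le]
      nth_rw 1 [← Real.rpow_one x]
      rw [← Real.rpow_add hx]
      norm_num
    have h5 : (L * x ^ (1 / 4 : ℝ)) ^ 2 ≤ 16 := by
      rw [← sq_abs]
      have := abs_nonneg (L * x ^ (1 / 4 : ℝ))
      have h6 : |L * x ^ (1 / 4 : ℝ)| < 4 := h3.trans_eq (by norm_num)
      nlinarith
    calc x * L ^ 2 * max 1 (Real.exp (-q * L)) ≤ x * L ^ 2 * x ^ (-(1 / 2 : ℝ)) := by gcongr
      _ = (L * x ^ (1 / 4 : ℝ)) ^ 2 := by rw [mul_pow, ← h4]; ring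
      _ ≤ 16 := h5
  · have hL0 : 0 ≤ L := Real.log_nonneg h.le
    have hL1 : L ≤ 1 := by
      have := Real.log_le_sub_one_of_pos hx
      linarith
    have h2 : max 1 (Real.exp (-q * L)) ≤ 1 :=
      max_le le_rfl (Real.exp_le_one_iff.2 (by nlinarith))
    have h3 : L ^ 2 ≤ 1 := by nlinarith
    calc x * L ^ 2 * max 1 (Real.exp (-q * L)) ≤ 2 * 1 * 1 := by gcongr
      _ ≤ 16 := by norm_num

section Calculus
variable {H : Type} [NormedAddCommGroup H] [InnerProductSpace ℂ H] [CompleteSpace H]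

theorem tendsto_rpow_xlogx {a : H →L[ℂ] H} (ha : 0 ≤ a) (hs : spectrum ℝ a ⊆ Set.Icc 0 2) :
    Filter.Tendsto (fun n : ℕ => ((n : ℝ) + 2) • (a - a ^ (1 - ((n : ℝ) + 2)⁻¹))) Filter.atTop
      (nhds (cfc (fun x : ℝ => x * Real.log x) a)) := by
  -- The offset `2` keeps `q = 1/(n + 2)` within the range of the uniform estimate.
  have hq : ∀ n : ℕ, 0 < ((n : ℝ) + 2)⁻¹ ∧ ((n : ℝ) + 2)⁻¹ ≤ 1 / 2 := fun n =>
    ⟨by positivity, by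
      rw [one_div]
      exact inv_anti₀ two_pos (by linarith [n.cast_nonneg (α := ℝ)])⟩
  have hc : ∀ n : ℕ, ContinuousOn (fun x : ℝ => x ^ (1 - ((n : ℝ) + 2)⁻¹)) (spectrum ℝ a) := fun n =>
    (Real.continuous_rpow_const (by linarith [(hq n).2])).continuousOn
  have e : ∀ n : ℕ, ((n : ℝ) + 2) • (a - a ^ (1 - ((n : ℝ) + 2)⁻¹)) =
      cfc (fun x : ℝ => ((n : ℝ) + 2) * (x - x ^ (1 - ((n : ℝ) + 2)⁻¹))) a := fun n => by
    rw [cfc_const_mul ((n : ℝ) + 2) (fun x : ℝ => x - x ^ (1 - ((n : ℝ) + 2)⁻¹)) a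
      (continuousOn_id.sub (hc n)), cfc_sub (fun x : ℝ => x) _ a continuousOn_id (hc n),
      cfc_id' ℝ a, CFC.rpow_eq_cfc_real ha]
  simp only [e]
  refine tendsto_cfc_fun ?_ (Filter.Eventually.of_forall fun n =>
    continuousOn_const.mul (continuousOn_id.sub (hc n)))
  rw [Metric.tendstoUniformlyOn_iff]
  intro ε hε
  have ht : Filter.Tendsto (fun n : ℕ => 16 * ((n : ℝ) + 2)⁻¹) Filter.atTop (nhds 0) := by
    have : Filter.Tendsto (fun n : ℕ => ((n : ℝ) + 2)) Filter.atTop Filter.atTop :=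
      Filter.tendsto_atTop_add_const_right _ _ tendsto_natCast_atTop_atTop
    simpa using this.inv_tendsto_atTop.const_mul 16
  filter_upwards [ht.eventually (gt_mem_nhds hε)] with n hn x hx
  have := abs_sub_rpow_sub_mul_log_le (hq n).1 (hq n).2 (hs hx).1 (hs hx).2
  rw [inv_inv] at this
  rw [dist_comm, Real.dist_eq]
  exact this.trans_lt hn

/-- Powers with exponent in `[0, 1]` are operator concave, so `(x - x ^ (1 - q)) / q` is operator
convex; `x log x` is its norm limit as `q → 0`. Only midpoint convexity is needed, because the
pinching is an average of two operators. -/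
theorem cfc_xlogx_midpoint_le {a c : H →L[ℂ] H} (ha : 0 ≤ a) (hc : 0 ≤ c)
    (hsa : spectrum ℝ a ⊆ Set.Icc 0 2) (hsc : spectrum ℝ c ⊆ Set.Icc 0 2)
    (hsm : spectrum ℝ ((1 / 2 : ℝ) • a + (1 / 2 : ℝ) • c) ⊆ Set.Icc 0 2) :
    cfc (fun x : ℝ => x * Real.log x) ((1 / 2 : ℝ) • a + (1 / 2 : ℝ) • c) ≤
      (1 / 2 : ℝ) • cfc (fun x : ℝ => x * Real.log x) a +
        (1 / 2 : ℝ) • cfc (fun x : ℝ => x * Real.log x) c := by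
  have hm : 0 ≤ (1 / 2 : ℝ) • a + (1 / 2 : ℝ) • c :=
    add_nonneg (smul_nonneg (by norm_num) ha) (smul_nonneg (by norm_num) hc)
  refine le_of_tendsto_of_tendsto' (tendsto_rpow_xlogx hm hsm)
    (((tendsto_rpow_xlogx ha hsa).const_smul (1 / 2 : ℝ)).add
      ((tendsto_rpow_xlogx hc hsc).const_smul (1 / 2 : ℝ))) fun n => ?_
  have hq : 1 - ((n : ℝ) + 2)⁻¹ ∈ Set.Icc (0 : ℝ) 1 := by
    have h1 : ((n : ℝ) + 2)⁻¹ ≤ 1 := inv_le_one_of_one_le₀ (by linarith [n.cast_nonneg (α := ℝ)])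
    have h2 : 0 ≤ ((n : ℝ) + 2)⁻¹ := by positivity
    exact ⟨by linarith, by linarith⟩
  have h := (CFC.concaveOn_rpow (A := H →L[ℂ] H) hq).2 ha hc (by norm_num : (0 : ℝ) ≤ 1 / 2)
    (by norm_num : (0 : ℝ) ≤ 1 / 2) (by norm_num)
  have e : (1 / 2 : ℝ) • ((n : ℝ) + 2) • (a - a ^ (1 - ((n : ℝ) + 2)⁻¹)) +
      (1 / 2 : ℝ) • ((n : ℝ) + 2) • (c - c ^ (1 - ((n : ℝ) + 2)⁻¹)) =
      ((n : ℝ) + 2) • (((1 / 2 : ℝ) • a + (1 / 2 : ℝ) • c) -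
        ((1 / 2 : ℝ) • a ^ (1 - ((n : ℝ) + 2)⁻¹) + (1 / 2 : ℝ) • c ^ (1 - ((n : ℝ) + 2)⁻¹))) := by
    module
  rw [e]
  exact smul_le_smul_of_nonneg_left (sub_le_sub_left h _) (by positivity)

theorem cfc_conj_unitary {a U : H →L[ℂ] H} (hU : IsSelfAdjoint U) (hU2 : U * U = 1)
    (ha : IsSelfAdjoint a) {f : ℝ → ℝ} (hf : Continuous f) : cfc f (U * a * U) = U * cfc f a * U := by
  have hU' : U ∈ unitary (H →L[ℂ] H) := by
    rw [Unitary.mem_iff, hU.star_eq]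
    exact ⟨hU2, hU2⟩
  have hφ : ∀ x, Unitary.conjStarAlgAut ℂ (H →L[ℂ] H) ⟨U, hU'⟩ x = U * x * U := fun x => by
    rw [Unitary.conjStarAlgAut_apply, hU.star_eq]
  have hcont : Continuous (Unitary.conjStarAlgAut ℂ (H →L[ℂ] H) ⟨U, hU'⟩) := by
    have : ⇑(Unitary.conjStarAlgAut ℂ (H →L[ℂ] H) ⟨U, hU'⟩) = fun x => U * x * U := funext hφ
    rw [this]
    fun_prop
  have hsa : IsSelfAdjoint (Unitary.conjStarAlgAut ℂ (H →L[ℂ] H) ⟨U, hU'⟩ a) := by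
    rw [hφ, IsSelfAdjoint, star_mul, star_mul, hU.star_eq, ha.star_eq, mul_assoc]
  have := StarAlgHomClass.map_cfc (S := ℂ) (Unitary.conjStarAlgAut ℂ (H →L[ℂ] H) ⟨U, hU'⟩) f a
    hf.continuousOn hcont ha hsa
  rw [hφ, hφ] at this
  exact this.symm

end Calculus

/-! ### Complex conjugation -/

theorem coeFn_conjL2 (u : OneSp) : ∀ᵐ x, conjL2 u x = conj (u x) := Lp.coeFn_star u

theorem conjL2_conjL2 (u : OneSp) : conjL2 (conjL2 u) = u := star_star u

theorem inner_conjL2_conjL2 (u w : OneSp) : ⟪conjL2 u, conjL2 w⟫_ℂ = ⟪w, u⟫_ℂ := by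
  rw [L2.inner_def, L2.inner_def]
  refine integral_congr_ae ?_
  filter_upwards [coeFn_conjL2 u, coeFn_conjL2 w] with x h1 h2
  simp only [h1, h2, RCLike.inner_apply, Complex.conj_conj]
  ring

theorem inner_conjL2_left (u w : OneSp) : ⟪conjL2 u, w⟫_ℂ = ⟪conjL2 w, u⟫_ℂ := by
  have := inner_conjL2_conjL2 u (conjL2 w)
  rwa [conjL2_conjL2] at this

theorem norm_conjL2 (u : OneSp) : ‖conjL2 u‖ = ‖u‖ := by
  have := inner_conjL2_conjL2 u u
  rw [inner_self_eq_norm_sq_to_K, inner_self_eq_norm_sq_to_K] at this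
  norm_cast at this
  exact (pow_left_inj₀ (norm_nonneg _) (norm_nonneg _) two_ne_zero).1 this

theorem conjOp_apply (A : OneSp →L[ℂ] OneSp) (u : OneSp) : conjOp A u = conjL2 (A (conjL2 u)) := rfl

theorem isSelfAdjoint_conjOp {A : OneSp →L[ℂ] OneSp} (hA : IsSelfAdjoint A) :
    IsSelfAdjoint (conjOp A) := by
  have hs : ∀ x y, ⟪A x, y⟫_ℂ = ⟪x, A y⟫_ℂ := hA.isSymmetric
  rw [ContinuousLinearMap.isSelfAdjoint_iff_isSymmetric]
  intro x y
  change ⟪conjL2 (A (conjL2 x)), y⟫_ℂ = ⟪x, conjL2 (A (conjL2 y))⟫_ℂ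
  rw [← conjL2_conjL2 y, inner_conjL2_conjL2, conjL2_conjL2, ← hs, ← inner_conjL2_conjL2,
    conjL2_conjL2]

/-! ### Block operators -/

/-- The vector `(u, w)` of the doubled space. -/
abbrev pairVec (u w : OneSp) : DoubledSp := WithLp.toLp 2 (u, w)

theorem inner_pairVec (u w u' w' : OneSp) :
    ⟪pairVec u w, pairVec u' w'⟫_ℂ = ⟪u, u'⟫_ℂ + ⟪w, w'⟫_ℂ := by
  rw [WithLp.prod_inner_apply]

theorem norm_sq_pairVec (u w : OneSp) : ‖pairVec u w‖ ^ 2 = ‖u‖ ^ 2 + ‖w‖ ^ 2 := by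
  rw [WithLp.prod_norm_sq_eq_of_L2]
  rfl

theorem densityMatrix_apply (γ α : OneSp →L[ℂ] OneSp) (u w : OneSp) :
    densityMatrix γ α (pairVec u w) =
      pairVec (γ u + α w) (ContinuousLinearMap.adjoint α u + (w - conjOp γ w)) := rfl

theorem block11_apply (G : DoubledSp →L[ℂ] DoubledSp) (u : OneSp) :
    block11 G u = (G (pairVec u 0)).fst := rfl

theorem block22_apply (G : DoubledSp →L[ℂ] DoubledSp) (u : OneSp) :
    block22 G u = (G (pairVec 0 u)).snd := rfl

theorem inner_block11 (G : DoubledSp →L[ℂ] DoubledSp) (u w : OneSp) :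
    ⟪u, block11 G w⟫_ℂ = ⟪pairVec u 0, G (pairVec w 0)⟫_ℂ := by
  rw [WithLp.prod_inner_apply]
  simp [block11_apply]

theorem inner_block22 (G : DoubledSp →L[ℂ] DoubledSp) (u w : OneSp) :
    ⟪u, block22 G w⟫_ℂ = ⟪pairVec 0 u, G (pairVec 0 w)⟫_ℂ := by
  rw [WithLp.prod_inner_apply]
  simp [block22_apply]

theorem isSelfAdjoint_densityMatrix {γ : OneSp →L[ℂ] OneSp} (hγ : IsSelfAdjoint γ)
    (α : OneSp →L[ℂ] OneSp) : IsSelfAdjoint (densityMatrix γ α) := by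
  have hs : ∀ x y, ⟪γ x, y⟫_ℂ = ⟪x, γ y⟫_ℂ := hγ.isSymmetric
  have hc : ∀ x y, ⟪conjOp γ x, y⟫_ℂ = ⟪x, conjOp γ y⟫_ℂ := (isSelfAdjoint_conjOp hγ).isSymmetric
  rw [ContinuousLinearMap.isSelfAdjoint_iff_isSymmetric]
  intro x y
  change ⟪densityMatrix γ α (pairVec x.fst x.snd), pairVec y.fst y.snd⟫_ℂ =
    ⟪pairVec x.fst x.snd, densityMatrix γ α (pairVec y.fst y.snd)⟫_ℂ
  simp only [densityMatrix_apply, inner_pairVec, inner_add_left, inner_add_right, inner_sub_left,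
    inner_sub_right, hs, hc, ContinuousLinearMap.adjoint_inner_left,
    ContinuousLinearMap.adjoint_inner_right]
  ring

/-- The reflection `(u, w) ↦ (u, -w)`. -/
def reflect : DoubledSp →L[ℂ] DoubledSp := blockOp 1 0 0 (-1)

theorem reflect_apply (u w : OneSp) : reflect (pairVec u w) = pairVec u (-w) := by
  have : reflect (pairVec u w) = pairVec ((1 : OneSp →L[ℂ] OneSp) u + (0 : OneSp →L[ℂ] OneSp) w)
    ((0 : OneSp →L[ℂ] OneSp) u + (-1 : OneSp →L[ℂ] OneSp) w) := rfl
  rw [this]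
  simp

theorem isSelfAdjoint_reflect : IsSelfAdjoint reflect := by
  rw [ContinuousLinearMap.isSelfAdjoint_iff_isSymmetric]
  intro x y
  change ⟪reflect (pairVec x.fst x.snd), pairVec y.fst y.snd⟫_ℂ =
    ⟪pairVec x.fst x.snd, reflect (pairVec y.fst y.snd)⟫_ℂ
  simp only [reflect_apply, inner_pairVec, inner_neg_left, inner_neg_right]

theorem reflect_mul_reflect : reflect * reflect = 1 := by
  ext1 x
  change reflect (reflect (pairVec x.fst x.snd)) = pairVec x.fst x.snd
  rw [reflect_apply, reflect_apply, neg_neg]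

/-- Conjugation with the reflection flips the sign of the off-diagonal blocks, so averaging removes
them. -/
theorem densityMatrix_zero_eq (γ α : OneSp →L[ℂ] OneSp) : densityMatrix γ 0 =
    (1 / 2 : ℝ) • densityMatrix γ α + (1 / 2 : ℝ) • (reflect * densityMatrix γ α * reflect) := by
  ext1 x
  change densityMatrix γ 0 (pairVec x.fst x.snd) = (1 / 2 : ℝ) • densityMatrix γ α (pairVec x.fst x.snd)
    + (1 / 2 : ℝ) • reflect (densityMatrix γ α (reflect (pairVec x.fst x.snd)))
  simp only [reflect_apply, densityMatrix_apply, map_neg, map_zero, zero_apply]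
  simp only [pairVec, ← WithLp.toLp_smul, ← WithLp.toLp_add, Prod.smul_mk, Prod.mk_add_mk]
  congr 2 <;> module

theorem densityMatrix_smul_eq (γ α : OneSp →L[ℂ] OneSp) (ε : ℝ) : densityMatrix γ ((ε : ℂ) • α) =
    densityMatrix γ 0 + (ε : ℂ) • (densityMatrix γ α - densityMatrix γ 0) := by
  ext1 x
  change densityMatrix γ ((ε : ℂ) • α) (pairVec x.fst x.snd) = densityMatrix γ 0 (pairVec x.fst x.snd)
    + (ε : ℂ) • (densityMatrix γ α (pairVec x.fst x.snd) - densityMatrix γ 0 (pairVec x.fst x.snd))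
  simp only [densityMatrix_apply, map_smulₛₗ, Complex.conj_ofReal, smul_apply, map_zero, zero_apply]
  simp only [pairVec, ← WithLp.toLp_smul, ← WithLp.toLp_add, ← WithLp.toLp_sub, Prod.smul_mk,
    Prod.mk_add_mk, Prod.mk_sub_mk]
  congr 2 <;> module

/-! ### Spectral bounds for density matrices -/

theorem HilbertBasis.hasSum_norm_sq {ι H : Type} [NormedAddCommGroup H] [InnerProductSpace ℂ H]
    (B : HilbertBasis ι ℂ H) (u : H) : HasSum (fun i => ‖⟪B i, u⟫_ℂ‖ ^ 2) (‖u‖ ^ 2) := by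
  have h := Complex.reCLM.hasSum (B.hasSum_inner_mul_inner u u)
  rw [Complex.reCLM_apply, inner_self_eq_norm_sq_to_K] at h
  norm_cast at h
  refine (congrArg (fun F => HasSum F _) (funext fun i => ?_)).mp h
  rw [Complex.reCLM_apply, ← inner_conj_symm u, ← Complex.normSq_eq_norm_sq, mul_comm,
    Complex.mul_conj, Complex.ofReal_re]

theorem spectrum_subset_Icc {H : Type} [NormedAddCommGroup H] [InnerProductSpace ℂ H]
    [CompleteSpace H] {A : H →L[ℂ] H} (h0 : 0 ≤ A) {M : ℝ}
    (hM : ∀ x, RCLike.re ⟪x, A x⟫_ℂ ≤ M * ‖x‖ ^ 2) : spectrum ℝ A ⊆ Set.Icc 0 M := by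
  have hsa : IsSelfAdjoint A := .of_nonneg h0
  refine fun x hx => ⟨spectrum_nonneg_of_nonneg h0 hx, ?_⟩
  refine (le_algebraMap_iff_spectrum_le (R := ℝ) (r := M) hsa).1 ?_ x hx
  rw [ContinuousLinearMap.le_def, ContinuousLinearMap.isPositive_def]
  refine ⟨((IsSelfAdjoint.algebraMap _ (star_trivial _)).sub hsa).isSymmetric, fun x => ?_⟩
  rw [ContinuousLinearMap.reApplyInnerSelf_apply, ← inner_conj_symm, RCLike.conj_re, sub_apply,
    inner_sub_right, map_sub, sub_nonneg, Algebra.algebraMap_eq_smul_one]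
  refine (hM x).trans_eq ?_
  rw [smul_apply, one_apply_eq_self, ← Complex.coe_smul, inner_smul_right,
    RCLike.re_eq_complex_re, Complex.re_ofReal_mul, ← RCLike.re_eq_complex_re, inner_self_eq_norm_sq]

section Diagonal
variable {ι : Type} (B : HilbertBasis ι ℂ OneSp) {γ : OneSp →L[ℂ] OneSp} {p : ι → ℝ}
  (hγ : IsSelfAdjoint γ) (hB : ∀ i, γ (B i) = (p i : ℂ) • B i)
include hγ hB

theorem inner_basis_apply (i : ι) (u : OneSp) : ⟪B i, γ u⟫_ℂ = p i * ⟪B i, u⟫_ℂ := by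
  have hs : ⟪γ (B i), u⟫_ℂ = ⟪B i, γ u⟫_ℂ := hγ.isSymmetric _ _
  rw [← hs, hB, inner_smul_left, Complex.conj_ofReal]

theorem hasSum_re_inner_apply (u : OneSp) :
    HasSum (fun i => p i * ‖⟪B i, u⟫_ℂ‖ ^ 2) (RCLike.re ⟪u, γ u⟫_ℂ) := by
  have h := Complex.reCLM.hasSum (B.hasSum_inner_mul_inner u (γ u))
  refine (congrArg (fun F => HasSum F _) (funext fun i => ?_)).mp h
  rw [Complex.reCLM_apply, inner_basis_apply B hγ hB, ← inner_conj_symm u,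
    ← Complex.normSq_eq_norm_sq, mul_left_comm, mul_comm (conj _), Complex.mul_conj,
    ← Complex.ofReal_mul, Complex.ofReal_re]

variable (hp0 : ∀ i, 0 ≤ p i)
include hp0

omit hp0 in
theorem re_inner_apply_le {P : ℝ} (hP : ∀ i, p i ≤ P) (u : OneSp) :
    RCLike.re ⟪u, γ u⟫_ℂ ≤ P * ‖u‖ ^ 2 :=
  hasSum_le (fun i => mul_le_mul_of_nonneg_right (hP i) (by positivity))
    (hasSum_re_inner_apply B hγ hB u) ((HilbertBasis.hasSum_norm_sq B u).mul_left P)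

theorem re_inner_apply_nonneg (u : OneSp) : 0 ≤ RCLike.re ⟪u, γ u⟫_ℂ :=
  (hasSum_re_inner_apply B hγ hB u).nonneg fun i => mul_nonneg (hp0 i) (by positivity)

/-- On each eigenspace this is `p² (1 - p)² ≤ p`. It converts the admissibility bound on `α` into a
form bound by `γ`. -/
theorem norm_sq_mul_one_sub_le (hp1 : ∀ i, p i ≤ 1) (u : OneSp) :
    ‖(γ * (1 - γ)) u‖ ^ 2 ≤ RCLike.re ⟪u, γ u⟫_ℂ := by
  refine hasSum_le (fun i => ?_) (HilbertBasis.hasSum_norm_sq B _) (hasSum_re_inner_apply B hγ hB u)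
  have e : ⟪B i, (γ * (1 - γ)) u⟫_ℂ = (p i * (1 - p i) : ℝ) * ⟪B i, u⟫_ℂ := by
    rw [mul_apply_eq_comp, inner_basis_apply B hγ hB, sub_apply, one_apply_eq_self, inner_sub_right,
      inner_basis_apply B hγ hB]
    push_cast
    ring
  rw [e, norm_mul, mul_pow, Complex.norm_real, Real.norm_eq_abs, sq_abs]
  refine mul_le_mul_of_nonneg_right ?_ (by positivity)
  have h0 := hp0 i
  have h1 := hp1 i
  nlinarith [mul_nonneg h0 (sub_nonneg.2 h1), mul_nonneg h0 h0]

/-- The cross term is absorbed by completing a square: `‖α* u‖²` is bounded by `⟨u, γ u⟩`, and the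
lower block is at least `1 - P > 0`. The crude upper bound `2` is all that the scalar estimates
need. -/
theorem exists_spectrum_densityMatrix {P : ℝ} (hP1 : P < 1) (hP : ∀ i, p i ≤ P)
    {α : OneSp →L[ℂ] OneSp} (hα : ∃ C : ℝ, ∀ u : OneSp,
      ‖ContinuousLinearMap.adjoint α u‖ ^ 2 ≤ C * ‖(γ * (1 - γ)) u‖ ^ 2) :
    ∃ ε₀ > 0, ∀ ε : ℝ, |ε| < ε₀ → 0 ≤ densityMatrix γ ((ε : ℂ) • α) ∧
      spectrum ℝ (densityMatrix γ ((ε : ℂ) • α)) ⊆ Set.Icc 0 2 := by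
  obtain ⟨C, hC⟩ := hα
  set C' := max C 1
  have hC'1 : 1 ≤ C' := le_max_right _ _
  have hc : 0 < 1 - P := sub_pos.2 hP1
  -- The first entry serves positivity, the second gives `|ε| ‖α‖ ≤ 1` for the upper bound.
  refine ⟨min (√((1 - P) / C')) (1 / (‖α‖ + 1)), by positivity, fun ε hε => ?_⟩
  have hε1 : ε ^ 2 * C' ≤ 1 - P := by
    have h1 := hε.trans_le (min_le_left _ _)
    have h2 := (Real.lt_sqrt (abs_nonneg ε)).1 h1
    rw [sq_abs, lt_div_iff₀ (by positivity)] at h2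
    exact h2.le
  have hε2 : |ε| * ‖α‖ ≤ 1 := by
    have h1 := hε.trans_le (min_le_right _ _)
    rw [lt_div_iff₀ (by positivity)] at h1
    nlinarith [abs_nonneg ε]
  have hsa := isSelfAdjoint_densityMatrix hγ ((ε : ℂ) • α)
  have form : ∀ u w : OneSp, RCLike.re ⟪pairVec u w, densityMatrix γ ((ε : ℂ) • α) (pairVec u w)⟫_ℂ =
      RCLike.re ⟪u, γ u⟫_ℂ + 2 * ε * RCLike.re ⟪ContinuousLinearMap.adjoint α u, w⟫_ℂ + (‖w‖ ^ 2 -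
        RCLike.re ⟪conjL2 w, γ (conjL2 w)⟫_ℂ) := by
    intro u w
    have h1 : ⟪w, conjOp γ w⟫_ℂ = conj ⟪conjL2 w, γ (conjL2 w)⟫_ℂ := by
      rw [conjOp_apply, ← inner_conj_symm, inner_conjL2_left]
    rw [densityMatrix_apply, inner_pairVec, map_smulₛₗ, Complex.conj_ofReal, inner_add_right,
      inner_add_right, inner_sub_right, smul_apply, smul_apply, inner_smul_right, inner_smul_right,
      h1, ← ContinuousLinearMap.adjoint_inner_left α, ← inner_conj_symm w]
    simp only [map_add, map_sub, RCLike.conj_re, inner_self_eq_norm_sq]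
    simp only [RCLike.re_eq_complex_re, Complex.re_ofReal_mul, Complex.conj_re]
    ring
  have hnn : ∀ u w : OneSp,
      0 ≤ RCLike.re ⟪pairVec u w, densityMatrix γ ((ε : ℂ) • α) (pairVec u w)⟫_ℂ := by
    intro u w
    rw [form]
    have h1 := norm_sq_mul_one_sub_le B hγ hB hp0 (fun i => (hP i).trans hP1.le) u
    have h2 := re_inner_apply_le B hγ hB hP (conjL2 w)
    rw [norm_conjL2] at h2
    set a := RCLike.re ⟪u, γ u⟫_ℂ
    have h3 : ‖ContinuousLinearMap.adjoint α u‖ ^ 2 ≤ C' * a :=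
      (hC u).trans (mul_le_mul (le_max_left _ _) h1 (by positivity) (by positivity))
    have h4 := (RCLike.abs_re_le_norm ⟪ContinuousLinearMap.adjoint α u, w⟫_ℂ).trans
      (norm_inner_le_norm _ _)
    set s := ‖ContinuousLinearMap.adjoint α u‖
    set r := RCLike.re ⟪ContinuousLinearMap.adjoint α u, w⟫_ℂ
    have h5 : -(|ε| * (s * ‖w‖)) ≤ ε * r := by
      have : |ε * r| ≤ |ε| * (s * ‖w‖) := by rw [abs_mul]; gcongr
      exact (abs_le.1 this).1
    have h6 : 0 ≤ (s / √C' - |ε| * √C' * ‖w‖) ^ 2 := sq_nonneg _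
    have h7 : (s / √C' - |ε| * √C' * ‖w‖) ^ 2 = s ^ 2 / C' - 2 * (|ε| * (s * ‖w‖)) +
        ε ^ 2 * C' * ‖w‖ ^ 2 := by
      have hs := Real.sq_sqrt (by positivity : 0 ≤ C')
      have hs0 : √C' ≠ 0 := by positivity
      rw [sub_sq, div_pow, hs, mul_pow, mul_pow, hs, sq_abs]
      field_simp
    have h8 : s ^ 2 / C' ≤ a := by rw [div_le_iff₀ (by positivity)]; linarith
    have h9 : ε ^ 2 * C' * ‖w‖ ^ 2 ≤ (1 - P) * ‖w‖ ^ 2 :=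
      mul_le_mul_of_nonneg_right hε1 (by positivity)
    linarith
  have hle : ∀ u w : OneSp,
      RCLike.re ⟪pairVec u w, densityMatrix γ ((ε : ℂ) • α) (pairVec u w)⟫_ℂ ≤
        2 * (‖u‖ ^ 2 + ‖w‖ ^ 2) := by
    intro u w
    rw [form]
    have h1 := re_inner_apply_le B hγ hB (fun i => (hP i).trans hP1.le) u
    have h2 := re_inner_apply_nonneg B hγ hB hp0 (conjL2 w)
    have h4 := (RCLike.abs_re_le_norm ⟪ContinuousLinearMap.adjoint α u, w⟫_ℂ).trans
      (norm_inner_le_norm _ _)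
    have h3 : ‖ContinuousLinearMap.adjoint α u‖ ≤ ‖α‖ * ‖u‖ := by
      refine (ContinuousLinearMap.le_opNorm _ _).trans_eq ?_
      rw [LinearIsometryEquiv.norm_map]
    set r := RCLike.re ⟪ContinuousLinearMap.adjoint α u, w⟫_ℂ
    have h5 : ε * r ≤ ‖u‖ * ‖w‖ := by
      calc ε * r ≤ |ε * r| := le_abs_self _
        _ = |ε| * |r| := abs_mul _ _
        _ ≤ |ε| * (‖α‖ * ‖u‖ * ‖w‖) := by
          refine mul_le_mul_of_nonneg_left (h4.trans ?_) (abs_nonneg _)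
          gcongr
        _ = (|ε| * ‖α‖) * (‖u‖ * ‖w‖) := by ring
        _ ≤ 1 * (‖u‖ * ‖w‖) := by gcongr
        _ = _ := one_mul _
    nlinarith [sq_nonneg (‖u‖ - ‖w‖)]
  have h0 : 0 ≤ densityMatrix γ ((ε : ℂ) • α) := by
    rw [ContinuousLinearMap.nonneg_iff_isPositive, ContinuousLinearMap.isPositive_def]
    refine ⟨hsa.isSymmetric, fun x => ?_⟩
    rw [ContinuousLinearMap.reApplyInnerSelf_apply, ← inner_conj_symm, RCLike.conj_re]
    exact hnn x.fst x.snd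
  refine ⟨h0, spectrum_subset_Icc h0 fun x => ?_⟩
  refine (hle x.fst x.snd).trans_eq ?_
  rw [← norm_sq_pairVec]
  rfl

end Diagonal

/-! ### Pinching -/

section Pinching
variable {H : Type} [NormedAddCommGroup H] [InnerProductSpace ℂ H] [CompleteSpace H]

theorem exists_isSelfAdjoint_mul_self {A : H →L[ℂ] H} (hA : A.IsPositive) :
    ∃ S, IsSelfAdjoint S ∧ A = S * S :=
  CStarAlgebra.nonneg_iff_exists_isSelfAdjoint_and_eq_mul_self.1
    ((ContinuousLinearMap.nonneg_iff_isPositive A).2 hA)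

/-- Midpoint convexity is applied to `A` and `U A U`; on an eigenvector of `U` with unimodular
eigenvalue both have the same expectation of `x log x`. -/
theorem re_inner_cfc_xlogx_pinch_le {A A₀ U : H →L[ℂ] H} (hA : 0 ≤ A)
    (hs : spectrum ℝ A ⊆ Set.Icc 0 2) (hs₀ : spectrum ℝ A₀ ⊆ Set.Icc 0 2) (hU : IsSelfAdjoint U)
    (hU2 : U * U = 1) (hA₀ : A₀ = (1 / 2 : ℝ) • A + (1 / 2 : ℝ) • (U * A * U)) {ψ : H} {c : ℂ}
    (hc : ‖c‖ = 1) (hψ : U ψ = c • ψ) :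
    RCLike.re ⟪ψ, cfc (fun x : ℝ => x * Real.log x) A₀ ψ⟫_ℂ ≤
      RCLike.re ⟪ψ, cfc (fun x : ℝ => x * Real.log x) A ψ⟫_ℂ := by
  set f : ℝ → ℝ := fun x => x * Real.log x
  have hx : cfc f (U * A * U) = U * cfc f A * U :=
    cfc_conj_unitary hU hU2 (.of_nonneg hA) Real.continuous_mul_log
  have hsc : spectrum ℝ (U * A * U) ⊆ Set.Icc 0 2 := by
    have := spectrum.units_conjugate (R := ℝ) (a := A) (u := ⟨U, U, hU2, hU2⟩)
    exact this.symm ▸ hs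
  have h1 := cfc_xlogx_midpoint_le hA (hU.conjugate_nonneg hA) hs hsc (hA₀ ▸ hs₀)
  rw [← hA₀, hx] at h1
  have h2 := ((ContinuousLinearMap.le_def _ _).1 h1).re_inner_nonneg_right ψ
  have h3 : ⟪ψ, (U * cfc f A * U) ψ⟫_ℂ = ⟪ψ, cfc f A ψ⟫_ℂ := by
    have hr : ⟪U ψ, cfc f A (U ψ)⟫_ℂ = ⟪ψ, U (cfc f A (U ψ))⟫_ℂ := hU.isSymmetric _ _
    rw [mul_apply_eq_comp, mul_apply_eq_comp, ← hr, hψ, map_smul, inner_smul_left, inner_smul_right,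
      ← mul_assoc, Complex.conj_mul', hc]
    simp
  rw [sub_apply, add_apply, smul_apply, smul_apply, inner_sub_right, inner_add_right,
    ← Complex.coe_smul, ← Complex.coe_smul, inner_smul_right, inner_smul_right, h3] at h2
  simp only [map_sub, map_add, RCLike.re_eq_complex_re, Complex.re_ofReal_mul] at h2 ⊢
  linarith

end Pinching

/-! ### Traces of non-negative operators -/

theorem sum_le_posTrace (P : OneSp →L[ℂ] OneSp) {ι : Type} {e : ι → OneSp} (he : Orthonormal ℂ e)
    (F : Finset ι) : ∑ i ∈ F, ENNReal.ofReal (RCLike.re ⟪e i, P (e i)⟫_ℂ) ≤ posTrace P := by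
  have h1 : ∑ i ∈ F, ENNReal.ofReal (RCLike.re ⟪e i, P (e i)⟫_ℂ) =
      ∑ j : Fin F.card, ENNReal.ofReal (RCLike.re ⟪e (F.equivFin.symm j), P (e (F.equivFin.symm j))⟫_ℂ) := by
    rw [← Finset.sum_coe_sort, ← F.equivFin.symm.sum_comp]
  rw [h1, posTrace]
  have ho : Orthonormal ℂ (fun j : Fin F.card => e (F.equivFin.symm j)) :=
    he.comp (fun j : Fin F.card => ((F.equivFin.symm j : F) : ι))
      (Subtype.val_injective.comp F.equivFin.symm.injective)
  exact le_iSup_of_le F.card (le_iSup_of_le _ (le_iSup_of_le ho le_rfl))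

/-- Writing `P = S²`, expand each `‖S f_j‖²` by Parseval in `B`, exchange the sums and apply
Bessel's inequality to the orthonormal family `f`. Positivity is indispensable here, which is why
the pinching inequality is needed. -/
theorem posTrace_le {P : OneSp →L[ℂ] OneSp} (hP : P.IsPositive) {ι : Type}
    (B : HilbertBasis ι ℂ OneSp) :
    posTrace P ≤ ∑' i, ENNReal.ofReal (RCLike.re ⟪B i, P (B i)⟫_ℂ) := by
  obtain ⟨S, hS, rfl⟩ := exists_isSelfAdjoint_mul_self hP
  have hs : ∀ x y, ⟪S x, y⟫_ℂ = ⟪x, S y⟫_ℂ := hS.isSymmetric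
  have e : ∀ x, RCLike.re ⟪x, (S * S) x⟫_ℂ = ‖S x‖ ^ 2 := fun x => by
    rw [mul_apply_eq_comp, ← hs, inner_self_eq_norm_sq]
  simp only [posTrace, e]
  refine iSup_le fun n => iSup_le fun f => iSup_le fun hf => ?_
  have h1 : ∀ j, ENNReal.ofReal (‖S (f j)‖ ^ 2) = ∑' i, ENNReal.ofReal (‖⟪B i, S (f j)⟫_ℂ‖ ^ 2) :=
    fun j => by
      rw [← (HilbertBasis.hasSum_norm_sq B (S (f j))).tsum_eq,
        ENNReal.ofReal_tsum_of_nonneg (fun i => by positivity)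
          (HilbertBasis.hasSum_norm_sq B (S (f j))).summable]
  simp only [h1]
  rw [← tsum_fintype (L := .unconditional _), ENNReal.tsum_comm]
  refine ENNReal.tsum_le_tsum fun i => ?_
  rw [tsum_fintype, ← ENNReal.ofReal_sum_of_nonneg fun j _ => by positivity]
  refine ENNReal.ofReal_le_ofReal ?_
  have e2 : ∀ j, ‖⟪B i, S (f j)⟫_ℂ‖ = ‖⟪f j, S (B i)⟫_ℂ‖ := fun j => by
    rw [← hs, norm_inner_symm]
  simp only [e2]
  exact hf.sum_inner_products_le (S (B i))

/-! ### The entropy of a perturbed state -/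

theorem isPositive_of_re_inner {P : OneSp →L[ℂ] OneSp} (hP : ∀ u w, ⟪P u, w⟫_ℂ = ⟪u, P w⟫_ℂ)
    (h : ∀ u, 0 ≤ RCLike.re ⟪u, P u⟫_ℂ) : P.IsPositive := by
  rw [ContinuousLinearMap.isPositive_def]
  refine ⟨hP, fun u => ?_⟩
  rw [ContinuousLinearMap.reApplyInnerSelf_apply, ← inner_conj_symm, RCLike.conj_re]
  exact h u

theorem isSelfAdjoint_xlogx (G : DoubledSp →L[ℂ] DoubledSp) : IsSelfAdjoint (xlogx G) :=
  cfc_predicate _ _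

section Entropy
variable {γ α : OneSp →L[ℂ] OneSp} (h0 : 0 ≤ densityMatrix γ α)
  (hs : spectrum ℝ (densityMatrix γ α) ⊆ Set.Icc 0 2)
  (h00 : spectrum ℝ (densityMatrix γ 0) ⊆ Set.Icc 0 2)
include h0 hs h00

theorem re_inner_xlogx_le {ψ : DoubledSp} {c : ℂ} (hc : ‖c‖ = 1) (hψ : reflect ψ = c • ψ) :
    RCLike.re ⟪ψ, xlogx (densityMatrix γ 0) ψ⟫_ℂ ≤ RCLike.re ⟪ψ, xlogx (densityMatrix γ α) ψ⟫_ℂ :=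
  re_inner_cfc_xlogx_pinch_le h0 hs h00 isSelfAdjoint_reflect reflect_mul_reflect
    (densityMatrix_zero_eq γ α) hc hψ

theorem isPositive_block11 :
    (block11 (xlogx (densityMatrix γ α) - xlogx (densityMatrix γ 0))).IsPositive := by
  have hsa : ∀ x y, ⟪(xlogx (densityMatrix γ α) - xlogx (densityMatrix γ 0)) x, y⟫_ℂ =
    ⟪x, (xlogx (densityMatrix γ α) - xlogx (densityMatrix γ 0)) y⟫_ℂ :=
    ((isSelfAdjoint_xlogx _).sub (isSelfAdjoint_xlogx _)).isSymmetric
  refine isPositive_of_re_inner (fun u w => ?_) fun u => ?_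
  · rw [inner_block11, ← hsa, ← inner_conj_symm, inner_block11, inner_conj_symm]
  · rw [inner_block11, sub_apply, inner_sub_right, map_sub, sub_nonneg]
    exact re_inner_xlogx_le h0 hs h00 (c := 1) (by simp) (by rw [reflect_apply, neg_zero, one_smul])

theorem isPositive_block22 :
    (block22 (xlogx (densityMatrix γ α) - xlogx (densityMatrix γ 0))).IsPositive := by
  have hsa : ∀ x y, ⟪(xlogx (densityMatrix γ α) - xlogx (densityMatrix γ 0)) x, y⟫_ℂ =
    ⟪x, (xlogx (densityMatrix γ α) - xlogx (densityMatrix γ 0)) y⟫_ℂ :=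
    ((isSelfAdjoint_xlogx _).sub (isSelfAdjoint_xlogx _)).isSymmetric
  refine isPositive_of_re_inner (fun u w => ?_) fun u => ?_
  · rw [inner_block22, ← hsa, ← inner_conj_symm, inner_block22, inner_conj_symm]
  · rw [inner_block22, sub_apply, inner_sub_right, map_sub, sub_nonneg]
    refine re_inner_xlogx_le h0 hs h00 (c := -1) (by simp) ?_
    rw [reflect_apply, pairVec, pairVec, ← WithLp.toLp_smul, Prod.smul_mk, smul_zero, neg_one_smul]

end Entropy

/-! ### Diagonal entries of the entropy loss -/

section Entry
variable {H : Type} [NormedAddCommGroup H] [InnerProductSpace ℂ H] [CompleteSpace H]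
  {A A₀ : H →L[ℂ] H} {ψ w : H} {p : ℝ} (hA : IsSelfAdjoint A) (hA₀ : IsSelfAdjoint A₀)
  (h₀ : A₀ ψ = (p : ℂ) • ψ) (hw : A ψ = (p : ℂ) • ψ + w) (hψw : ⟪ψ, w⟫_ℂ = 0)
include hA hA₀ h₀ hw hψw

/-- Orthogonality of `w` to `ψ` gives `A` the expectation `p`, so the affine part of `relEnt p`
accounts exactly for the unperturbed entry. -/
theorem re_inner_xlogx_sub : RCLike.re ⟪ψ, (cfc (fun x : ℝ => x * Real.log x) A -
    cfc (fun x : ℝ => x * Real.log x) A₀) ψ⟫_ℂ = RCLike.re ⟪ψ, cfc (relEnt p) A ψ⟫_ℂ := by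
  rw [← re_inner_cfc_relEnt hA (by rw [hw, inner_add_right, hψw, add_zero, inner_smul_right]),
    sub_apply, inner_sub_right, map_sub, cfc_apply_of_eq_smul hA₀ Real.continuous_mul_log h₀,
    inner_smul_right, RCLike.re_eq_complex_re, Complex.re_ofReal_mul, ← RCLike.re_eq_complex_re,
    inner_self_eq_norm_sq]

theorem re_inner_xlogx_sub_le {f : ℝ → ℝ} (hf : Continuous f)
    (h : ∀ x ∈ spectrum ℝ A, relEnt p x ≤ f x * (x - p) ^ 2) :
    RCLike.re ⟪ψ, (cfc (fun x : ℝ => x * Real.log x) A - cfc (fun x : ℝ => x * Real.log x) A₀) ψ⟫_ℂ ≤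
      RCLike.re ⟪w, opFun f A w⟫_ℂ := by
  rw [re_inner_xlogx_sub hA hA₀ h₀ hw hψw]
  refine (re_inner_cfc_mono (continuous_relEnt p) (by fun_prop) h ψ).trans_eq ?_
  rw [re_inner_cfc_mul_sub_sq hA p hf, hw, add_sub_cancel_left]
  rfl

theorem le_re_inner_xlogx_sub {c : ℝ} (h : ∀ x ∈ spectrum ℝ A, c * (x - p) ^ 2 ≤ relEnt p x) :
    c * ‖w‖ ^ 2 ≤ RCLike.re ⟪ψ, (cfc (fun x : ℝ => x * Real.log x) A -
      cfc (fun x : ℝ => x * Real.log x) A₀) ψ⟫_ℂ := by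
  rw [re_inner_xlogx_sub hA hA₀ h₀ hw hψw]
  refine le_trans ?_ (re_inner_cfc_mono (by fun_prop) (continuous_relEnt p) h ψ)
  rw [re_inner_cfc_mul_sub_sq hA p continuous_const, hw, add_sub_cancel_left, cfc_const c A hA,
    Algebra.algebraMap_eq_smul_one, smul_apply, one_apply_eq_self, ← Complex.coe_smul,
    inner_smul_right, RCLike.re_eq_complex_re, Complex.re_ofReal_mul, ← RCLike.re_eq_complex_re,
    inner_self_eq_norm_sq]

end Entry

/-! ### Matrix elements of the functional calculus: continuity in the operator and linearity in the
function. -/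

section Limit
variable {H : Type} [NormedAddCommGroup H] [InnerProductSpace ℂ H] [CompleteSpace H]

theorem opFun_apply_of_eq_smul {A : H →L[ℂ] H} (hA : IsSelfAdjoint A) {f : ℝ → ℝ}
    (hf : Continuous f) {v : H} {t : ℝ} (hv : A v = (t : ℂ) • v) :
    opFun f A v = ((f t : ℝ) : ℂ) • v := cfc_apply_of_eq_smul hA hf hv

theorem tendsto_cfc_apply {X : Type} {l : Filter X} {A : X → H →L[ℂ] H} {A₀ : H →L[ℂ] H}
    (hA : Filter.Tendsto A l (nhds A₀)) {M : ℝ} (hs : ∀ᶠ x in l, spectrum ℝ (A x) ⊆ Set.Icc 0 M)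
    (hsa : ∀ᶠ x in l, IsSelfAdjoint (A x)) (hs₀ : spectrum ℝ A₀ ⊆ Set.Icc 0 M)
    (hsa₀ : IsSelfAdjoint A₀) {g : ℝ → ℝ} (hg : Continuous g) (w : H) :
    Filter.Tendsto (fun x => RCLike.re ⟪w, opFun g (A x) w⟫_ℂ) l
      (nhds (RCLike.re ⟪w, opFun g A₀ w⟫_ℂ)) := by
  have h1 := hA.cfc isCompact_Icc g hs hsa hs₀ hsa₀ hg.continuousOn
  have h2 : Continuous (fun L : H →L[ℂ] H => RCLike.re ⟪w, L w⟫_ℂ) :=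
    RCLike.continuous_re.comp (continuous_const.inner
      (ContinuousLinearMap.apply ℂ H w).continuous)
  exact (h2.tendsto _).comp h1

theorem re_inner_cfc_add_const_mul {A : H →L[ℂ] H} (hA : IsSelfAdjoint A) (c d : ℝ) {g : ℝ → ℝ}
    (hg : Continuous g) (w : H) : RCLike.re ⟪w, opFun (fun x => c + d * g x) A w⟫_ℂ =
      c * ‖w‖ ^ 2 + d * RCLike.re ⟪w, opFun g A w⟫_ℂ := by
  rw [opFun, opFun, cfc_add (a := A) (fun _ => c) (fun x => d * g x) (by fun_prop) (by fun_prop), cfc_const c A hA,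
    cfc_const_mul d g A hg.continuousOn, Algebra.algebraMap_eq_smul_one, add_apply, smul_apply,
    smul_apply, one_apply_eq_self, ← Complex.coe_smul, ← Complex.coe_smul, inner_add_right,
    inner_smul_right, inner_smul_right, map_add, RCLike.re_eq_complex_re, Complex.re_ofReal_mul,
    Complex.re_ofReal_mul, ← RCLike.re_eq_complex_re, inner_self_eq_norm_sq]

end Limit

theorem pairVec_smul (c : ℂ) (u w : OneSp) : c • pairVec u w = pairVec (c • u) (c • w) := rfl

/-! ### The entropy loss in an eigenbasis of the normal state. -/

section Diagonal
variable {ι : Type} (B : HilbertBasis ι ℂ OneSp) {γ α : OneSp →L[ℂ] OneSp} {p : ι → ℝ}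
  (hγ : IsSelfAdjoint γ) (hB : ∀ i, γ (B i) = (p i : ℂ) • B i)

theorem exists_conj_basis : ∃ B' : HilbertBasis ι ℂ OneSp, ∀ i, B' i = conjL2 (B i) := by
  classical
  have ho : Orthonormal ℂ (fun i => conjL2 (B i)) := by
    rw [orthonormal_iff_ite]
    intro i j
    rw [inner_conjL2_conjL2, orthonormal_iff_ite.1 B.orthonormal]
    simp only [eq_comm]
  refine ⟨HilbertBasis.mkOfOrthogonalEqBot ho ?_, fun i => by
    rw [HilbertBasis.coe_mkOfOrthogonalEqBot]⟩
  rw [Submodule.eq_bot_iff]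
  intro u hu
  have h1 : ∀ i, ⟪B i, conjL2 u⟫_ℂ = 0 := fun i => by
    have := (Submodule.mem_orthogonal _ _).1 hu (conjL2 (B i)) (Submodule.subset_span ⟨i, rfl⟩)
    rw [inner_conjL2_left] at this
    rw [← inner_conj_symm, this, map_zero]
  have h2 : conjL2 u = 0 := HilbertBasis.ext_repr B fun i => by
    rw [HilbertBasis.repr_apply_apply, h1, map_zero]
    rfl
  rw [← conjL2_conjL2 u, h2, map_zero]

include hB in
theorem densityMatrix_apply_left (α : OneSp →L[ℂ] OneSp) (i : ι) :
    densityMatrix γ α (pairVec (B i) 0) =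
      (p i : ℂ) • pairVec (B i) 0 + pairVec 0 (ContinuousLinearMap.adjoint α (B i)) := by
  rw [densityMatrix_apply, hB]
  simp [pairVec, ← WithLp.toLp_smul, ← WithLp.toLp_add]

include hB in
theorem densityMatrix_apply_right (α : OneSp →L[ℂ] OneSp) (i : ι) :
    densityMatrix γ α (pairVec 0 (conjL2 (B i))) =
      ((1 - p i : ℝ) : ℂ) • pairVec 0 (conjL2 (B i)) + pairVec (α (conjL2 (B i))) 0 := by
  have : conjOp γ (conjL2 (B i)) = (p i : ℂ) • conjL2 (B i) := by
    rw [conjOp_apply, conjL2_conjL2, hB, map_smulₛₗ, Complex.conj_ofReal]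
  rw [densityMatrix_apply, this]
  simp only [pairVec, ← WithLp.toLp_smul, ← WithLp.toLp_add, map_zero, zero_add, add_zero,
    Prod.smul_mk, smul_zero, Prod.mk_add_mk]
  congr 2
  push_cast
  module

include hB in
theorem densityMatrix_zero_apply_left (i : ι) :
    densityMatrix γ 0 (pairVec (B i) 0) = (p i : ℂ) • pairVec (B i) 0 := by
  rw [densityMatrix_apply_left B hB]
  simp [pairVec]

include hB in
theorem densityMatrix_zero_apply_right (i : ι) : densityMatrix γ 0 (pairVec 0 (conjL2 (B i))) =
    ((1 - p i : ℝ) : ℂ) • pairVec 0 (conjL2 (B i)) := by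
  rw [densityMatrix_apply_right B hB]
  simp [pairVec]

include hγ hB in
-- The upper block alone is kept. No positivity is required, since the supremum in `posTrace`
-- contains every finite part of the basis.
theorem le_entropyLoss (hs : spectrum ℝ (densityMatrix γ α) ⊆ Set.Icc 0 2) {c : ℝ} (hc0 : 0 ≤ c)
    (hc : ∀ i, ∀ x, 0 ≤ x → x ≤ 2 → c * (x - p i) ^ 2 ≤ relEnt (p i) x) (F : Finset ι) :
    ENNReal.ofReal (c * ∑ i ∈ F, ‖ContinuousLinearMap.adjoint α (B i)‖ ^ 2) ≤
      entropyLoss (densityMatrix γ 0) (densityMatrix γ α) := by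
  refine le_trans ?_ (le_self_add (b := posTrace (block22 _)))
  refine le_trans ?_ (sum_le_posTrace _ B.orthonormal F)
  rw [Finset.mul_sum, ENNReal.ofReal_sum_of_nonneg fun i _ => by positivity]
  refine Finset.sum_le_sum fun i _ => ENNReal.ofReal_le_ofReal ?_
  rw [inner_block11]
  have h := le_re_inner_xlogx_sub (isSelfAdjoint_densityMatrix hγ α) (isSelfAdjoint_densityMatrix hγ 0)
    (densityMatrix_zero_apply_left B hB i) (densityMatrix_apply_left B hB α i)
    (by rw [inner_pairVec]; simp) (fun x hx => hc i x (hs hx).1 (hs hx).2)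
  rwa [norm_sq_pairVec, norm_zero, zero_pow two_ne_zero, zero_add] at h

section Upper
variable {F : Finset ι} (hp0 : ∀ i, 0 < p i) (hp1 : ∀ i, p i < 1) (hF : ∀ i ∈ F, p i ≤ 1 / 2)
  (hα : ∀ i ∉ F, ContinuousLinearMap.adjoint α (B i) = 0) (hα' : ∀ i ∉ F, α (conjL2 (B i)) = 0)
  (hs : ∀ᶠ ε : ℝ in nhds 0, 0 ≤ densityMatrix γ ((ε : ℂ) • α) ∧
      spectrum ℝ (densityMatrix γ ((ε : ℂ) • α)) ⊆ Set.Icc 0 2)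
include hγ hB hF hα'

/-- `α*` takes values in the span of the conjugate basis vectors with index in `F`; on them the
lower block has eigenvalue `1 - p ≥ 1/2`, where the function is zero. -/
theorem cfc_defect_apply_eq_zero (i : ι) : opFun (fun x : ℝ => max 0 (1 / 2 - x)) (densityMatrix γ 0)
    (pairVec 0 (ContinuousLinearMap.adjoint α (B i))) = 0 := by
  obtain ⟨B', hB'⟩ := exists_conj_basis B
  set u := ContinuousLinearMap.adjoint α (B i)
  let J : OneSp →L[ℂ] DoubledSp := ((WithLp.prodContinuousLinearEquiv 2 ℂ OneSp OneSp).symm :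
      OneSp × OneSp →L[ℂ] DoubledSp).comp (ContinuousLinearMap.inr ℂ OneSp OneSp)
  have hJ : ∀ u, J u = pairVec 0 u := fun u => rfl
  have h1 := (B'.hasSum_repr u).mapL
    ((opFun (fun x : ℝ => max 0 (1 / 2 - x)) (densityMatrix γ 0)).comp J)
  have e : ∀ j, ((opFun (fun x : ℝ => max 0 (1 / 2 - x)) (densityMatrix γ 0)).comp J)
      (B'.repr u j • B' j) = 0 := by
    intro j
    rw [map_smul, HilbertBasis.repr_apply_apply, hB']
    by_cases hj : j ∈ F
    · rw [ContinuousLinearMap.comp_apply, hJ, opFun_apply_of_eq_smul (isSelfAdjoint_densityMatrix hγ 0)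
        (by fun_prop) (densityMatrix_zero_apply_right B hB j), max_eq_left (by linarith [hF j hj])]
      simp
    · rw [ContinuousLinearMap.adjoint_inner_right, hα' j hj, inner_zero_left, zero_smul]
  simp only [e] at h1
  exact (h1.unique hasSum_zero)

include hp0 hp1 hα hs

/-- In the upper block, where `p` may be tiny, the logarithmic bound `relEnt_upper` is used, and its
defect term tends to zero with `ε` by norm continuity of the functional calculus; finiteness of `F`
makes this uniform. In the lower block the eigenvalue is `1 - p ≥ 1/2`, so the simple bound
`relEnt_le` costs only a factor `2`. -/
theorem eventually_entropyLoss_le {η : ℝ} (hη : 0 < η) : ∀ᶠ ε : ℝ in nhds 0,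
    entropyLoss (densityMatrix γ 0) (densityMatrix γ ((ε : ℂ) • α)) ≤ ENNReal.ofReal (ε ^ 2 *
      (∑ i ∈ F, (128 * (1 - Real.log (p i)) * ‖ContinuousLinearMap.adjoint α (B i)‖ ^ 2 +
        2 * ‖α (conjL2 (B i))‖ ^ 2) + η)) := by
  set g : ℝ → ℝ := fun x => max 0 (1 / 2 - x) with hg
  have hgc : Continuous g := by fun_prop
  set w : ι → DoubledSp := fun i => pairVec 0 (ContinuousLinearMap.adjoint α (B i)) with hw
  have hG0 := hs.self_of_nhds
  rw [Complex.ofReal_zero, zero_smul] at hG0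
  have hGt : Filter.Tendsto (fun ε : ℝ => densityMatrix γ ((ε : ℂ) • α)) (nhds 0)
      (nhds (densityMatrix γ 0)) := by
    have : Continuous (fun ε : ℝ => densityMatrix γ 0 + (ε : ℂ) • (densityMatrix γ α - densityMatrix γ 0)) := by
      fun_prop
    have h := this.tendsto 0
    simp only [← densityMatrix_smul_eq] at h
    simpa using h
  have ht : ∀ i, Filter.Tendsto (fun ε : ℝ => RCLike.re ⟪w i, opFun g (densityMatrix γ ((ε : ℂ) • α)) (w i)⟫_ℂ)
      (nhds 0) (nhds 0) := by
    intro i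
    have h1 := tendsto_cfc_apply hGt (hs.mono fun ε h => h.2) (Filter.Eventually.of_forall fun ε =>
      isSelfAdjoint_densityMatrix hγ _) hG0.2 (isSelfAdjoint_densityMatrix hγ 0) hgc (w i)
    rwa [cfc_defect_apply_eq_zero B hγ hB hF hα' i, inner_zero_right, map_zero] at h1
  have ht2 : Filter.Tendsto (fun ε : ℝ => ∑ i ∈ F, 4 / p i *
      RCLike.re ⟪w i, opFun g (densityMatrix γ ((ε : ℂ) • α)) (w i)⟫_ℂ) (nhds 0) (nhds 0) := by
    simpa using tendsto_finsetSum F fun i _ => (ht i).const_mul (4 / p i)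
  obtain ⟨B', hB'⟩ := exists_conj_basis B
  filter_upwards [hs, ht2.eventually (gt_mem_nhds hη)] with ε hε hε2
  set G := densityMatrix γ ((ε : ℂ) • α) with hG
  have hadj : ContinuousLinearMap.adjoint ((ε : ℂ) • α) = (ε : ℂ) • ContinuousLinearMap.adjoint α := by
    rw [map_smulₛₗ, Complex.conj_ofReal]
  have hGs : IsSelfAdjoint G := isSelfAdjoint_densityMatrix hγ _
  have e1 : ∀ i, RCLike.re ⟪B i, block11 (xlogx G - xlogx (densityMatrix γ 0)) (B i)⟫_ℂ ≤
      ε ^ 2 * (128 * (1 - Real.log (p i)) * ‖ContinuousLinearMap.adjoint α (B i)‖ ^ 2 +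
        4 / p i * RCLike.re ⟪w i, opFun g G (w i)⟫_ℂ) := by
    intro i
    rw [inner_block11]
    have hwε : densityMatrix γ ((ε : ℂ) • α) (pairVec (B i) 0) =
        (p i : ℂ) • pairVec (B i) 0 + (ε : ℂ) • w i := by
      rw [densityMatrix_apply_left B hB, hadj]
      simp only [hw, smul_apply, pairVec_smul, smul_zero]
    refine (re_inner_xlogx_sub_le (f := fun x => 128 * (1 - Real.log (p i)) + 4 / p i * g x) hGs
      (isSelfAdjoint_densityMatrix hγ 0) (densityMatrix_zero_apply_left B hB i) hwε
      (by rw [inner_smul_right, inner_pairVec]; simp) (by fun_prop)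
      (fun x hx => relEnt_upper (hp0 i) (hp1 i).le (hε.2 hx).1 (hε.2 hx).2)).trans_eq ?_
    rw [re_inner_cfc_add_const_mul hGs _ _ hgc, norm_smul, mul_pow, norm_sq_pairVec, norm_zero,
      map_smul, inner_smul_left, inner_smul_right, Complex.conj_ofReal, RCLike.re_eq_complex_re,
      Complex.re_ofReal_mul, Complex.re_ofReal_mul, Complex.norm_real, Real.norm_eq_abs, sq_abs]
    ring
  have e2 : ∀ i, RCLike.re ⟪B' i, block22 (xlogx G - xlogx (densityMatrix γ 0)) (B' i)⟫_ℂ ≤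
      ε ^ 2 * (1 / (1 - p i) * ‖α (conjL2 (B i))‖ ^ 2) := by
    intro i
    rw [inner_block22, hB']
    have hwε : densityMatrix γ ((ε : ℂ) • α) (pairVec 0 (conjL2 (B i))) =
        ((1 - p i : ℝ) : ℂ) • pairVec 0 (conjL2 (B i)) + (ε : ℂ) • pairVec (α (conjL2 (B i))) 0 := by
      rw [densityMatrix_apply_right B hB]
      simp only [smul_apply, pairVec_smul, smul_zero]
    have hq : 0 < 1 - p i := sub_pos.2 (hp1 i)
    refine (re_inner_xlogx_sub_le (f := fun x => 1 / (1 - p i) + 0 * g x) hGs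
      (isSelfAdjoint_densityMatrix hγ 0) (densityMatrix_zero_apply_right B hB i) hwε
      (by rw [inner_smul_right, inner_pairVec]; simp) (by fun_prop)
      (fun x hx => (relEnt_le hq (hε.2 hx).1).trans_eq (by ring))).trans_eq ?_
    rw [re_inner_cfc_add_const_mul hGs _ _ hgc, norm_smul, mul_pow, norm_sq_pairVec, norm_zero,
      Complex.norm_real, Real.norm_eq_abs, sq_abs]
    ring
  have t1 := posTrace_le (isPositive_block11 hε.1 hε.2 hG0.2) B
  have t2 := posTrace_le (isPositive_block22 hε.1 hε.2 hG0.2) B'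
  -- Outside `F` the off-diagonal image of the basis vector is zero, so its diagonal entry is at
  -- most zero and drops out of the trace.
  rw [tsum_eq_sum (s := F) (fun i hi => ?_)] at t1 t2
  rotate_left
  · exact ENNReal.ofReal_eq_zero.2 ((e2 i).trans_eq (by rw [hα' i hi]; simp))
  · exact ENNReal.ofReal_eq_zero.2 ((e1 i).trans_eq (by simp only [hw, hα i hi]; simp [pairVec]))
  have n1 : ∀ i ∈ F, 0 ≤ RCLike.re ⟪B i, block11 (xlogx G - xlogx (densityMatrix γ 0)) (B i)⟫_ℂ :=
    fun i _ => (isPositive_block11 hε.1 hε.2 hG0.2).re_inner_nonneg_right _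
  have n2 : ∀ i ∈ F, 0 ≤ RCLike.re ⟪B' i, block22 (xlogx G - xlogx (densityMatrix γ 0)) (B' i)⟫_ℂ :=
    fun i _ => (isPositive_block22 hε.1 hε.2 hG0.2).re_inner_nonneg_right _
  rw [← ENNReal.ofReal_sum_of_nonneg n1] at t1
  rw [← ENNReal.ofReal_sum_of_nonneg n2] at t2
  refine (add_le_add t1 t2).trans ?_
  rw [← ENNReal.ofReal_add (Finset.sum_nonneg n1) (Finset.sum_nonneg n2)]
  refine ENNReal.ofReal_le_ofReal ?_
  have s1 := Finset.sum_le_sum fun i (_ : i ∈ F) => e1 i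
  have s2 : ∑ i ∈ F, RCLike.re ⟪B' i, block22 (xlogx G - xlogx (densityMatrix γ 0)) (B' i)⟫_ℂ ≤
      ∑ i ∈ F, ε ^ 2 * (2 * ‖α (conjL2 (B i))‖ ^ 2) := by
    refine Finset.sum_le_sum fun i hi => (e2 i).trans ?_
    have hq : 1 / (1 - p i) ≤ 2 := by
      rw [div_le_iff₀ (sub_pos.2 (hp1 i))]
      linarith [hF i hi]
    gcongr
  rw [← Finset.mul_sum, Finset.sum_add_distrib] at s1
  rw [← Finset.mul_sum] at s2
  rw [Finset.sum_add_distrib]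
  nlinarith [mul_le_mul_of_nonneg_left hε2.le (sq_nonneg ε)]

end Upper

end Diagonal

/-! ### Hilbert-Schmidt kernels -/

theorem memLp_mul_prod {φ ψ : Plane → ℂ} (hφ : MemLp φ 2 (volume : Measure Plane))
    (hψ : MemLp ψ 2 (volume : Measure Plane)) :
    MemLp (fun p : Plane × Plane => φ p.1 * ψ p.2) 2 volume := by
  have hm : AEStronglyMeasurable (fun p : Plane × Plane => φ p.1 * ψ p.2) volume :=
    (hφ.1.comp_fst).mul (hψ.1.comp_snd)
  rw [memLp_two_iff_integrable_sq_norm hm]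
  simp only [norm_mul, mul_pow]
  exact ((memLp_two_iff_integrable_sq_norm hφ.1).1 hφ).mul_prod
    ((memLp_two_iff_integrable_sq_norm hψ.1).1 hψ)

section HilbertSchmidt
variable {α : OneSp →L[ℂ] OneSp} {k : Plane × Plane → ℂ}

theorem integrable_mul_kernel (hk : MemLp k 2 volume) {φ ψ : Plane → ℂ}
    (hφ : MemLp φ 2 (volume : Measure Plane)) (hψ : MemLp ψ 2 (volume : Measure Plane)) :
    Integrable (fun p : Plane × Plane => conj (φ p.1) * k p * ψ p.2) volume := by
  have h := (memLp_mul_prod hφ.star hψ).integrable_mul hk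
  refine h.congr (Filter.Eventually.of_forall fun p => ?_)
  simp
  ring

/-- The kernel identity is extended by cutoffs to smooth square integrable functions without compact
support, such as the Landau functions. -/
theorem HasKernel.apply_smooth (hα : HasKernel α k) (hk : MemLp k 2 volume) {f : Plane → ℂ}
    (hf : ContDiff ℝ ∞ f) (hf2 : MemLp f 2 (volume : Measure Plane)) {ψ : Plane → ℂ}
    (hψ : IsTest ψ) : ∫ x, conj (f x) * α (hψ.memLp.toLp ψ) x =
      ∫ p : Plane × Plane, conj (f p.1) * k p * ψ p.2 := by
  obtain ⟨χ, hχ, hχ1⟩ := exists_cutoff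
  let c : ℕ → ℝ := fun k => 1 / ((k : ℝ) + 1)
  have hc0 : ∀ k, c k ≠ 0 := fun k => by positivity
  have hc : Filter.Tendsto c Filter.atTop (nhds 0) := tendsto_one_div_add_atTop_nhds_zero_nat
  obtain ⟨C, hC⟩ := hχ.exists_norm_le
  have ev : ∀ x : Plane, ∀ᶠ k in Filter.atTop, χ (c k • x) = 1 := by
    intro x
    have : Filter.Tendsto (fun k => |c k| * ‖x‖) Filter.atTop (nhds 0) := by
      simpa using hc.abs.mul_const ‖x‖
    filter_upwards [this.eventually (ge_mem_nhds one_pos)] with k hk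
    exact hχ1 _ (by rwa [norm_smul, Real.norm_eq_abs])
  have hφ := fun j => (hχ.dilate (hc0 j)).mul_left hf
  have heq := fun j => hα _ ψ (hφ j) hψ
  have t1 : Filter.Tendsto (fun j => ∫ x, conj (χ (c j • x) * f x) * α (hψ.memLp.toLp ψ) x)
      Filter.atTop (nhds (∫ x, conj (f x) * α (hψ.memLp.toLp ψ) x)) := by
    refine tendsto_integral_of_dominated_convergence (fun x => C * ‖conj (f x) * α (hψ.memLp.toLp ψ) x‖)
      (fun j => ?_) ((integrable_conj_mul_Lp hf2 _).norm.const_mul C) (fun j => ?_) ?_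
    · exact ((hφ j).conj.1.continuous.aestronglyMeasurable).mul (Lp.aestronglyMeasurable _)
    · refine Filter.Eventually.of_forall fun x => ?_
      rw [map_mul, mul_assoc, norm_mul, RCLike.norm_conj]
      gcongr
      exact hC _
    · refine Filter.Eventually.of_forall fun x => tendsto_const_nhds.congr' ?_
      filter_upwards [ev x] with k hk
      rw [hk, one_mul]
  have t2 : Filter.Tendsto (fun j => ∫ p : Plane × Plane, conj (χ (c j • p.1) * f p.1) * k p * ψ p.2)
      Filter.atTop (nhds (∫ p : Plane × Plane, conj (f p.1) * k p * ψ p.2)) := by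
    have hi := integrable_mul_kernel hk hf2 hψ.memLp
    refine tendsto_integral_of_dominated_convergence (fun p => C * ‖conj (f p.1) * k p * ψ p.2‖)
      (fun j => ?_) (hi.norm.const_mul C) (fun j => ?_) ?_
    · exact (integrable_mul_kernel hk (hφ j).memLp hψ.memLp).aestronglyMeasurable
    · refine Filter.Eventually.of_forall fun x => ?_
      rw [map_mul, mul_assoc, mul_assoc, norm_mul, RCLike.norm_conj, mul_assoc]
      gcongr
      exact hC _
    · refine Filter.Eventually.of_forall fun x => tendsto_const_nhds.congr' ?_
      filter_upwards [ev x.1] with k hk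
      rw [hk, one_mul]
  exact tendsto_nhds_unique (t1.congr heq) t2

theorem ae_memLp_left (hk : MemLp k 2 volume) :
    ∀ᵐ y, MemLp (fun x => k (x, y)) 2 (volume : Measure Plane) := by
  have h1 := (memLp_two_iff_integrable_sq_norm hk.1).1 hk
  have h2 : AEStronglyMeasurable (fun z : Plane × Plane => k z.swap) (volume.prod volume) :=
    hk.1.prod_swap
  filter_upwards [h1.prod_left_ae, h2.prodMk_left] with y hy hm
  exact (memLp_two_iff_integrable_sq_norm hm).2 hy

theorem HasKernel.adjoint_apply_ae (hα : HasKernel α k) (hk : MemLp k 2 volume) {f : Plane → ℂ}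
    (hf : ContDiff ℝ ∞ f) (hf2 : MemLp f 2 (volume : Measure Plane)) :
    ∀ᵐ y, conj (ContinuousLinearMap.adjoint α (hf2.toLp f) y) = ∫ x, conj (f x) * k (x, y) := by
  set u := ContinuousLinearMap.adjoint α (hf2.toLp f)
  have hu : MemLp (fun y => conj (u y)) 2 (volume : Measure Plane) := (Lp.memLp u).star
  have hm : AEStronglyMeasurable (fun y => ∫ x, conj (f x) * k (x, y)) (volume : Measure Plane) := by
    have : AEStronglyMeasurable (fun z : Plane × Plane => conj (f z.2) * k z.swap) (volume.prod volume) :=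
      (hf2.star.1.comp_snd).mul hk.1.prod_swap
    exact this.integral_prod_right'
  have hg : MemLp (fun y => ∫ x, conj (f x) * k (x, y)) 2 (volume : Measure Plane) := by
    rw [memLp_two_iff_integrable_sq_norm hm]
    have h1 := ((memLp_two_iff_integrable_sq_norm hk.1).1 hk).integral_prod_right.const_mul
      (‖hf2.toLp f‖ ^ 2)
    refine h1.mono' (hm.norm.pow 2) ?_
    filter_upwards [ae_memLp_left hk] with y hy
    rw [← inner_toLp_toLp hf2 hy, Real.norm_eq_abs, abs_of_nonneg (by positivity), ← norm_sq_toLp hy,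
      ← mul_pow]
    gcongr
    exact norm_inner_le_norm _ _
  refine ae_eq_of_integral_contDiff_smul_eq (hu.locallyIntegrable one_le_two)
    (hg.locallyIntegrable one_le_two) fun g hg1 hg2 => ?_
  have hψ : IsTest (fun x => (g x : ℂ)) := ⟨Complex.ofRealCLM.contDiff.comp hg1,
    hg2.comp_left (g := fun z : ℝ => (z : ℂ)) Complex.ofReal_zero⟩
  have e1 : ∫ x, g x • conj (u x) = ∫ p : Plane × Plane, conj (f p.1) * k p * (g p.2 : ℂ) := by
    rw [← hα.apply_smooth hk hf hf2 hψ, ← inner_toLp hf2, ← ContinuousLinearMap.adjoint_inner_left,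
      ← inner_conj_symm, inner_toLp, ← integral_conj]
    refine integral_congr_ae (Filter.Eventually.of_forall fun x => ?_)
    simp [u]
  have hi := integrable_mul_kernel hk hf2 hψ.memLp
  rw [e1, Measure.volume_eq_prod, integral_prod_symm _ hi]
  refine integral_congr_ae (Filter.Eventually.of_forall fun y => ?_)
  simp only [Complex.real_smul]
  rw [← integral_const_mul]
  exact integral_congr_ae (Filter.Eventually.of_forall fun x => by ring)

theorem memLp_landauN {b : ℝ} (hb : 0 < b) (i : ℕ × ℕ) :
    MemLp (landauN b i) 2 (volume : Measure Plane) := (landauN_gaussDecay hb i).memLp_two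

/-- Parseval in the first variable for almost every value of the second, then dominated convergence.
-/
theorem HasKernel.hasSum_norm_sq_adjoint (hα : HasKernel α k) (hk : MemLp k 2 volume) {b : ℝ}
    (hb : 0 < b) : HasSum (fun i => ‖ContinuousLinearMap.adjoint α (landauBasis hb i)‖ ^ 2)
      (∫ p, ‖k p‖ ^ 2) := by
  have hi := (memLp_two_iff_integrable_sq_norm hk.1).1 hk
  have hae : ∀ i, ∀ᵐ y, conj (ContinuousLinearMap.adjoint α (landauBasis hb i) y) =
      ∫ x, conj (landauN b i x) * k (x, y) := fun i => by
    rw [landauBasis_apply]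
    exact hα.adjoint_apply_ae hk (contDiff_landauN b i) (memLp_landauN hb i)
  have hn : ∀ i, ‖ContinuousLinearMap.adjoint α (landauBasis hb i)‖ ^ 2 =
      ∫ y, ‖∫ x, conj (landauN b i x) * k (x, y)‖ ^ 2 := fun i => by
    have := norm_sq_toLp (Lp.memLp (ContinuousLinearMap.adjoint α (landauBasis hb i)))
    rw [Lp.toLp_coeFn] at this
    rw [this]
    refine integral_congr_ae ?_
    filter_upwards [hae i] with y hy
    rw [← hy, RCLike.norm_conj]
  have hL : ∀ i, Integrable (fun y => ‖∫ x, conj (landauN b i x) * k (x, y)‖ ^ 2)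
      (volume : Measure Plane) := fun i => by
    have h := Lp.memLp (ContinuousLinearMap.adjoint α (landauBasis hb i))
    refine ((memLp_two_iff_integrable_sq_norm h.1).1 h).congr ?_
    filter_upwards [hae i] with y hy
    rw [← hy, RCLike.norm_conj]
  have hP : ∀ᵐ y, HasSum (fun i => ‖∫ x, conj (landauN b i x) * k (x, y)‖ ^ 2)
      (∫ x, ‖k (x, y)‖ ^ 2) := by
    filter_upwards [ae_memLp_left hk] with y hy
    have h := HilbertBasis.hasSum_norm_sq (landauBasis hb) (hy.toLp _)
    rw [norm_sq_toLp] at h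
    refine (congrArg (fun F => HasSum F _) (funext fun i => ?_)).mp h
    rw [landauBasis_apply, landauVec, inner_toLp_toLp]
  have h2 : ∫ p, ‖k p‖ ^ 2 = ∫ y, ∫ x, ‖k (x, y)‖ ^ 2 := by
    rw [Measure.volume_eq_prod, integral_prod_symm _ hi]
  rw [h2]
  simp only [hn]
  refine hasSum_integral_of_dominated_convergence (fun i y => ‖∫ x, conj (landauN b i x) * k (x, y)‖ ^ 2)
    (fun i => (hL i).aestronglyMeasurable) (fun i => Filter.Eventually.of_forall fun y => ?_)
    (hP.mono fun y hy => hy.summable) ?_ hP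
  · rw [Real.norm_eq_abs, abs_of_nonneg (by positivity)]
  · refine hi.integral_prod_right.congr ?_
    filter_upwards [hP] with y hy
    exact hy.tsum_eq.symm

end HilbertSchmidt

/-! ### Stability in strong fields. -/

theorem neg_mul_le_pairEnergy {v : Plane → ℝ} {M : ℝ} (hM : ∀ᵐ x, ‖v x‖ ≤ M)
    {k : Plane × Plane → ℂ} (hk : MemLp k 2 volume) :
    -(M / 2 * ∫ p, ‖k p‖ ^ 2) ≤ pairEnergy v k := by
  have hi := (memLp_two_iff_integrable_sq_norm hk.1).1 hk
  have h1 : ∀ᵐ p : Plane × Plane, ‖v (p.1 - p.2)‖ ≤ M :=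
    (quasiMeasurePreserving_sub (volume : Measure Plane) (volume : Measure Plane)).ae hM
  have h2 : ‖∫ p : Plane × Plane, v (p.1 - p.2) * ‖k p‖ ^ 2‖ ≤ ∫ p, M * ‖k p‖ ^ 2 := by
    refine norm_integral_le_of_norm_le (hi.const_mul M) ?_
    filter_upwards [h1] with p hp
    rw [norm_mul, Real.norm_eq_abs (‖k p‖ ^ 2), abs_of_nonneg (by positivity)]
    gcongr
  rw [integral_const_mul, Real.norm_eq_abs, abs_le] at h2
  rw [pairEnergy]
  linarith [h2.1]

theorem neg_log_fermi (T h : ℝ) : 2 * h / T ≤ -Real.log (fermi T h) := by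
  rw [fermi, Real.log_inv, neg_neg, Real.le_log_iff_exp_le (by positivity)]
  linarith

/-- If the entropy dominates the interaction, then the normal state is stable. -/
theorem isEnergeticallyStable_of_relEnt {v : Plane → ℝ} {M : ℝ} (hM0 : 0 ≤ M) (hM : ∀ᵐ x, ‖v x‖ ≤ M)
    {s T b : ℝ} (hb : 0 < b) (hs : 0 < s) (hT : 0 < T) {γ : OneSp →L[ℂ] OneSp} (hγ : IsSelfAdjoint γ)
    {p : ℕ × ℕ → ℝ} (hB : ∀ i, γ (landauBasis hb i) = (p i : ℂ) • landauBasis hb i)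
    {P : ℝ} (hp0 : ∀ i, 0 < p i) (hP : P < 1) (hpP : ∀ i, p i ≤ P) {c : ℝ} (hc0 : 0 ≤ c)
    (hc : ∀ i, ∀ x, 0 ≤ x → x ≤ 2 → c * (x - p i) ^ 2 ≤ relEnt (p i) x) (hcM : M < s * T * c) :
    IsEnergeticallyStable v s T b γ := by
  intro α k hα hα0
  obtain ⟨ε₀, hε₀, hsp⟩ := exists_spectrum_densityMatrix (landauBasis hb) hγ hB (fun i => (hp0 i).le)
    hP hpP hα.bound
  have hsum := hα.hasKernel.hasSum_norm_sq_adjoint hα.memLp hb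
  set K := ∫ p, ‖k p‖ ^ 2 with hK
  have hKpos : 0 < K := by
    rcases (hsum.nonneg fun i => by positivity).lt_or_eq with h | h
    · exact h
    exfalso
    apply hα0
    rw [← h] at hsum
    have h0 := (hasSum_zero_iff_of_nonneg (fun i => by positivity)).1 hsum
    have h1 : ContinuousLinearMap.adjoint α = 0 := HilbertBasis.ext_apply (landauBasis hb) fun i => by
      have := congrFun h0 i
      simpa using this
    rw [← ContinuousLinearMap.adjoint_adjoint α, h1, map_zero]
  -- A finite set carrying more than half of the Hilbert-Schmidt norm suffices, because the
  -- interaction energy has the prefactor `1/2`.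
  obtain ⟨F, hF⟩ := ((hsum.eventually (lt_mem_nhds (half_lt_self hKpos)))).exists
  refine ⟨ε₀, hε₀, fun ε hε hε' => ?_⟩
  have hent := le_entropyLoss (landauBasis hb) hγ hB (hsp ε hε').2 hc0 hc F
  have hadj : ContinuousLinearMap.adjoint ((ε : ℂ) • α) = (ε : ℂ) • ContinuousLinearMap.adjoint α := by
    rw [map_smulₛₗ, Complex.conj_ofReal]
  have hε2 : 0 < ε ^ 2 := by rw [← sq_abs]; positivity
  simp only [hadj, smul_apply, norm_smul, mul_pow, Complex.norm_real, Real.norm_eq_abs, sq_abs,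
    ← Finset.mul_sum] at hent
  set S := ∑ i ∈ F, ‖ContinuousLinearMap.adjoint α (landauBasis hb i)‖ ^ 2
  have hpair := neg_mul_le_pairEnergy hM (hα.memLp.const_mul (ε : ℂ))
  simp only [norm_mul, mul_pow, Complex.norm_real, Real.norm_eq_abs, sq_abs, integral_const_mul] at hpair
  rw [← hK] at hpair
  have hcomb : ENNReal.ofReal (s * T * (c * (ε ^ 2 * S))) ≤ ENNReal.ofReal (s * T) *
      entropyLoss (densityMatrix γ 0) (densityMatrix γ ((ε : ℂ) • α)) := by
    rw [ENNReal.ofReal_mul (by positivity)]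
    gcongr
  have hS : 0 ≤ S := Finset.sum_nonneg fun i _ => by positivity
  have hpos : 0 < pairEnergy v (fun p => (ε : ℂ) * k p) + s * T * (c * (ε ^ 2 * S)) := by
    have h1 : M / 2 * K < s * T * c * S := by
      have : 0 < s * T * c := lt_of_le_of_lt hM0 hcM
      nlinarith
    nlinarith
  rw [freeEnergyChange]
  refine lt_of_lt_of_le ?_ (add_le_add_right (EReal.coe_ennreal_le_coe_ennreal_iff.2 hcomb) _)
  rw [EReal.coe_ennreal_ofReal, max_eq_left (by positivity)]
  exact_mod_cast hpos

theorem exists_ae_norm_le {v : Plane → ℝ} (hv : MemLp v ⊤ volume) :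
    ∃ M : ℝ, 0 ≤ M ∧ ∀ᵐ x, ‖v x‖ ≤ M := by
  refine ⟨(eLpNormEssSup v volume).toReal, ENNReal.toReal_nonneg, ?_⟩
  have h2 : eLpNormEssSup v volume ≠ ⊤ := by
    rw [← eLpNorm_exponent_top]
    exact hv.2.ne
  filter_upwards [ae_le_eLpNormEssSup (f := v) (μ := volume)] with x hx
  rw [← ENNReal.toReal_ofReal (norm_nonneg (v x)), ofReal_norm]
  exact ENNReal.toReal_mono h2 hx

theorem exists_stabilityTemp_eq_zero {v : Plane → ℝ} {μ s : ℝ} (hv : MemLp v ⊤ volume)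
    (hv0 : ∀ᵐ x, v x ≤ 0) (hv1 : |∫ x, v x| < 1) (hs : 0 < s) :
    ∃ b₁ : ℝ, 0 < b₁ ∧ ∀ b : ℝ, b₁ < b → stabilityTemp v μ s b = 0 := by
  obtain ⟨M, hM0, hM⟩ := exists_ae_norm_le hv
  have hint : ∫ x, v x ≤ 0 := integral_nonpos_of_ae hv0
  -- The first term yields `ν ≤ 3b/4` whenever `T ≤ b`; the second yields `s b / 48 > M`.
  refine ⟨8 * |μ| + 48 * (M + 1) / s, by positivity, fun b hb => ?_⟩
  have hbμ : 8 * |μ| < b := lt_of_le_of_lt (by linarith [show 0 < 48 * (M + 1) / s by positivity]) hb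
  have hbs : 48 * (M + 1) / s < b := lt_of_le_of_lt (by linarith [abs_nonneg μ]) hb
  rw [div_lt_iff₀ hs] at hbs
  have hb0 : 0 < b := lt_of_le_of_lt (by positivity) hbμ
  refine le_antisymm (sInf_le fun T hT _ => ?_) zero_le
  refine ⟨exists_isNormalState hb0 hT hint (by rw [abs_lt] at hv1; exact hv1.1.le),
    fun γ k hN => ?_⟩
  obtain ⟨ν, hν, hγ, hB⟩ := hN.exists_levels hb0 hT
  have hbd := (density_fixedPoint_bounds hT hb0 (neg_nonneg.2 hint)
    (by rw [abs_lt] at hv1; linarith [hv1.1]) hν).2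
  have hp1 : ∀ i : ℕ × ℕ, fermi T (b * (2 * i.1 + 1) - ν) ≤ fermi T (b - ν) := fun i =>
    fermi_anti hT (by nlinarith [i.1.cast_nonneg (α := ℝ)])
  have hp0 : ∀ i : ℕ × ℕ, 0 < fermi T (b * (2 * i.1 + 1) - ν) := fun i => fermi_pos _ _
  have hple : ∀ i : ℕ × ℕ, fermi T (b * (2 * i.1 + 1) - ν) ≤ 1 := fun i => (fermi_lt_one _ _).le
  -- For `T ≤ b` the gap `b - ν ≥ b/4` gives `-log p ≥ b/(2T)`, so the logarithmic bound makes `s T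
  -- c = s b / 48`, independently of `T`. For `T > b` the fixed constant `1/6` is enough.
  rcases le_or_gt T b with hTb | hTb
  · refine isEnergeticallyStable_of_relEnt hM0 hM hb0 hs hT hγ hB hp0 (fermi_lt_one _ _) hp1
      (c := b / (48 * T)) (by positivity) (fun i x h0 h2 => ?_) ?_
    · refine le_trans ?_ (relEnt_lower_log (hp0 i) (hple i) h0 h2)
      refine mul_le_mul_of_nonneg_right ?_ (sq_nonneg _)
      have h1 := neg_log_fermi T (b * (2 * i.1 + 1) - ν)
      have h2 : b / 4 ≤ b * (2 * i.1 + 1) - ν := by nlinarith [i.1.cast_nonneg (α := ℝ)]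
      have h3 : 2 * (b / 4) / T ≤ 2 * (b * (2 * i.1 + 1) - ν) / T := by gcongr
      rw [show b / (48 * T) = 2 * (b / 4) / T / 24 by field_simp; norm_num]
      linarith
    · rw [show s * T * (b / (48 * T)) = b * s / 48 by field_simp]
      linarith
  · refine isEnergeticallyStable_of_relEnt hM0 hM hb0 hs hT hγ hB hp0 (fermi_lt_one _ _) hp1
      (c := 1 / 6) (by positivity) (fun i x h0 h2 => relEnt_lower (hp0 i) (hple i) h0 h2) ?_
    nlinarith

/-! ### Finite rank pairing operators -/

section FiniteRank
variable {b : ℝ} (hb : 0 < b) {τ : Type} (Q : Finset τ) (I J : τ → ℕ × ℕ) (a : τ → ℝ)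

/-- The kernel `∑ a_q e_{I q}(x) e_{J q}(y)`. -/
def pairKer (b : ℝ) (p : Plane × Plane) : ℂ :=
  ∑ q ∈ Q, (a q : ℂ) * (landauN b (I q) p.1 * landauN b (J q) p.2)

/-- The operator with kernel `pairKer`. -/
def pairOp : OneSp →L[ℂ] OneSp := ∑ q ∈ Q, (a q : ℂ) •
  InnerProductSpace.rankOne ℂ (landauBasis hb (I q)) (conjL2 (landauBasis hb (J q)))

theorem pairOp_apply (u : OneSp) : pairOp hb Q I J a u =
    ∑ q ∈ Q, (a q : ℂ) • ⟪conjL2 (landauBasis hb (J q)), u⟫_ℂ • landauBasis hb (I q) := by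
  simp only [pairOp, sum_apply, smul_apply, InnerProductSpace.rankOne_apply]

theorem adjoint_pairOp_apply (u : OneSp) : ContinuousLinearMap.adjoint (pairOp hb Q I J a) u =
    ∑ q ∈ Q, (a q : ℂ) • ⟪landauBasis hb (I q), u⟫_ℂ • conjL2 (landauBasis hb (J q)) := by
  simp only [pairOp, map_sum, map_smulₛₗ, Complex.conj_ofReal, InnerProductSpace.adjoint_rankOne,
    sum_apply, smul_apply, InnerProductSpace.rankOne_apply]

theorem norm_sq_sum_smul {ι H : Type} [NormedAddCommGroup H] [InnerProductSpace ℂ H] {e : ι → H}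
    (he : Orthonormal ℂ e) {Q : Finset τ} {J : τ → ι} (hJ : Set.InjOn J Q) (a : τ → ℝ) :
    ‖∑ q ∈ Q, (a q : ℂ) • e (J q)‖ ^ 2 = ∑ q ∈ Q, a q ^ 2 := by
  classical
  rw [← inner_self_eq_norm_sq (𝕜 := ℂ), sum_inner, map_sum]
  refine Finset.sum_congr rfl fun q hq => ?_
  rw [inner_sum, Finset.sum_eq_single q]
  · rw [inner_smul_left, inner_smul_right, orthonormal_iff_ite.1 he, if_pos rfl, mul_one,
      Complex.conj_ofReal, ← Complex.ofReal_mul, RCLike.re_eq_complex_re, Complex.ofReal_re, sq]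
  · intro q' hq' hne
    rw [inner_smul_left, inner_smul_right, orthonormal_iff_ite.1 he,
      if_neg fun h => hne (hJ hq' hq h.symm), mul_zero, mul_zero]
  · exact fun h => absurd hq h

variable {Q I J} (hinj : ∀ q ∈ Q, ∀ q' ∈ Q, I q = I q' → J q = J q' → q = q')

include hinj in
-- Distinct terms with the same first index have different second indices, so their images are
-- orthogonal and no interference occurs.
theorem norm_sq_adjoint_pairOp (i : ℕ × ℕ) :
    ‖ContinuousLinearMap.adjoint (pairOp hb Q I J a) (landauBasis hb i)‖ ^ 2 =
      ∑ q ∈ Q with I q = i, a q ^ 2 := by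
  obtain ⟨B', hB'⟩ := exists_conj_basis (landauBasis hb)
  rw [adjoint_pairOp_apply, ← norm_sq_sum_smul (e := B') B'.orthonormal (J := J) (Q := Q.filter (I · = i)),
    Finset.sum_filter]
  · congr 2
    refine Finset.sum_congr rfl fun q _ => ?_
    rw [orthonormal_iff_ite.1 (landauBasis hb).orthonormal, hB']
    split_ifs <;> simp
  · intro q hq q' hq' h
    rw [Finset.mem_coe, Finset.mem_filter] at hq hq'
    exact hinj q hq.1 q' hq'.1 (hq.2.trans hq'.2.symm) h

include hinj in
theorem norm_sq_pairOp_conj (j : ℕ × ℕ) :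
    ‖pairOp hb Q I J a (conjL2 (landauBasis hb j))‖ ^ 2 = ∑ q ∈ Q with J q = j, a q ^ 2 := by
  rw [pairOp_apply, ← norm_sq_sum_smul (e := landauBasis hb) (landauBasis hb).orthonormal (J := I)
    (Q := Q.filter (J · = j)), Finset.sum_filter]
  · congr 2
    refine Finset.sum_congr rfl fun q _ => ?_
    rw [inner_conjL2_conjL2, orthonormal_iff_ite.1 (landauBasis hb).orthonormal]
    by_cases h : J q = j
    · rw [if_pos h.symm, if_pos h, one_smul]
    · rw [if_neg (Ne.symm h), if_neg h, zero_smul, smul_zero]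
  · intro q hq q' hq' h
    rw [Finset.mem_coe, Finset.mem_filter] at hq hq'
    exact hinj q hq.1 q' hq'.1 h (hq.2.trans hq'.2.symm)

variable (Q I J)

include hb in
theorem memLp_pairKer : MemLp (pairKer Q I J a b) 2 volume := by
  refine memLp_finsetSum Q fun q _ => ?_
  exact (memLp_mul_prod (memLp_landauN hb (I q)) (memLp_landauN hb (J q))).const_mul _

include hb in
theorem integral_mul_pairKer {φ ψ : Plane → ℂ} (hφ : MemLp φ 2 (volume : Measure Plane))
    (hψ : MemLp ψ 2 (volume : Measure Plane)) :
    ∫ p : Plane × Plane, conj (φ p.1) * pairKer Q I J a b p * ψ p.2 = ∑ q ∈ Q, (a q : ℂ) *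
      ((∫ x, conj (φ x) * landauN b (I q) x) * ∫ y, landauN b (J q) y * ψ y) := by
  have hi : ∀ q, Integrable (fun p : Plane × Plane => (a q : ℂ) *
      ((conj (φ p.1) * landauN b (I q) p.1) * (landauN b (J q) p.2 * ψ p.2))) volume := fun q =>
    (Integrable.mul_prod ((hφ.star).integrable_mul (memLp_landauN hb (I q)))
      ((memLp_landauN hb (J q)).integrable_mul hψ)).const_mul _
  have e : ∀ p : Plane × Plane, conj (φ p.1) * pairKer Q I J a b p * ψ p.2 = ∑ q ∈ Q, (a q : ℂ) *
      ((conj (φ p.1) * landauN b (I q) p.1) * (landauN b (J q) p.2 * ψ p.2)) := fun p => by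
    rw [pairKer, Finset.mul_sum, Finset.sum_mul]
    exact Finset.sum_congr rfl fun q _ => by ring
  simp only [e]
  rw [integral_finsetSum _ fun q _ => hi q]
  refine Finset.sum_congr rfl fun q _ => ?_
  rw [integral_const_mul, Measure.volume_eq_prod, ← integral_prod_mul]

theorem hasKernel_pairOp : HasKernel (pairOp hb Q I J a) (pairKer Q I J a b) := by
  intro φ ψ hφ hψ
  rw [integral_mul_pairKer hb Q I J a hφ.memLp hψ.memLp, ← inner_toLp hφ.memLp, pairOp_apply, inner_sum]
  refine Finset.sum_congr rfl fun q _ => ?_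
  rw [inner_smul_right, inner_smul_right, landauBasis_apply, landauBasis_apply, landauVec, landauVec,
    inner_toLp_toLp, inner_conjL2_left, ← inner_conj_symm, inner_toLp, ← integral_conj]
  rw [mul_comm (∫ x, _) (∫ x, _)]
  congr 2
  refine integral_congr_ae ?_
  filter_upwards [coeFn_conjL2 (hψ.memLp.toLp ψ), hψ.memLp.coeFn_toLp] with x h1 h2
  rw [h1, h2]
  simp

variable {Q I J}

include hb hinj in
theorem integral_norm_sq_pairKer : ∫ p, ‖pairKer Q I J a b p‖ ^ 2 = ∑ q ∈ Q, a q ^ 2 := by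
  classical
  have h := (hasKernel_pairOp hb Q I J a).hasSum_norm_sq_adjoint (memLp_pairKer hb Q I J a) hb
  simp only [norm_sq_adjoint_pairOp hb a hinj] at h
  refine h.unique ?_
  rw [← Finset.sum_fiberwise_of_maps_to (t := Q.image I) fun q hq => Finset.mem_image_of_mem I hq]
  refine hasSum_sum_of_ne_finset_zero fun i hi => Finset.sum_eq_zero fun q hq => ?_
  rw [Finset.mem_filter] at hq
  exact absurd (Finset.mem_image.2 ⟨q, hq.1, hq.2⟩) hi

variable (Q I J)

theorem isAlphaPerturbation_pairOp (hsymm : ∀ x y, pairKer Q I J a b (y, x) = pairKer Q I J a b (x, y))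
    {γ : OneSp →L[ℂ] OneSp} (hγ : IsSelfAdjoint γ) {p : ℕ × ℕ → ℝ}
    (hB : ∀ i, γ (landauBasis hb i) = (p i : ℂ) • landauBasis hb i) (hp0 : ∀ i, 0 < p i)
    (hp1 : ∀ i, p i < 1) : IsAlphaPerturbation b γ (pairOp hb Q I J a) (pairKer Q I J a b) where
  memLp := memLp_pairKer hb Q I J a
  hasKernel := hasKernel_pairOp hb Q I J a
  symm := Filter.Eventually.of_forall fun p => hsymm p.1 p.2
  smooth := by
    refine ⟨pairKer Q I J (fun q => a q * (b * (2 * (I q).1 + 1))) b, memLp_pairKer hb Q I J _,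
      fun φ ψ hφ hψ => ?_⟩
    rw [integral_mul_pairKer hb Q I J a (hφ.magLap b).memLp hψ.memLp,
      integral_mul_pairKer hb Q I J _ hφ.memLp hψ.memLp]
    refine Finset.sum_congr rfl fun q _ => ?_
    rw [integral_conj_magLap_landauN b hφ]
    push_cast
    ring
  bound := by
    have hq : ∀ i, 0 < p i * (1 - p i) := fun i => mul_pos (hp0 i) (sub_pos.2 (hp1 i))
    have hg : ∀ i u, (p i * (1 - p i)) * ‖⟪landauBasis hb i, u⟫_ℂ‖ ≤ ‖(γ * (1 - γ)) u‖ := by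
      intro i u
      have hs : IsSelfAdjoint (γ * (1 - γ)) := by
        rw [mul_sub, mul_one]
        exact hγ.sub (hγ.commute_iff hγ |>.1 (Commute.refl γ))
      have h1 : (γ * (1 - γ)) (landauBasis hb i) = ((p i * (1 - p i) : ℝ) : ℂ) • landauBasis hb i := by
        rw [mul_apply_eq_comp, sub_apply, one_apply_eq_self, hB, map_sub, map_smul, hB]
        push_cast
        module
      have h2 : ⟪landauBasis hb i, (γ * (1 - γ)) u⟫_ℂ = ((p i * (1 - p i) : ℝ) : ℂ) *
          ⟪landauBasis hb i, u⟫_ℂ := by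
        rw [← hs.adjoint_eq, ContinuousLinearMap.adjoint_inner_right, h1, inner_smul_left,
          Complex.conj_ofReal]
      have h3 := norm_inner_le_norm (𝕜 := ℂ) (landauBasis hb i) ((γ * (1 - γ)) u)
      rwa [h2, norm_mul, Complex.norm_real, Real.norm_eq_abs, abs_of_pos (hq i),
        (landauBasis hb).orthonormal.1, one_mul] at h3
    -- Each of the finitely many components of `u` is recovered from that of `γ (1 - γ) u` by
    -- division by `p (1 - p) > 0`.
    refine ⟨(∑ q ∈ Q, |a q| / (p (I q) * (1 - p (I q)))) ^ 2, fun u => ?_⟩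
    rw [← mul_pow]
    gcongr
    rw [adjoint_pairOp_apply, Finset.sum_mul]
    refine (norm_sum_le _ _).trans (Finset.sum_le_sum fun q _ => ?_)
    rw [norm_smul, norm_smul, norm_conjL2, (landauBasis hb).orthonormal.1, mul_one, Complex.norm_real,
      Real.norm_eq_abs, div_mul_eq_mul_div, mul_div_assoc]
    gcongr
    rw [le_div_iff₀ (hq _), mul_comm]
    exact hg _ _

end FiniteRank

/-- The second variation of the free energy along a finite rank perturbation. -/
theorem isEnergeticallyUnstable_of_pairKer {b : ℝ} (hb : 0 < b) {τ : Type} {Q : Finset τ}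
    {I J : τ → ℕ × ℕ} {a : τ → ℝ} (hinj : ∀ q ∈ Q, ∀ q' ∈ Q, I q = I q' → J q = J q' → q = q')
    (hsymm : ∀ x y, pairKer Q I J a b (y, x) = pairKer Q I J a b (x, y)) {v : Plane → ℝ} {s T : ℝ}
    (hs : 0 < s) (hT : 0 < T) {γ : OneSp →L[ℂ] OneSp} (hγ : IsSelfAdjoint γ) {p : ℕ × ℕ → ℝ}
    (hB : ∀ i, γ (landauBasis hb i) = (p i : ℂ) • landauBasis hb i) (hp0 : ∀ i, 0 < p i)
    {P : ℝ} (hP : P < 1) (hpP : ∀ i, p i ≤ P) (hpI : ∀ q ∈ Q, p (I q) ≤ 1 / 2)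
    (hpJ : ∀ q ∈ Q, p (J q) ≤ 1 / 2)
    (hneg : pairEnergy v (pairKer Q I J a b) +
      s * T * ∑ q ∈ Q, a q ^ 2 * (128 * (1 - Real.log (p (I q))) + 2) < 0) :
    IsEnergeticallyUnstable v s T b γ := by
  classical
  set α := pairOp hb Q I J a
  set k := pairKer Q I J a b
  have hp1 : ∀ i, p i < 1 := fun i => (hpP i).trans_lt hP
  have hα : IsAlphaPerturbation b γ α k := isAlphaPerturbation_pairOp hb Q I J a hsymm hγ hB hp0 hp1
  refine ⟨α, k, hα, ?_⟩
  obtain ⟨ε₀, hε₀, hsp⟩ := exists_spectrum_densityMatrix (landauBasis hb) hγ hB (fun i => (hp0 i).le)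
    hP hpP hα.bound
  set F := Q.image I ∪ Q.image J
  have hev : ∀ᶠ ε : ℝ in nhds 0, |ε| < ε₀ := by
    have := (continuous_abs.tendsto (0 : ℝ)).eventually (gt_mem_nhds (by simpa using hε₀))
    simpa using this
  have hF : ∀ i ∈ F, p i ≤ 1 / 2 := by
    intro i hi
    rcases Finset.mem_union.1 hi with h | h <;> obtain ⟨q, hq, rfl⟩ := Finset.mem_image.1 h
    exacts [hpI q hq, hpJ q hq]
  have hIF : ∀ q ∈ Q, I q ∈ F := fun q hq => Finset.mem_union_left _ (Finset.mem_image_of_mem I hq)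
  have hJF : ∀ q ∈ Q, J q ∈ F := fun q hq => Finset.mem_union_right _ (Finset.mem_image_of_mem J hq)
  have h0 : ∀ i ∉ F, ContinuousLinearMap.adjoint α (landauBasis hb i) = 0 := fun i hi => by
    have := norm_sq_adjoint_pairOp hb a hinj i
    rw [Finset.filter_false_of_mem fun q hq (h : I q = i) => hi (h ▸ hIF q hq), Finset.sum_empty] at this
    simpa using this
  have h0' : ∀ i ∉ F, α (conjL2 (landauBasis hb i)) = 0 := fun i hi => by
    have := norm_sq_pairOp_conj hb a hinj i
    rw [Finset.filter_false_of_mem fun q hq (h : J q = i) => hi (h ▸ hJF q hq), Finset.sum_empty] at this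
    simpa using this
  set C := ∑ q ∈ Q, a q ^ 2 * (128 * (1 - Real.log (p (I q))) + 2) with hC
  have hcost : ∑ i ∈ F, (128 * (1 - Real.log (p i)) *
      ‖ContinuousLinearMap.adjoint α (landauBasis hb i)‖ ^ 2 +
        2 * ‖α (conjL2 (landauBasis hb i))‖ ^ 2) = C := by
    simp only [α, norm_sq_adjoint_pairOp hb a hinj, norm_sq_pairOp_conj hb a hinj, hC, mul_add,
      Finset.sum_add_distrib]
    congr 1
    · rw [← Finset.sum_fiberwise_of_maps_to hIF]
      refine Finset.sum_congr rfl fun i _ => ?_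
      rw [Finset.mul_sum]
      refine Finset.sum_congr rfl fun q hq => ?_
      rw [(Finset.mem_filter.1 hq).2, mul_comm]
    · rw [← Finset.sum_fiberwise_of_maps_to hJF]
      refine Finset.sum_congr rfl fun i _ => ?_
      rw [Finset.mul_sum]
      exact Finset.sum_congr rfl fun q hq => mul_comm _ _
  -- The error allowed in the entropy is half of the strict margin.
  obtain ⟨η, hη, hη1⟩ : ∃ η > 0, pairEnergy v k + s * T * (C + η) < 0 := by
    refine ⟨-(pairEnergy v k + s * T * C) / (2 * (s * T)), div_pos (by linarith) (by positivity), ?_⟩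
    rw [mul_add, mul_div_assoc', mul_comm 2 (s * T), mul_div_mul_left _ _ (by positivity)]
    linarith
  have hmain := eventually_entropyLoss_le (landauBasis hb) hγ hB hp0 hp1 hF h0 h0'
    (hev.mono fun ε h => hsp ε h) hη
  rw [hcost] at hmain
  obtain ⟨δ, hδ, hball⟩ := Metric.eventually_nhds_iff.1 hmain
  refine ⟨δ, hδ, fun ε hε hεδ => ?_⟩
  have h := hball (y := ε) (by simpa using hεδ)
  have hε2 : 0 < ε ^ 2 := by rw [← sq_abs]; positivity
  have hC0 : 0 ≤ C := by
    rw [← hcost]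
    refine Finset.sum_nonneg fun i _ => ?_
    have : Real.log (p i) ≤ 0 := Real.log_nonpos (hp0 i).le (hp1 i).le
    have : 0 ≤ 1 - Real.log (p i) := by linarith
    positivity
  have hpe : pairEnergy v (fun p => (ε : ℂ) * k p) = ε ^ 2 * pairEnergy v k := by
    rw [pairEnergy, pairEnergy, mul_left_comm, ← integral_const_mul (ε ^ 2)]
    congr 2
    funext p
    rw [norm_mul, mul_pow, Complex.norm_real, Real.norm_eq_abs, sq_abs]
    ring
  have hcomb : ENNReal.ofReal (s * T) * entropyLoss (densityMatrix γ 0) (densityMatrix γ ((ε : ℂ) • α)) ≤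
      ENNReal.ofReal (s * T * (ε ^ 2 * (C + η))) := by
    rw [ENNReal.ofReal_mul (p := s * T) (by positivity)]
    exact mul_le_mul' le_rfl h
  rw [freeEnergyChange]
  refine lt_of_le_of_lt (add_le_add_right (EReal.coe_ennreal_le_coe_ennreal_iff.2 hcomb) _) ?_
  rw [EReal.coe_ennreal_ofReal, max_eq_left (by positivity), hpe]
  have : ε ^ 2 * pairEnergy v k + s * T * (ε ^ 2 * (C + η)) < 0 := by nlinarith
  exact_mod_cast this

/-! ### Pairs with radial relative motion -/

/-- The projection of `(z - w)^P` to the Landau levels `n` and `n'`. -/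
def relLandau (b : ℝ) (x y : Plane) (P n n' : ℕ) : ℂ :=
  ∑ m ∈ Finset.HasAntidiagonal.antidiagonal P, (P.choose m.1 : ℂ) * ((-1) ^ m.2 *
    (landau b n (fun w => w ^ m.1) x * landau b n' (fun w => w ^ m.2) y))

/-- The raising operator of the relative motion, applied `k` times to `(z - w)^P`. -/
def relRaise (b : ℝ) (x y : Plane) (P k : ℕ) : ℂ :=
  ∑ n ∈ Finset.HasAntidiagonal.antidiagonal k, (k.choose n.1 : ℂ) * ((-1) ^ n.2 * relLandau b x y P n.1 n.2)

theorem landau_succ_pow (b : ℝ) (n m : ℕ) (x : Plane) : landau b (n + 1) (fun w => w ^ m) x =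
    b * conj (zc x) * landau b n (fun w => w ^ m) x -
      2 * (m * landau b n (fun w => w ^ (m - 1)) x) := by
  rw [landau_succ, ← landau_const_mul b n (m : ℂ) (expType_pow _)]
  congr 3
  funext w
  simp

/-- This is the rule `(∂_z - ∂_w) (z - w)^P = 2 P (z - w)^(P-1)`, written in the binomial
coefficients so that the monomials may be replaced by arbitrary sequences. -/
theorem sum_choose_mul_deriv (U V : ℕ → ℂ) (P : ℕ) :
    ∑ m ∈ Finset.HasAntidiagonal.antidiagonal P, (P.choose m.1 : ℂ) * ((-1) ^ m.2 *
      (m.1 * U (m.1 - 1) * V m.2 - U m.1 * (m.2 * V (m.2 - 1)))) =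
    2 * P * ∑ m ∈ Finset.HasAntidiagonal.antidiagonal (P - 1), ((P - 1).choose m.1 : ℂ) * ((-1) ^ m.2 *
      (U m.1 * V m.2)) := by
  cases P with
  | zero => simp
  | succ P =>
    simp only [mul_sub, Finset.sum_sub_distrib, Nat.add_sub_cancel]
    rw [Finset.Nat.sum_antidiagonal_succ, Finset.Nat.sum_antidiagonal_succ']
    simp only [Nat.cast_zero, zero_mul, mul_zero, zero_add, Nat.add_sub_cancel, ← Finset.sum_sub_distrib]
    rw [Finset.mul_sum]
    refine Finset.sum_congr rfl fun m hm => ?_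
    rw [Finset.HasAntidiagonal.mem_antidiagonal] at hm
    have h1 : ((P + 1).choose (m.1 + 1) : ℂ) * (m.1 + 1) = (P + 1) * P.choose m.1 := by
      exact_mod_cast (Nat.add_one_mul_choose_eq P m.1).symm
    have h2 : ((P + 1).choose m.1 : ℂ) * (m.2 + 1) = (P + 1) * P.choose m.1 := by
      have := Nat.choose_mul_succ_eq P m.1
      rw [show P + 1 - m.1 = m.2 + 1 by omega] at this
      rw [mul_comm ((P : ℂ) + 1)]
      exact_mod_cast this.symm
    push_cast
    rw [pow_succ]
    linear_combination ((-1) ^ m.2 * (U m.1 * V m.2)) * (h1 + h2)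

/-- The difference of the two raising operators acts on the relative coordinate only. -/
theorem relLandau_raise (b : ℝ) (x y : Plane) (P n n' : ℕ) :
    relLandau b x y P (n + 1) n' - relLandau b x y P n (n' + 1) =
      b * conj (zc (x - y)) * relLandau b x y P n n' - 4 * P * relLandau b x y (P - 1) n n' := by
  have h := sum_choose_mul_deriv (fun m => landau b n (fun w => w ^ m) x)
    (fun m => landau b n' (fun w => w ^ m) y) P
  rw [mul_comm (4 : ℂ), show (P : ℂ) * 4 = 2 * (2 * P) by ring, mul_assoc (2 : ℂ)]
  simp only [relLandau]
  rw [← h, Finset.mul_sum, Finset.mul_sum, ← Finset.sum_sub_distrib, ← Finset.sum_sub_distrib]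
  refine Finset.sum_congr rfl fun m _ => ?_
  rw [landau_succ_pow, landau_succ_pow, zc_sub, map_sub]
  ring

theorem relRaise_succ (b : ℝ) (x y : Plane) (P k : ℕ) : relRaise b x y P (k + 1) =
    b * conj (zc (x - y)) * relRaise b x y P k - 4 * P * relRaise b x y (P - 1) k := by
  rw [relRaise, Finset.sum_antidiagonal_choose_succ_mul
    (fun i j => (-1) ^ j * relLandau b x y P i j) k, ← Finset.sum_add_distrib, relRaise, relRaise,
    Finset.mul_sum, Finset.mul_sum, ← Finset.sum_sub_distrib]
  refine Finset.sum_congr rfl fun n hn => ?_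
  rw [← Nat.choose_symm_of_eq_add (Finset.HasAntidiagonal.mem_antidiagonal.1 hn).symm]
  have h := relLandau_raise b x y P n.1 n.2
  rw [pow_succ]
  linear_combination ((k.choose n.1 : ℂ) * (-1) ^ n.2) * h

theorem gauss_mul_gauss (b : ℝ) (x y : Plane) : gauss b x * gauss b y =
    gauss (b / 2) (x - y) * gauss (b / 2) (x + y) := by
  simp only [gauss, ← Complex.exp_add, zc_sub, zc_add, map_add, map_sub]
  congr 1
  push_cast
  ring

/-- Relative motion and centre of mass separate: the product of the Gaussians factorises with field
`b/2` in both `x - y` and `x + y`, and the relative raising operator is twice the raising operator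
at field `b/2`. -/
theorem relRaise_eq (b : ℝ) (x y : Plane) (k : ℕ) : ∀ P, relRaise b x y P k =
    2 ^ k * landau (b / 2) k (fun w => w ^ P) (x - y) * gauss (b / 2) (x + y) := by
  induction k with
  | zero =>
    intro P
    have h := (Commute.all (zc x) (-zc y)).add_pow' P
    rw [← sub_eq_add_neg, ← zc_sub] at h
    simp only [relRaise, relLandau, Finset.Nat.antidiagonal_zero, Finset.sum_singleton, landau_zero,
      Nat.choose_self, Nat.cast_one, pow_zero, one_mul]
    rw [mul_assoc, ← gauss_mul_gauss, h, Finset.sum_mul]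
    refine Finset.sum_congr rfl fun m _ => ?_
    rw [nsmul_eq_mul, neg_pow (zc y)]
    ring
  | succ k ih =>
    intro P
    rw [relRaise_succ, ih, ih, landau_succ_pow, pow_succ]
    push_cast
    ring

theorem relRaise_self (b : ℝ) (x y : Plane) (N : ℕ) : relRaise b x y N N =
    (-4) ^ N * (N.factorial : ℂ) * (radial (b / 2) N (x - y) * gauss (b / 2) (x + y)) := by
  have : (N.factorial : ℂ) ≠ 0 := by exact_mod_cast N.factorial_ne_zero
  rw [relRaise_eq, radial, show (-4 : ℂ) = 2 * -2 by norm_num, mul_pow]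
  field_simp

/-- The coefficients of a pair with radial relative motion in the Landau basis. -/
def pairCoeff (b : ℝ) (N : ℕ) (n m : ℕ × ℕ) : ℝ :=
  (-1) ^ (n.2 + m.2) * N.choose n.1 * N.choose m.1 * Real.sqrt (landauNormSq b n.1 m.1) *
    Real.sqrt (landauNormSq b n.2 m.2) / ((-4) ^ N * N.factorial)

theorem landau_pow_eq {b : ℝ} (hb : 0 < b) (n m : ℕ) (x : Plane) : landau b n (fun w => w ^ m) x =
    (Real.sqrt (landauNormSq b n m) : ℂ) * landauN b (n, m) x := by
  have : (Real.sqrt (landauNormSq b n m) : ℂ) ≠ 0 := by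
    exact_mod_cast (Real.sqrt_pos.2 (landauNormSq_pos hb n m)).ne'
  rw [landauN, Complex.ofReal_inv, mul_inv_cancel_left₀ this]

theorem sum_pairCoeff {b : ℝ} (hb : 0 < b) (N : ℕ) (x y : Plane) :
    ∑ n ∈ Finset.HasAntidiagonal.antidiagonal N, ∑ m ∈ Finset.HasAntidiagonal.antidiagonal N, (pairCoeff b N n m : ℂ) *
      (landauN b (n.1, m.1) x * landauN b (n.2, m.2) y) =
        radial (b / 2) N (x - y) * gauss (b / 2) (x + y) := by
  have h0 : ((-4) ^ N * (N.factorial : ℂ)) ≠ 0 :=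
    mul_ne_zero (pow_ne_zero _ (by norm_num)) (by exact_mod_cast N.factorial_ne_zero)
  have hN : (N.factorial : ℂ) ≠ 0 := by exact_mod_cast N.factorial_ne_zero
  refine mul_left_cancel₀ h0 ?_
  rw [← relRaise_self, relRaise, Finset.mul_sum]
  refine Finset.sum_congr rfl fun n _ => ?_
  rw [relLandau, Finset.mul_sum, Finset.mul_sum, Finset.mul_sum]
  refine Finset.sum_congr rfl fun m _ => ?_
  rw [landau_pow_eq hb, landau_pow_eq hb, pairCoeff]
  push_cast
  field_simp
  ring

/-- The factorials in the norms cancel one power of each binomial coefficient. What remains is a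
product of two binomial distributions, for the levels and for the angular momenta, with total mass
`(2π/b)²`. -/
theorem pairCoeff_sq {b : ℝ} (hb : 0 < b) {N : ℕ} {n m : ℕ × ℕ} (hn : n ∈ Finset.HasAntidiagonal.antidiagonal N)
    (hm : m ∈ Finset.HasAntidiagonal.antidiagonal N) : pairCoeff b N n m ^ 2 =
      (2 * Real.pi / b) ^ 2 * ((N.choose n.1 / 2 ^ N) * (N.choose m.1 / 2 ^ N)) := by
  rw [Finset.HasAntidiagonal.mem_antidiagonal] at hn hm
  have e1 : (N.choose n.1 : ℝ) * (n.1.factorial * n.2.factorial) = N.factorial := by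
    have := Nat.choose_mul_factorial_mul_factorial (show n.1 ≤ N by omega)
    rw [show N - n.1 = n.2 by omega] at this
    rw [← mul_assoc]
    exact_mod_cast this
  have e2 : (N.choose m.1 : ℝ) * (m.1.factorial * m.2.factorial) = N.factorial := by
    have := Nat.choose_mul_factorial_mul_factorial (show m.1 ≤ N by omega)
    rw [show N - m.1 = m.2 by omega] at this
    rw [← mul_assoc]
    exact_mod_cast this
  have e3 : landauNormSq b n.1 m.1 * landauNormSq b n.2 m.2 = (2 * Real.pi / b) ^ 2 * 4 ^ N *
      ((n.1.factorial * n.2.factorial) * (m.1.factorial * m.2.factorial)) := by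
    have h4 : ((2 * b) ^ n.1 * (2 * b) ^ n.2) * ((2 / b) ^ m.1 * (2 / b) ^ m.2) = (4 : ℝ) ^ N := by
      rw [← pow_add, ← pow_add, hn, hm, ← mul_pow]
      congr 1
      field_simp
      norm_num
    rw [← h4, landauNormSq, landauNormSq]
    ring
  have hN : (N.factorial : ℝ) ≠ 0 := by exact_mod_cast N.factorial_ne_zero
  rw [pairCoeff, div_pow, mul_pow, mul_pow, Real.sq_sqrt (landauNormSq_pos hb _ _).le,
    Real.sq_sqrt (landauNormSq_pos hb _ _).le, mul_assoc, e3, mul_pow, mul_pow, ← pow_mul,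
    mul_comm _ 2, pow_mul, neg_one_sq, one_pow, one_mul, mul_pow ((-4 : ℝ) ^ N), ← pow_mul (-4 : ℝ),
    mul_comm N 2, pow_mul (-4 : ℝ), show ((-4 : ℝ)) ^ 2 = 4 * 4 by norm_num, mul_pow (4 : ℝ) 4,
    show (4 : ℝ) ^ N = 2 ^ N * 2 ^ N by rw [← mul_pow]; norm_num, div_eq_iff (by positivity)]
  field_simp
  linear_combination ((N.choose n.1 : ℝ) * N.choose m.1) * (e1 * (N.choose m.1 * (m.1.factorial * m.2.factorial)) + e2 * N.factorial)

/-! ### The radial functions as a power series -/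

theorem landau_pow_expand (b : ℝ) (x : Plane) (n : ℕ) : ∀ m : ℕ, landau b n (fun w => w ^ m) x =
    (∑ p ∈ Finset.HasAntidiagonal.antidiagonal n, (n.choose p.1 : ℂ) * ((b * conj (zc x)) ^ p.1 *
      (-2) ^ p.2 * m.descFactorial p.2 * zc x ^ (m - p.2))) * gauss b x := by
  induction n with
  | zero => intro m; simp [landau_zero]
  | succ n ih =>
    intro m
    rw [Finset.sum_antidiagonal_choose_succ_mul
      (fun i j => (b * conj (zc x)) ^ i * (-2) ^ j * m.descFactorial j * zc x ^ (m - j)) n,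
      landau_succ_pow, ih, ih, ← mul_assoc, ← mul_assoc, ← mul_assoc, ← sub_mul, Finset.mul_sum,
      Finset.mul_sum, ← Finset.sum_sub_distrib, ← Finset.sum_add_distrib]
    congr 1
    refine Finset.sum_congr rfl fun p hp => ?_
    rw [← Nat.choose_symm_of_eq_add (Finset.HasAntidiagonal.mem_antidiagonal.1 hp).symm]
    rcases m with _ | m
    · simp
      ring
    · rw [Nat.succ_descFactorial_succ, Nat.add_sub_cancel, Nat.add_sub_add_right]
      push_cast
      ring

/-- The coefficients of a series interpolating between Laguerre polynomials and Bessel functions. -/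
def besselCoeff (β E : ℝ) (j : ℕ) : ℝ :=
  (-1) ^ j * (∏ i ∈ Finset.range j, (E - i * β)) / (j.factorial : ℝ) ^ 2

/-- A series interpolating between Laguerre polynomials and Bessel functions. -/
def besselSeries (β E : ℝ) (t : ℂ) : ℂ := ∑' j : ℕ, (besselCoeff β E j : ℂ) * t ^ j

theorem prod_mul_nat_sub (b : ℝ) (N j : ℕ) : ∏ i ∈ Finset.range j, (b * N - i * b) =
    b ^ j * N.descFactorial j := by
  induction j with
  | zero => simp
  | succ j ih =>
    rw [Finset.prod_range_succ, ih, Nat.descFactorial_succ]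
    rcases le_or_gt j N with h | h
    · rw [Nat.cast_mul, Nat.cast_sub h]
      ring
    · rw [Nat.descFactorial_of_lt h]
      simp

theorem besselCoeff_mul_nat (b : ℝ) (N j : ℕ) :
    besselCoeff b (b * N) j = (-b) ^ j * N.choose j / j.factorial := by
  have : (j.factorial : ℝ) ≠ 0 := by exact_mod_cast j.factorial_ne_zero
  rw [besselCoeff, prod_mul_nat_sub, Nat.descFactorial_eq_factorial_mul_choose, neg_pow b]
  push_cast
  field_simp

/-- At `E = b N` the series terminates and is a Laguerre polynomial; at `β = 0` it is a Bessel
function. Thus weak fields at fixed energy `b N` become a regular limit. -/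
theorem radial_eq_besselSeries (b : ℝ) (N : ℕ) (x : Plane) : radial (b / 2) N x =
    besselSeries b (b * N) (‖x‖ ^ 2 / 4 : ℝ) * gauss (b / 2) x := by
  have hN : (N.factorial : ℂ) ≠ 0 := by exact_mod_cast N.factorial_ne_zero
  have h2 : ((-2 : ℂ)) ^ N ≠ 0 := pow_ne_zero _ (by norm_num)
  rw [radial, landau_pow_expand, besselSeries, tsum_eq_sum (s := Finset.range (N + 1)),
    ← mul_assoc]
  · congr 1
    rw [Finset.Nat.sum_antidiagonal_eq_sum_range_succ_mk, Finset.mul_sum]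
    refine Finset.sum_congr rfl fun j hj => ?_
    have hj' : j ≤ N := Nat.lt_succ_iff.1 (Finset.mem_range.1 hj)
    have hjf : (j.factorial : ℂ) ≠ 0 := by exact_mod_cast j.factorial_ne_zero
    have e1 : (N.descFactorial (N - j) : ℂ) * j.factorial = N.factorial := by
      have := Nat.factorial_mul_descFactorial (Nat.sub_le N j)
      rw [Nat.sub_sub_self hj'] at this
      rw [mul_comm]
      exact_mod_cast this
    have e2 : (-2 : ℂ) ^ (N - j) * (-2) ^ j = (-2) ^ N := by
      rw [← pow_add, Nat.sub_add_cancel hj']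
    have e3 : conj (zc x) ^ j * zc x ^ j = (‖x‖ ^ 2 : ℝ) ^ j := by
      rw [← mul_pow, mul_comm, Complex.mul_conj, Complex.normSq_eq_norm_sq, norm_zc]
    have e4 : ((b / 2 : ℝ) : ℂ) ^ j = (-(b : ℂ)) ^ j / 4 ^ j * (-2) ^ j := by
      rw [← div_pow, ← mul_pow]
      congr 1
      push_cast
      ring
    rw [besselCoeff_mul_nat, Nat.sub_sub_self hj', ← e1, ← e2]
    have hd : (N.descFactorial (N - j) : ℂ) ≠ 0 := fun h => by
      rw [h, zero_mul] at e1
      exact hN e1.symm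
    have h3 : ((-2 : ℂ)) ^ (N - j) ≠ 0 := pow_ne_zero _ (by norm_num)
    have h4 : ((-2 : ℂ)) ^ j ≠ 0 := pow_ne_zero _ (by norm_num)
    rw [mul_pow, e4]
    push_cast at e3 ⊢
    rw [div_pow, ← e3]
    field_simp
  · intro j hj
    rw [besselCoeff_mul_nat, Nat.choose_eq_zero_of_lt (by simpa using hj)]
    simp

/-- Each factor is at most `(M + 1)(i + 1)`; the product consumes one of the two factorials, and the
other one makes the series converge uniformly in the parameters, down to `β = 0`. -/
theorem abs_besselCoeff_le {β E M : ℝ} (hβ : |β| ≤ 1) (hE : |E| ≤ M) (j : ℕ) :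
    |besselCoeff β E j| ≤ (M + 1) ^ j / j.factorial := by
  have hM : 0 ≤ M := (abs_nonneg E).trans hE
  have h1 : ∏ i ∈ Finset.range j, |E - i * β| ≤ (M + 1) ^ j * j.factorial := by
    rw [← Finset.prod_range_add_one_eq_factorial, Nat.cast_prod]
    conv_rhs => rw [← Finset.card_range j, ← Finset.prod_const, Finset.card_range]
    rw [← Finset.prod_mul_distrib]
    refine Finset.prod_le_prod (fun _ _ => abs_nonneg _) fun i _ => ?_
    calc |E - i * β| ≤ |E| + |i * β| := abs_sub _ _
      _ ≤ M + i * 1 := by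
        rw [abs_mul, Nat.abs_cast]
        gcongr
      _ ≤ _ := by
        push_cast
        nlinarith [i.cast_nonneg (α := ℝ)]
  have hj : (0 : ℝ) < j.factorial := by exact_mod_cast j.factorial_pos
  rw [besselCoeff, abs_div, abs_mul, abs_pow, abs_neg, abs_one, one_pow, one_mul, Finset.abs_prod,
    abs_of_pos (pow_pos hj 2), div_le_div_iff₀ (by positivity) hj]
  nlinarith

theorem norm_besselTerm_le {β E M R : ℝ} (hβ : |β| ≤ 1) (hE : |E| ≤ M) {t : ℂ} (ht : ‖t‖ ≤ R) (j : ℕ) :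
    ‖(besselCoeff β E j : ℂ) * t ^ j‖ ≤ ((M + 1) * R) ^ j / j.factorial := by
  have hM : 0 ≤ M := (abs_nonneg E).trans hE
  rw [norm_mul, Complex.norm_real, Real.norm_eq_abs, norm_pow, mul_pow, mul_div_right_comm]
  gcongr
  exact abs_besselCoeff_le hβ hE j

theorem continuous_besselCoeff (j : ℕ) : Continuous fun q : ℝ × ℝ => besselCoeff q.1 q.2 j := by
  unfold besselCoeff
  fun_prop

theorem continuousOn_besselSeries (M R : ℝ) : ContinuousOn
    (fun q : (ℝ × ℝ) × ℂ => besselSeries q.1.1 q.1.2 q.2)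
    ((Set.Icc 0 1 ×ˢ Set.Icc 0 M) ×ˢ Metric.closedBall 0 R) := by
  refine continuousOn_tsum (fun j => Continuous.continuousOn ?_)
    (Real.summable_pow_div_factorial ((M + 1) * R)) fun j q hq => ?_
  · exact (Complex.continuous_ofReal.comp ((continuous_besselCoeff j).comp continuous_fst)).mul
      (continuous_snd.pow j)
  · obtain ⟨⟨⟨h1, h2⟩, h3, h4⟩, h5⟩ := hq
    exact norm_besselTerm_le (by rw [abs_of_nonneg h1]; exact h2) (by rw [abs_of_nonneg h3]; exact h4)
      (by simpa using h5) j

theorem besselSeries_zero (β E : ℝ) : besselSeries β E 0 = 1 := by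
  rw [besselSeries, tsum_eq_single 0]
  · simp [besselCoeff]
  · intro j hj
    simp [hj]

/-- An entire function equal to one at the origin has countably many zeros, which correspond to
countably many circles in the plane. -/
theorem ae_besselSeries_ne_zero {β E : ℝ} (hβ : |β| ≤ 1) :
    ∀ᵐ x : Plane, besselSeries β E (‖x‖ ^ 2 / 4 : ℝ) ≠ 0 := by
  have hd : Differentiable ℂ (besselSeries β E) := by
    intro t
    have h : DifferentiableOn ℂ (besselSeries β E) (Metric.ball 0 (‖t‖ + 1)) := by
      refine Complex.differentiableOn_tsum_of_summable_norm
        (Real.summable_pow_div_factorial ((|E| + 1) * (‖t‖ + 1))) (fun j => by fun_prop)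
        Metric.isOpen_ball fun j w hw => ?_
      exact norm_besselTerm_le hβ le_rfl (by simpa using (Metric.mem_ball.1 hw).le) j
    exact h.differentiableAt (Metric.isOpen_ball.mem_nhds (by simp))
  have han : AnalyticOnNhd ℂ (besselSeries β E) Set.univ := fun t _ => hd.analyticAt t
  have hc := mem_codiscrete'.1 (han.preimage_zero_mem_codiscrete (x := 0)
    (by rw [besselSeries_zero]; exact one_ne_zero))
  set Z := (besselSeries β E ⁻¹' {0}ᶜ)ᶜ with hZ
  have hZc : Z.Countable := by
    have := isDiscrete_iff_discreteTopology.1 hc.2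
    exact countable_of_Lindelof_of_discrete (X := Z)
  rw [ae_iff]
  refine measure_mono_null (t := ⋃ z ∈ Z, Metric.sphere (0 : Plane) (2 * Real.sqrt ‖z‖)) ?_ ?_
  · intro x hx
    replace hx : besselSeries β E (‖x‖ ^ 2 / 4 : ℝ) = 0 := not_not.1 hx
    refine Set.mem_biUnion (x := ((‖x‖ ^ 2 / 4 : ℝ) : ℂ)) (fun h => h hx) ?_
    rw [mem_sphere_zero_iff_norm, Complex.norm_real, Real.norm_of_nonneg (by positivity),
      show ‖x‖ ^ 2 / 4 = (‖x‖ / 2) ^ 2 by ring, Real.sqrt_sq (by positivity)]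
    ring
  · exact (measure_biUnion_null_iff hZc).2 fun z _ => Measure.addHaar_sphere _ _ _

/-- The common profile of the radial functions. -/
def profile (q : ℝ × ℝ) (x : Plane) : ℂ :=
  besselSeries q.1 q.2 (‖x‖ ^ 2 / 4 : ℝ) * gauss (q.1 / 2) x

theorem continuousOn_profile (M R : ℝ) : ContinuousOn (fun q : (ℝ × ℝ) × Plane => profile q.1 q.2)
    ((Set.Icc 0 1 ×ˢ Set.Icc 0 M) ×ˢ Metric.closedBall 0 R) := by
  refine ContinuousOn.mul ?_ (Continuous.continuousOn ?_)
  · refine (continuousOn_besselSeries M (R ^ 2 / 4)).comp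
      (f := fun q : (ℝ × ℝ) × Plane => (q.1, ((‖q.2‖ ^ 2 / 4 : ℝ) : ℂ)))
      (Continuous.continuousOn (by fun_prop)) fun q hq => ⟨hq.1, ?_⟩
    have : ‖q.2‖ ≤ R := by simpa using hq.2
    rw [mem_closedBall_zero_iff, Complex.norm_real, Real.norm_of_nonneg (by positivity)]
    gcongr
  · simp only [gauss_eq]
    fun_prop

theorem exists_closedBall_not_ae_zero {v : Plane → ℝ} (hv : ¬ ∀ᵐ x, v x = 0) :
    ∃ R : ℝ, ¬ ∀ᵐ x ∂(volume.restrict (Metric.closedBall (0 : Plane) R)), v x = 0 := by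
  by_contra! h
  apply hv
  have h1 : ∀ n : ℕ, ∀ᵐ x, x ∈ Metric.closedBall (0 : Plane) n → v x = 0 := fun n =>
    (ae_restrict_iff' Metric.isClosed_closedBall.measurableSet).1 (h n)
  filter_upwards [ae_all_iff.2 h1] with x hx
  obtain ⟨n, hn⟩ := exists_nat_ge ‖x‖
  exact hx n (by simpa using hn)

/-- The integral is continuous and positive on a compact parameter set that includes zero field, so
the bound does not degenerate as `b → 0`. -/
theorem exists_profile_lower_bound {v : Plane → ℝ} (hv : Integrable v) (hv0 : ¬ ∀ᵐ x, v x = 0) (M : ℝ) :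
    ∃ R : ℝ, ∃ c > 0, ∀ q ∈ Set.Icc (0 : ℝ) 1 ×ˢ Set.Icc 0 M,
      c ≤ ∫ x in Metric.closedBall 0 R, |v x| * ‖profile q x‖ ^ 2 := by
  obtain ⟨R, hR⟩ := exists_closedBall_not_ae_zero hv0
  refine ⟨R, ?_⟩
  set K := Set.Icc (0 : ℝ) 1 ×ˢ Set.Icc 0 M
  have hK : IsCompact K := isCompact_Icc.prod isCompact_Icc
  have hB : IsCompact (Metric.closedBall (0 : Plane) R) := isCompact_closedBall _ _
  have hcont := continuousOn_profile M R
  obtain ⟨C, hC⟩ := (hK.prod hB).exists_bound_of_continuousOn hcont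
  have hm : ∀ q ∈ K, AEStronglyMeasurable (fun x => |v x| * ‖profile q x‖ ^ 2)
      (volume.restrict (Metric.closedBall (0 : Plane) R)) := fun q hq => by
    refine (continuous_abs.comp_aestronglyMeasurable hv.1.restrict).mul ?_
    refine ContinuousOn.aestronglyMeasurable ?_ Metric.isClosed_closedBall.measurableSet
    exact (hcont.comp (f := fun x => (q, x)) (Continuous.continuousOn (by fun_prop))
      fun x hx => ⟨hq, hx⟩).norm.pow 2
  have hbd : ∀ q ∈ K, ∀ᵐ x ∂(volume.restrict (Metric.closedBall (0 : Plane) R)),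
      ‖|v x| * ‖profile q x‖ ^ 2‖ ≤ |v x| * C ^ 2 := fun q hq => by
    filter_upwards [ae_restrict_mem Metric.isClosed_closedBall.measurableSet] with x hx
    rw [Real.norm_of_nonneg (by positivity)]
    gcongr
    exact hC (q, x) ⟨hq, hx⟩
  have hbi : Integrable (fun x => |v x| * C ^ 2) (volume.restrict (Metric.closedBall (0 : Plane) R)) :=
    (hv.abs.mul_const _).restrict
  have hQ : ContinuousOn (fun q => ∫ x in Metric.closedBall 0 R, |v x| * ‖profile q x‖ ^ 2) K := by
    refine continuousOn_of_dominated hm hbd hbi ?_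
    filter_upwards [ae_restrict_mem Metric.isClosed_closedBall.measurableSet] with x hx
    exact continuousOn_const.mul ((hcont.comp (f := fun q => (q, x)) (Continuous.continuousOn (by fun_prop))
      fun q hq => ⟨hq, hx⟩).norm.pow 2)
  rcases K.eq_empty_or_nonempty with he | hne
  · exact ⟨1, one_pos, fun q hq => by rw [he] at hq; exact hq.elim⟩
  obtain ⟨q₀, hq₀, hmin⟩ := hK.exists_isMinOn hne hQ
  refine ⟨_, ?_, hmin⟩
  rw [gt_iff_lt, integral_pos_iff_support_of_nonneg_ae
    (Filter.Eventually.of_forall fun x => by positivity) (hbi.mono' (hm q₀ hq₀) (hbd q₀ hq₀)), pos_iff_ne_zero]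
  intro h0
  apply hR
  have hz : ∀ᵐ x ∂(volume.restrict (Metric.closedBall (0 : Plane) R)), |v x| * ‖profile q₀ x‖ ^ 2 = 0 := by
    rw [ae_iff]
    exact h0
  have hb1 : |q₀.1| ≤ 1 := by
    rw [abs_of_nonneg hq₀.1.1]
    exact hq₀.1.2
  filter_upwards [hz, ae_restrict_of_ae (ae_besselSeries_ne_zero (E := q₀.2) hb1)] with x h1 h2
  rcases mul_eq_zero.1 h1 with h | h
  · exact abs_eq_zero.1 h
  · refine absurd h (pow_ne_zero _ (norm_ne_zero_iff.2 (mul_ne_zero h2 ?_)))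
    exact Complex.exp_ne_zero _

/-! ### The interaction energy of radial pairs -/

theorem integrable_mul_norm_sq {v : Plane → ℝ} (hv : Integrable v) {g : Plane → ℂ} (hg : Continuous g)
    {C : ℝ} (hC : ∀ x, ‖g x‖ ≤ C) : Integrable (fun x => |v x| * ‖g x‖ ^ 2) := by
  refine (hv.abs.mul_const (C ^ 2)).mono' ((continuous_abs.comp_aestronglyMeasurable hv.1).mul
    (hg.norm.pow 2).aestronglyMeasurable) (Filter.Eventually.of_forall fun x => ?_)
  rw [Real.norm_of_nonneg (by positivity)]
  gcongr
  exact hC x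

theorem norm_sum_radial_le {b : ℝ} (hb : 0 < b) (D : Finset ℕ) {w : ℕ → ℝ} (hw : ∀ d ∈ D, 0 ≤ w d)
    (n : ℕ) (x : Plane) : ‖∑ d ∈ D, (w d : ℂ) * radial b (n + d) x‖ ≤ ∑ d ∈ D, w d := by
  refine (norm_sum_le _ _).trans (Finset.sum_le_sum fun d hd => ?_)
  rw [norm_mul, Complex.norm_real, Real.norm_of_nonneg (hw d hd)]
  exact mul_le_of_le_one_right (hw d hd) (norm_radial_le hb _ _)

theorem continuous_sum_radial (b : ℝ) (D : Finset ℕ) (w : ℕ → ℝ) (n : ℕ) :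
    Continuous fun x => ∑ d ∈ D, (w d : ℂ) * radial b (n + d) x :=
  continuous_finsetSum _ fun d _ => continuous_const.mul (continuous_radial b (n + d))

/-- Uniform continuity of `profile` on a ball that sees part of `v`: if `b d ≤ Λ`, all functions in
the sum are close to the one with `d = 0`. They add up coherently and the square of the total weight
appears. -/
theorem exists_sum_radial_lower_bound {v : Plane → ℝ} (hv : Integrable v) (hv0 : ¬ ∀ᵐ x, v x = 0)
    (M : ℝ) : ∃ c > 0, ∃ Λ > 0, Λ ≤ 1 ∧ ∀ b : ℝ, 0 < b → b ≤ 1 → ∀ n : ℕ, b * n ≤ M →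
      ∀ (D : Finset ℕ) (w : ℕ → ℝ), (∀ d ∈ D, 0 ≤ w d) → (∀ d ∈ D, b * d ≤ Λ) →
        c * (∑ d ∈ D, w d) ^ 2 ≤
          ∫ x, |v x| * ‖∑ d ∈ D, (w d : ℂ) * radial (b / 2) (n + d) x‖ ^ 2 := by
  obtain ⟨R, c, hc, hlow⟩ := exists_profile_lower_bound hv hv0 (M + 1)
  have hcont := continuousOn_profile (M + 1) R
  have hU := ((isCompact_Icc.prod isCompact_Icc).prod
    (isCompact_closedBall (0 : Plane) R)).uniformContinuousOn_of_continuous hcont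
  rw [Metric.uniformContinuousOn_iff] at hU
  set V := ∫ x, |v x| with hV
  have hV0 : 0 ≤ V := integral_nonneg fun x => abs_nonneg _
  -- The tolerance is chosen so that replacing every function by the one with `d = 0` costs at most
  -- half of `c`.
  set η := Real.sqrt (c / (4 * (V + 1)))
  have hη : 0 < η := Real.sqrt_pos.2 (by positivity)
  have hηV : η ^ 2 * V ≤ c / 4 := by
    rw [Real.sq_sqrt (by positivity), div_mul_eq_mul_div, div_le_div_iff₀ (by positivity) (by norm_num)]
    nlinarith
  obtain ⟨δ, hδ, hUδ⟩ := hU η hη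
  refine ⟨c / 4, by positivity, min 1 (δ / 2), by positivity, min_le_left _ _, ?_⟩
  intro b hb hb1 n hn D w hw hD
  set W := ∑ d ∈ D, w d with hW
  have hW0 : 0 ≤ W := Finset.sum_nonneg hw
  set g := fun x => ∑ d ∈ D, (w d : ℂ) * radial (b / 2) (n + d) x with hg
  have hgi := integrable_mul_norm_sq hv (continuous_sum_radial (b / 2) D w n)
    (norm_sum_radial_le (half_pos hb) D hw n)
  have hq : ((b, b * n) : ℝ × ℝ) ∈ Set.Icc (0 : ℝ) 1 ×ˢ Set.Icc 0 (M + 1) :=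
    ⟨⟨hb.le, hb1⟩, by positivity, by linarith⟩
  have hrad : ∀ (N : ℕ) (x : Plane), radial (b / 2) N x = profile (b, b * N) x :=
    fun N x => radial_eq_besselSeries b N x
  have hpt : ∀ x ∈ Metric.closedBall (0 : Plane) R,
      W ^ 2 * ‖profile (b, b * n) x‖ ^ 2 ≤ 2 * ‖g x‖ ^ 2 + 2 * η ^ 2 * W ^ 2 := by
    intro x hx
    have h1 : ‖(W : ℂ) * profile (b, b * n) x - g x‖ ≤ η * W := by
      rw [hW, hg, Complex.ofReal_sum, Finset.sum_mul, ← Finset.sum_sub_distrib, Finset.mul_sum]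
      refine (norm_sum_le _ _).trans (Finset.sum_le_sum fun d hd => ?_)
      have hbd := hD d hd
      rw [← mul_sub, norm_mul, Complex.norm_real, Real.norm_of_nonneg (hw d hd), mul_comm η]
      refine mul_le_mul_of_nonneg_left ?_ (hw d hd)
      rw [hrad, ← dist_eq_norm]
      refine (hUδ ((b, b * n), x) ⟨hq, hx⟩ ((b, b * (n + d : ℕ)), x) ⟨⟨⟨hb.le, hb1⟩, by positivity, ?_⟩, hx⟩ ?_).le
      · push_cast
        have := min_le_left 1 (δ / 2)
        linarith
      · rw [Prod.dist_eq, Prod.dist_eq, dist_self, dist_self, Real.dist_eq]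
        push_cast
        rw [mul_add, sub_add_cancel_left, abs_neg, abs_of_nonneg (by positivity)]
        have := min_le_right 1 (δ / 2)
        simp only [max_lt_iff]
        exact ⟨⟨hδ, by linarith⟩, hδ⟩
    have h2 : W * ‖profile (b, b * n) x‖ ≤ ‖g x‖ + η * W := by
      have := norm_le_norm_add_norm_sub' ((W : ℂ) * profile (b, b * n) x) (g x)
      rw [norm_mul, Complex.norm_real, Real.norm_of_nonneg hW0] at this
      linarith
    have h3 : 0 ≤ W * ‖profile (b, b * n) x‖ := by positivity
    nlinarith [sq_nonneg (‖g x‖ - η * W), pow_le_pow_left₀ h3 h2 2]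
  have hcl : Continuous (fun x => profile (b, b * n) x) := by
    have := continuous_radial (b / 2) n
    rwa [show radial (b / 2) n = fun x => profile (b, b * n) x from funext (hrad n)] at this
  have hci : Integrable (fun x => |v x| * ‖profile (b, b * n) x‖ ^ 2) :=
    integrable_mul_norm_sq hv hcl (C := 1) fun x => by
      rw [← hrad]
      exact norm_radial_le (half_pos hb) n x
  have h1 : ∫ x in Metric.closedBall 0 R, W ^ 2 * (|v x| * ‖profile (b, b * n) x‖ ^ 2) ≤
      ∫ x in Metric.closedBall 0 R, (2 * (|v x| * ‖g x‖ ^ 2) + 2 * η ^ 2 * W ^ 2 * |v x|) := by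
    refine setIntegral_mono_on (hci.const_mul _).integrableOn
      ((hgi.const_mul 2).add (hv.abs.const_mul _)).integrableOn Metric.isClosed_closedBall.measurableSet
      fun x hx => ?_
    nlinarith [mul_le_mul_of_nonneg_left (hpt x hx) (abs_nonneg (v x))]
  have h2 : ∫ x in Metric.closedBall 0 R, (2 * (|v x| * ‖g x‖ ^ 2) + 2 * η ^ 2 * W ^ 2 * |v x|) ≤
      ∫ x, (2 * (|v x| * ‖g x‖ ^ 2) + 2 * η ^ 2 * W ^ 2 * |v x|) :=
    setIntegral_le_integral ((hgi.const_mul 2).add (hv.abs.const_mul _))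
      (Filter.Eventually.of_forall fun x => by positivity)
  rw [integral_const_mul] at h1
  rw [integral_add (hgi.const_mul 2) (hv.abs.const_mul _), integral_const_mul, integral_const_mul, ← hV] at h2
  have h3 := mul_le_mul_of_nonneg_left (hlow _ hq) (sq_nonneg W)
  nlinarith [mul_le_mul_of_nonneg_right hηV (sq_nonneg W)]

theorem integral_exp_center {b : ℝ} (hb : 0 < b) (z : Plane) :
    Integrable (fun y : Plane => Real.exp (-(b / 4) * ‖z + (2 : ℝ) • y‖ ^ 2)) ∧
      ∫ y : Plane, Real.exp (-(b / 4) * ‖z + (2 : ℝ) • y‖ ^ 2) = Real.pi / b := by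
  have e : ∀ y : Plane, Real.exp (-(b / 4) * ‖z + (2 : ℝ) • y‖ ^ 2) =
      Real.exp (-b * ‖y + (1 / 2 : ℝ) • z‖ ^ 2) := fun y => by
    rw [show z + (2 : ℝ) • y = (2 : ℝ) • (y + (1 / 2 : ℝ) • z) by module, norm_smul, mul_pow]
    congr 1
    norm_num
    ring
  simp only [e]
  have hI : Integrable (fun y : Plane => Real.exp (-b * ‖y‖ ^ 2)) := integrable_gauss hb
  refine ⟨hI.comp_add_right _, ?_⟩
  rw [integral_add_right_eq_self (fun y : Plane => Real.exp (-b * ‖y‖ ^ 2)),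
    GaussianFourier.integral_rexp_neg_mul_sq_norm hb]
  simp

/-- In the variables `(x - y, y)` the centre of mass Gaussian integrates to `π/b`, whatever the
relative coordinate. -/
theorem integral_mul_radial_pair {b : ℝ} (hb : 0 < b) {v : Plane → ℝ} (hv : Integrable v) {g : Plane → ℂ}
    (hg : Continuous g) {C : ℝ} (hC : ∀ x, ‖g x‖ ≤ C) :
    ∫ p : Plane × Plane, |v (p.1 - p.2)| * ‖g (p.1 - p.2) * gauss (b / 2) (p.1 + p.2)‖ ^ 2 =
      Real.pi / b * ∫ x, |v x| * ‖g x‖ ^ 2 := by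
  set H : Plane × Plane → ℝ := fun p => (|v p.1| * ‖g p.1‖ ^ 2) *
    Real.exp (-(b / 4) * ‖p.1 + (2 : ℝ) • p.2‖ ^ 2) with hH
  have hgi := integrable_mul_norm_sq hv hg hC
  have hm : AEStronglyMeasurable H (volume.prod volume) :=
    hgi.1.comp_fst.mul (Continuous.aestronglyMeasurable (by fun_prop))
  have hHi : Integrable H (volume.prod volume) := by
    rw [integrable_prod_iff hm]
    refine ⟨Filter.Eventually.of_forall fun x =>
      (integral_exp_center hb x).1.const_mul (|v x| * ‖g x‖ ^ 2), ?_⟩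
    refine (hgi.mul_const (Real.pi / b)).congr (Filter.Eventually.of_forall fun x => ?_)
    simp only [hH]
    rw [← (integral_exp_center hb x).2, ← integral_const_mul]
    refine integral_congr_ae (Filter.Eventually.of_forall fun y => ?_)
    exact (Real.norm_of_nonneg (by positivity)).symm
  have hmp := measurePreserving_sub_prod (volume : Measure Plane) (volume : Measure Plane)
  calc _ = ∫ p : Plane × Plane, H (p.1 - p.2, p.2) := by
        refine integral_congr_ae (Filter.Eventually.of_forall fun p => ?_)
        simp only [hH]
        rw [norm_mul, mul_pow, norm_gauss, ← Real.exp_nat_mul,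
          show p.1 - p.2 + (2 : ℝ) • p.2 = p.1 + p.2 by module, mul_assoc]
        congr 3
        push_cast
        ring
    _ = ∫ p, H p := by
        rw [Measure.volume_eq_prod]
        conv_rhs => rw [← hmp.map_eq]
        rw [integral_map hmp.aemeasurable (by rw [hmp.map_eq]; exact hm)]
    _ = _ := by
        rw [Measure.volume_eq_prod, integral_prod _ hHi, ← integral_const_mul]
        refine integral_congr_ae (Filter.Eventually.of_forall fun x => ?_)
        simp only [hH]
        rw [integral_const_mul, (integral_exp_center hb x).2, mul_comm]

theorem integrable_pair_mul {v : Plane → ℝ} (hv : AEStronglyMeasurable v volume) {M : ℝ}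
    (hM : ∀ᵐ x, ‖v x‖ ≤ M) {k : Plane × Plane → ℂ} (hk : MemLp k 2 volume) :
    Integrable (fun p : Plane × Plane => |v (p.1 - p.2)| * ‖k p‖ ^ 2) := by
  have hi := (memLp_two_iff_integrable_sq_norm hk.1).1 hk
  have hq := quasiMeasurePreserving_sub (volume : Measure Plane) (volume : Measure Plane)
  refine (hi.const_mul M).mono' ((continuous_abs.comp_aestronglyMeasurable
    (hv.comp_quasiMeasurePreserving hq)).mul hi.1) ?_
  filter_upwards [hq.ae hM] with p hp
  rw [norm_mul, Real.norm_of_nonneg (sq_nonneg ‖k p‖), Real.norm_eq_abs, abs_abs]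
  exact mul_le_mul_of_nonneg_right hp (sq_nonneg _)

/-- The interaction energy of a pair function, up to a small part. -/
theorem pairEnergy_le_of_add {v : Plane → ℝ} (hv : AEStronglyMeasurable v volume)
    (hv0 : ∀ᵐ x, v x ≤ 0) {M : ℝ} (hM : ∀ᵐ x, ‖v x‖ ≤ M) {k k' : Plane × Plane → ℂ}
    (hk : MemLp k 2 volume) (hk' : MemLp k' 2 volume) :
    pairEnergy v k ≤ -(1 / 4) * (∫ p : Plane × Plane, |v (p.1 - p.2)| * ‖k p + k' p‖ ^ 2) +
      M / 2 * ∫ p, ‖k' p‖ ^ 2 := by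
  have hq := quasiMeasurePreserving_sub (volume : Measure Plane) (volume : Measure Plane)
  have i1 := integrable_pair_mul hv hM hk
  have i2 := integrable_pair_mul hv hM hk'
  have i3 := integrable_pair_mul hv hM (hk.add hk')
  have e1 : pairEnergy v k = -(1 / 2) * ∫ p : Plane × Plane, |v (p.1 - p.2)| * ‖k p‖ ^ 2 := by
    rw [pairEnergy, neg_mul, ← mul_neg, ← integral_neg]
    congr 1
    refine integral_congr_ae ?_
    filter_upwards [hq.ae hv0] with p hp
    rw [abs_of_nonpos hp]
    ring
  have h2 : ∫ p : Plane × Plane, |v (p.1 - p.2)| * ‖k' p‖ ^ 2 ≤ M * ∫ p, ‖k' p‖ ^ 2 := by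
    have hi := (memLp_two_iff_integrable_sq_norm hk'.1).1 hk'
    rw [← integral_const_mul]
    refine integral_mono_ae i2 (hi.const_mul M) ?_
    filter_upwards [hq.ae hM] with p hp
    gcongr
    exact hp
  have h3 : ∫ p : Plane × Plane, |v (p.1 - p.2)| * ‖k p + k' p‖ ^ 2 ≤
      ∫ p : Plane × Plane, (2 * (|v (p.1 - p.2)| * ‖k p‖ ^ 2) + 2 * (|v (p.1 - p.2)| * ‖k' p‖ ^ 2)) := by
    refine integral_mono i3 ((i1.const_mul 2).add (i2.const_mul 2)) fun p => ?_
    have h := pow_le_pow_left₀ (norm_nonneg _) (norm_add_le (k p) (k' p)) 2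
    have h' : ‖k p + k' p‖ ^ 2 ≤ 2 * ‖k p‖ ^ 2 + 2 * ‖k' p‖ ^ 2 := by
      nlinarith [sq_nonneg (‖k p‖ - ‖k' p‖)]
    have := mul_le_mul_of_nonneg_left h' (abs_nonneg (v (p.1 - p.2)))
    linarith
  rw [integral_add (i1.const_mul 2) (i2.const_mul 2), integral_const_mul, integral_const_mul] at h3
  rw [e1]
  linarith

/-! ### The trial state -/

open Finset.HasAntidiagonal (antidiagonal)

theorem sum_binomial (N : ℕ) : ∑ n ∈ antidiagonal N, (N.choose n.1 : ℝ) / 2 ^ N = 1 := by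
  rw [← Finset.sum_div, Finset.Nat.sum_antidiagonal_eq_sum_range_succ_mk, ← Nat.cast_sum,
    Nat.sum_range_choose]
  push_cast
  exact div_self (by positivity)

/-- The variance of a symmetric random walk of `N` steps, by conditioning on one step. -/
theorem sum_binomial_sq (N : ℕ) :
    ∑ n ∈ antidiagonal N, (N.choose n.1 : ℝ) / 2 ^ N * ((n.1 : ℝ) - n.2) ^ 2 = (N : ℝ) := by
  induction N with
  | zero => simp
  | succ N ih =>
    have h := Finset.sum_antidiagonal_choose_succ_mul
      (fun i j : ℕ => ((i : ℝ) - j) ^ 2 / 2 ^ (N + 1)) N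
    have e : ∀ n : ℕ × ℕ, ((N + 1).choose n.1 : ℝ) / 2 ^ (N + 1) * ((n.1 : ℝ) - n.2) ^ 2 =
      ((N + 1).choose n.1 : ℝ) * (((n.1 : ℝ) - n.2) ^ 2 / 2 ^ (N + 1)) := fun n => by ring
    simp only [e]
    rw [h, ← Finset.sum_add_distrib]
    have : ∀ n ∈ antidiagonal N, (N.choose n.1 : ℝ) * (((n.1 : ℝ) - (n.2 + 1 : ℕ)) ^ 2 / 2 ^ (N + 1)) +
        (N.choose n.2 : ℝ) * ((((n.1 + 1 : ℕ) : ℝ) - n.2) ^ 2 / 2 ^ (N + 1)) =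
        (N.choose n.1 : ℝ) / 2 ^ N * ((n.1 : ℝ) - n.2) ^ 2 + (N.choose n.1 : ℝ) / 2 ^ N := by
      intro n hn
      rw [← Nat.choose_symm_of_eq_add (Finset.HasAntidiagonal.mem_antidiagonal.1 hn).symm, pow_succ]
      push_cast
      field_simp
      ring
    rw [Finset.sum_congr rfl this, Finset.sum_add_distrib, ih, sum_binomial]
    push_cast
    ring

/-- Indices of pairs: the excess `d` of the total level over `n₀`, the two levels, and the two
angular momenta. -/
abbrev PairIndex : Type := (_ : ℕ) × ((ℕ × ℕ) × (ℕ × ℕ))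

/-- The pairs whose total level and total angular momentum are both `n₀ + d`, for `d ∈ D`. -/
def relPairs (n₀ : ℕ) (D : Finset ℕ) : Finset PairIndex :=
  D.sigma fun d => antidiagonal (n₀ + d) ×ˢ antidiagonal (n₀ + d)

/-- The Landau function of the first particle. -/
def PairIndex.fst (q : PairIndex) : ℕ × ℕ := (q.2.1.1, q.2.2.1)

/-- The Landau function of the second particle. -/
def PairIndex.snd (q : PairIndex) : ℕ × ℕ := (q.2.1.2, q.2.2.2)

/-- The coefficients of a superposition of radial pairs. -/
def relCoeff (b : ℝ) (n₀ : ℕ) (w : ℕ → ℝ) (q : PairIndex) : ℝ :=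
  w q.1 * pairCoeff b (n₀ + q.1) q.2.1 q.2.2

theorem mem_relPairs {n₀ : ℕ} {D : Finset ℕ} {q : PairIndex} : q ∈ relPairs n₀ D ↔
    q.1 ∈ D ∧ q.2.1.1 + q.2.1.2 = n₀ + q.1 ∧ q.2.2.1 + q.2.2.2 = n₀ + q.1 := by
  simp [relPairs]

theorem relPairs_inj {n₀ : ℕ} {D : Finset ℕ} : ∀ q ∈ relPairs n₀ D, ∀ q' ∈ relPairs n₀ D,
    q.fst = q'.fst → q.snd = q'.snd → q = q' := by
  rintro ⟨d, ⟨n, n'⟩, m, m'⟩ hq ⟨e, ⟨k, k'⟩, l, l'⟩ hq' h1 h2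
  rw [mem_relPairs] at hq hq'
  simp only [PairIndex.fst, PairIndex.snd, Prod.mk.injEq] at h1 h2 hq hq'
  obtain ⟨rfl, rfl⟩ := h1
  obtain ⟨rfl, rfl⟩ := h2
  obtain rfl : d = e := by omega
  rfl

theorem pairCoeff_swap (b : ℝ) {N : ℕ} {n m : ℕ × ℕ} (hn : n.1 + n.2 = N) (hm : m.1 + m.2 = N) :
    pairCoeff b N n.swap m.swap = pairCoeff b N n m := by
  have h1 : ((-1 : ℝ)) ^ (n.1 + m.1) = (-1) ^ (n.2 + m.2) := by
    have : ((-1 : ℝ)) ^ (n.1 + m.1) * (-1) ^ (n.2 + m.2) = 1 := by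
      rw [← pow_add, show n.1 + m.1 + (n.2 + m.2) = 2 * N by omega, pow_mul]
      norm_num
    rcases neg_one_pow_eq_or ℝ (n.2 + m.2) with h | h <;> rw [h] at this ⊢ <;> linarith
  simp only [pairCoeff, Prod.fst_swap, Prod.snd_swap]
  rw [h1, ← Nat.choose_symm_of_eq_add hn.symm, ← Nat.choose_symm_of_eq_add hm.symm]
  ring

theorem pairKer_relPairs {b : ℝ} (hb : 0 < b) (n₀ : ℕ) (D : Finset ℕ) (w : ℕ → ℝ) (p : Plane × Plane) :
    pairKer (relPairs n₀ D) PairIndex.fst PairIndex.snd (relCoeff b n₀ w) b p =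
      (∑ d ∈ D, (w d : ℂ) * radial (b / 2) (n₀ + d) (p.1 - p.2)) * gauss (b / 2) (p.1 + p.2) := by
  rw [pairKer, relPairs, Finset.sum_sigma, Finset.sum_mul]
  refine Finset.sum_congr rfl fun d _ => ?_
  rw [Finset.sum_product, mul_assoc, ← sum_pairCoeff hb, Finset.mul_sum]
  refine Finset.sum_congr rfl fun n _ => ?_
  rw [Finset.mul_sum]
  refine Finset.sum_congr rfl fun m _ => ?_
  simp only [relCoeff, PairIndex.fst, PairIndex.snd]
  push_cast
  ring

/-- Exchanging the particles preserves the coefficients, since total level and total angular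
momentum have the same parity. -/
theorem pairKer_swap (b : ℝ) (n₀ : ℕ) (D : Finset ℕ) (w : ℕ → ℝ) (P : PairIndex → Prop)
    [DecidablePred P] (hP : ∀ d n m, P ⟨d, n.swap, m.swap⟩ ↔ P ⟨d, n, m⟩) (x y : Plane) :
    pairKer ((relPairs n₀ D).filter P) PairIndex.fst PairIndex.snd (relCoeff b n₀ w) b (y, x) =
      pairKer ((relPairs n₀ D).filter P) PairIndex.fst PairIndex.snd (relCoeff b n₀ w) b (x, y) := by
  refine Finset.sum_nbij' (fun q => ⟨q.1, q.2.1.swap, q.2.2.swap⟩) (fun q => ⟨q.1, q.2.1.swap, q.2.2.swap⟩)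
    ?_ ?_ ?_ ?_ ?_
  · rintro ⟨d, n, m⟩ hq
    rw [Finset.mem_filter, mem_relPairs] at hq ⊢
    exact ⟨⟨hq.1.1, (add_comm _ _).trans hq.1.2.1, (add_comm _ _).trans hq.1.2.2⟩, (hP _ _ _).2 hq.2⟩
  · rintro ⟨d, n, m⟩ hq
    rw [Finset.mem_filter, mem_relPairs] at hq ⊢
    exact ⟨⟨hq.1.1, (add_comm _ _).trans hq.1.2.1, (add_comm _ _).trans hq.1.2.2⟩, (hP _ _ _).2 hq.2⟩
  · rintro ⟨d, n, m⟩ _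
    rfl
  · rintro ⟨d, n, m⟩ _
    rfl
  · rintro ⟨d, n, m⟩ hq
    rw [Finset.mem_filter, mem_relPairs] at hq
    simp only [relCoeff, PairIndex.fst, PairIndex.snd, pairCoeff_swap b hq.1.2.1 hq.1.2.2,
      Prod.fst_swap, Prod.snd_swap]
    ring

theorem sum_relCoeff_sq {b : ℝ} (hb : 0 < b) (n₀ : ℕ) (D : Finset ℕ) (w : ℕ → ℝ) (f : ℕ → ℕ × ℕ → ℝ) :
    ∑ q ∈ relPairs n₀ D, relCoeff b n₀ w q ^ 2 * f q.1 q.2.1 = (2 * Real.pi / b) ^ 2 *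
      ∑ d ∈ D, w d ^ 2 * ∑ n ∈ antidiagonal (n₀ + d),
        ((n₀ + d).choose n.1 : ℝ) / 2 ^ (n₀ + d) * f d n := by
  rw [relPairs, Finset.sum_sigma, Finset.mul_sum]
  refine Finset.sum_congr rfl fun d _ => ?_
  rw [Finset.sum_product, mul_left_comm, Finset.mul_sum, Finset.mul_sum]
  refine Finset.sum_congr rfl fun n hn => ?_
  have : ∀ m ∈ antidiagonal (n₀ + d), relCoeff b n₀ w ⟨d, n, m⟩ ^ 2 * f d n =
      w d ^ 2 * ((2 * Real.pi / b) ^ 2 * (((n₀ + d).choose n.1 : ℝ) / 2 ^ (n₀ + d) * f d n)) *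
        (((n₀ + d).choose m.1 : ℝ) / 2 ^ (n₀ + d)) := fun m hm => by
    rw [relCoeff, mul_pow, pairCoeff_sq hb hn hm]
    ring
  rw [Finset.sum_congr rfl this, ← Finset.mul_sum, sum_binomial, mul_one]

/-- Chebyshev's inequality for the binomial distribution of the levels, with variance `n₀ + d`. -/
theorem sum_relCoeff_sq_far_le {b : ℝ} (hb : 0 < b) (n₀ : ℕ) {D : Finset ℕ} (hD : ∀ d ∈ D, 0 < d)
    (w : ℕ → ℝ) (P : PairIndex → Prop) [DecidablePred P]
    (hP : ∀ q ∈ relPairs n₀ D, P q → (q.1 : ℝ) ^ 2 ≤ ((q.2.1.1 : ℝ) - q.2.1.2) ^ 2) :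
    ∑ q ∈ (relPairs n₀ D).filter P, relCoeff b n₀ w q ^ 2 ≤
      (2 * Real.pi / b) ^ 2 * ∑ d ∈ D, w d ^ 2 * (((n₀ + d : ℕ) : ℝ) / (d : ℝ) ^ 2) := by
  have h := sum_relCoeff_sq hb n₀ D w (fun d n => ((n.1 : ℝ) - n.2) ^ 2 / (d : ℝ) ^ 2)
  simp only [mul_div_assoc', ← Finset.sum_div, sum_binomial_sq] at h ⊢
  rw [← h, Finset.sum_filter]
  refine Finset.sum_le_sum fun q hq => ?_
  have hd : (0 : ℝ) < q.1 := by exact_mod_cast hD _ (mem_relPairs.1 hq).1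
  split_ifs with h
  · rw [le_div_iff₀ (by positivity)]
    exact mul_le_mul_of_nonneg_left (hP q hq h) (sq_nonneg _)
  · positivity

theorem sum_relCoeff_sq_mul_le {b : ℝ} (hb : 0 < b) (n₀ : ℕ) (D : Finset ℕ)
    (w : ℕ → ℝ) (P : PairIndex → Prop) [DecidablePred P] (X : PairIndex → ℝ) (Y : ℕ → ℝ)
    (hY : ∀ d, 0 ≤ Y d) (hX : ∀ q ∈ (relPairs n₀ D).filter P, X q ≤ Y q.1) :
    ∑ q ∈ (relPairs n₀ D).filter P, relCoeff b n₀ w q ^ 2 * X q ≤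
      (2 * Real.pi / b) ^ 2 * ∑ d ∈ D, w d ^ 2 * Y d := by
  have h := sum_relCoeff_sq hb n₀ D w (fun d _ => Y d)
  simp only [← Finset.sum_mul, sum_binomial, one_mul] at h
  rw [← h]
  refine (Finset.sum_le_sum fun q hq => mul_le_mul_of_nonneg_left (hX q hq) (sq_nonneg _)).trans ?_
  exact Finset.sum_le_sum_of_subset_of_nonneg (Finset.filter_subset _ _)
    fun q _ _ => mul_nonneg (sq_nonneg _) (hY _)

/-- Each of the `K` dyadic blocks of the harmonic sum contributes at least `1/2`. -/
theorem le_sum_inv_Ico {m : ℕ} (hm : 0 < m) (K : ℕ) :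
    (K : ℝ) / 2 ≤ ∑ d ∈ Finset.Ico m (2 ^ K * m), (1 : ℝ) / d := by
  induction K with
  | zero => simp
  | succ K ih =>
    have h1 : m ≤ 2 ^ K * m := Nat.le_mul_of_pos_left _ (by positivity)
    have h2 : 2 ^ K * m ≤ 2 ^ (K + 1) * m := Nat.mul_le_mul_right _ (Nat.pow_le_pow_right two_pos (by simp))
    rw [← Finset.sum_Ico_consecutive _ h1 h2]
    have h3 : (1 : ℝ) / 2 ≤ ∑ d ∈ Finset.Ico (2 ^ K * m) (2 ^ (K + 1) * m), (1 : ℝ) / d := by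
      have h4 : ∀ d ∈ Finset.Ico (2 ^ K * m) (2 ^ (K + 1) * m), (1 : ℝ) / ((2 ^ (K + 1) * m : ℕ) : ℝ) ≤ 1 / d := by
        intro d hd
        rw [Finset.mem_Ico] at hd
        have hd0 : 0 < d := lt_of_lt_of_le (by positivity) hd.1
        gcongr
        exact hd.2.le
      have h5 := Finset.card_nsmul_le_sum _ _ _ h4
      refine le_trans (le_of_eq ?_) h5
      rw [Nat.card_Ico, show 2 ^ (K + 1) * m - 2 ^ K * m = 2 ^ K * m by
        rw [show 2 ^ (K + 1) * m = 2 ^ K * m + 2 ^ K * m by ring, Nat.add_sub_cancel], nsmul_eq_mul]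
      have hm' : (0 : ℝ) < m := by exact_mod_cast hm
      push_cast
      field_simp
      ring
    push_cast
    linarith

theorem neg_log_fermi_le {T h : ℝ} (hT : 0 < T) (hh : 0 ≤ h) : -Real.log (fermi T h) ≤ 1 + 2 * h / T := by
  have h1 : 1 ≤ Real.exp (2 * h / T) := Real.one_le_exp (by positivity)
  rw [fermi, Real.log_inv, neg_neg, Real.log_le_iff_le_exp (by positivity), Real.exp_add]
  have h2 := Real.add_one_le_exp (1 : ℝ)
  nlinarith

/-! ### Instability in weak fields -/

open Finset.HasAntidiagonal (antidiagonal)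

theorem exists_least_level {b ν : ℝ} (hb : 0 < b) (hν : 0 ≤ ν) :
    ∃ n : ℕ, ν ≤ b * (2 * n + 1) ∧ b * (2 * n + 1) ≤ ν + 2 * b := by
  have hex : ∃ n : ℕ, ν ≤ b * (2 * n + 1) := by
    obtain ⟨n, hn⟩ := exists_nat_ge (ν / b)
    refine ⟨n, ?_⟩
    rw [div_le_iff₀ hb] at hn
    nlinarith [mul_nonneg hb.le (n.cast_nonneg (α := ℝ))]
  classical
  refine ⟨Nat.find hex, Nat.find_spec hex, ?_⟩
  rcases h : Nat.find hex with _ | n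
  · push_cast
    linarith
  · have := Nat.find_min hex (m := n) (by omega)
    push_cast at this ⊢
    linarith

theorem sq_le_sq_sub_of_add_eq {n n' n₀ d : ℝ} (h : n + n' = 2 * n₀ + d) (hd : 0 ≤ d)
    (hn : n ≤ n₀ ∨ n' ≤ n₀) : d ^ 2 ≤ (n - n') ^ 2 := by
  rcases hn with hn | hn
  · rw [← neg_sub n' n, neg_sq]
    exact pow_le_pow_left₀ hd (by linarith) 2
  · exact pow_le_pow_left₀ hd (by linarith) 2

/-- A partner at or above `n₀` forces `n ≤ n₀ + d`, so the particle lies at most `2b + 2bd` above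
`ν`; the terms proportional to `T` are below the same multiples of `b`. -/
theorem cost_le {T b ν n n' n₀ d p : ℝ} (hT : 0 < T) (hTb : T < b) (h : n + n' = 2 * n₀ + d)
    (hn : n₀ ≤ n') (hν : b * (2 * n₀ + 1) ≤ ν + 2 * b)
    (hp : -Real.log p ≤ 1 + 2 * (b * (2 * n + 1) - ν) / T) :
    T * (128 * (1 - Real.log p) + 2) ≤ 770 * b + 512 * b * d := by
  have h2 : T * (2 * (b * (2 * n + 1) - ν) / T) = 2 * (b * (2 * n + 1) - ν) := by field_simp
  have h3 := mul_le_mul_of_nonneg_left hp hT.le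
  rw [mul_add, h2] at h3
  have h4 : b * n ≤ b * (n₀ + d) := mul_le_mul_of_nonneg_left (by linarith) (hT.trans hTb).le
  linarith

/-- The condition `d³ b² ≥ 1` is what turns the Chebyshev tail, of size `M/(b d⁴)`, into a multiple
of `b/d`, the size of the entropy cost. -/
theorem sum_inv_sq_mul_le {b M : ℝ} (hb : 0 < b) (hM : 0 ≤ M) {D : Finset ℕ} (hD : ∀ d ∈ D, 0 < d) {n : ℕ}
    (hn : ∀ d ∈ D, b * ((n + d : ℕ) : ℝ) ≤ M) (hDb : ∀ d ∈ D, 1 ≤ (d : ℝ) ^ 3 * b ^ 2) :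
    ∑ d ∈ D, ((1 : ℝ) / d) ^ 2 * (((n + d : ℕ) : ℝ) / (d : ℝ) ^ 2) ≤ M * b * ∑ d ∈ D, (1 : ℝ) / d := by
  rw [Finset.mul_sum]
  refine Finset.sum_le_sum fun d hd => ?_
  have hd0 : (0 : ℝ) < d := by exact_mod_cast hD d hd
  rw [div_pow, one_pow, div_mul_div_comm, one_mul, mul_one_div, div_le_div_iff₀ (by positivity) hd0]
  have h3 : ((n + d : ℕ) : ℝ) ≤ M * b * d ^ 3 := by
    refine le_of_mul_le_mul_left (a := b) ?_ hb
    linarith [mul_le_mul_of_nonneg_left (hDb d hd) hM, hn d hd]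
  calc _ ≤ M * b * d ^ 3 * d := by gcongr
    _ = _ := by ring

theorem sum_inv_sq_mul_linear_le {b : ℝ} (hb : 0 < b) {D : Finset ℕ} (hD : ∀ d ∈ D, 0 < d) :
    ∑ d ∈ D, ((1 : ℝ) / d) ^ 2 * (770 * b + 512 * b * d) ≤ 1282 * b * ∑ d ∈ D, (1 : ℝ) / d := by
  rw [Finset.mul_sum]
  refine Finset.sum_le_sum fun d hd => ?_
  have hd0 : (0 : ℝ) < d := by exact_mod_cast hD d hd
  have hd1 : (1 : ℝ) ≤ d := by exact_mod_cast hD d hd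
  rw [div_pow, one_pow, one_div_mul_eq_div, mul_one_div, div_le_div_iff₀ (by positivity) hd0]
  linarith [mul_le_mul_of_nonneg_left hd1 (mul_nonneg hb.le hd0.le)]

/-- The range of `d` runs over `K` octaves ending near `Λ/b`. As `K` is fixed first, the range
starts near `θ/b`, which exceeds `b^(-2/3)` for small `b`. -/
theorem exists_scales {Λ : ℝ} (hΛ : 0 < Λ) (C : ℝ) : ∃ b₀ : ℝ, 0 < b₀ ∧ b₀ ≤ 1 ∧ ∀ b : ℝ, 0 < b → b < b₀ →
    ∃ D : Finset ℕ, (∀ d ∈ D, 0 < d) ∧ (∀ d ∈ D, b * d ≤ Λ) ∧ (∀ d ∈ D, 1 ≤ (d : ℝ) ^ 3 * b ^ 2) ∧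
      C < ∑ d ∈ D, (1 : ℝ) / d := by
  obtain ⟨K, hK⟩ := exists_nat_gt (2 * C)
  set θ := Λ / 2 ^ K with hθ
  have hθ0 : 0 < θ := by positivity
  -- `b < θ/2` makes the floor `m` at least `θ/(2b)`; then `b < θ³/8` gives `d³ b² ≥ 1`.
  refine ⟨min 1 (min (θ / 2) (θ ^ 3 / 8)), by positivity, min_le_left _ _, fun b hb hbb => ?_⟩
  obtain ⟨hb1, hb2, hb3⟩ : b < 1 ∧ b < θ / 2 ∧ b < θ ^ 3 / 8 := by simpa using hbb
  set m := ⌊θ / b⌋₊ with hm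
  have hm1 : (m : ℝ) ≤ θ / b := Nat.floor_le (by positivity)
  have hm2 : θ / (2 * b) ≤ m := by
    have h1 := Nat.sub_one_lt_floor (θ / b)
    have h2 : 2 ≤ θ / b := by rw [le_div_iff₀ hb]; linarith
    have h3 : θ / (2 * b) = θ / b / 2 := by field_simp
    linarith
  have hmpos : 0 < m := by
    have : (0 : ℝ) < m := lt_of_lt_of_le (by positivity) hm2
    exact_mod_cast this
  set D := Finset.Ico m (2 ^ K * m) with hD
  have hDm : ∀ d ∈ D, m ≤ d := fun d hd => (Finset.mem_Ico.1 hd).1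
  have hDpos : ∀ d ∈ D, 0 < d := fun d hd => hmpos.trans_le (hDm d hd)
  have hDΛ : ∀ d ∈ D, b * d ≤ Λ := by
    intro d hd
    have h1 : (d : ℝ) ≤ 2 ^ K * m := by exact_mod_cast (Finset.mem_Ico.1 hd).2.le
    calc b * d ≤ b * (2 ^ K * (θ / b)) := by gcongr; exact h1.trans (by gcongr)
      _ = Λ := by rw [hθ]; field_simp
  have hDb : ∀ d ∈ D, 1 ≤ (d : ℝ) ^ 3 * b ^ 2 := by
    intro d hd
    have h1 : θ / (2 * b) ≤ d := hm2.trans (by exact_mod_cast hDm d hd)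
    calc (1 : ℝ) ≤ θ ^ 3 / 8 / b := by rw [le_div_iff₀ hb]; linarith
      _ = (θ / (2 * b)) ^ 3 * b ^ 2 := by field_simp; norm_num
      _ ≤ _ := by gcongr
  exact ⟨D, hDpos, hDΛ, hDb, lt_of_lt_of_le (by linarith) (le_sum_inv_Ico hmpos K)⟩

theorem exists_criticalTemp_pos {v : Plane → ℝ} {μ s : ℝ} (hvi : Integrable v) (hv : MemLp v ⊤ volume)
    (hv0 : ∀ᵐ x, v x ≤ 0) (hvn : ¬ ∀ᵐ x, v x = 0) (hv1 : |∫ x, v x| < 1) (hs : 0 < s) (hμ : 0 ≤ μ) :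
    ∃ b₀ : ℝ, 0 < b₀ ∧ ∀ b : ℝ, 0 < b → b < b₀ → 0 < criticalTemp v μ s b := by
  obtain ⟨V, hV0, hV⟩ := exists_ae_norm_le hv
  have hint : ∫ x, v x ≤ 0 := integral_nonpos_of_ae hv0
  -- A bound for the energy `2 b n₀`, which is at most `ν + b`, uniformly in `T < b < 1`.
  set M := 2 * μ + 4 with hM
  obtain ⟨c, hc, Λ, hΛ, hΛ1, hlow⟩ := exists_sum_radial_lower_bound hvi hvn M
  have hpi := Real.pi_pos
  set C := V / 2 * (4 * Real.pi ^ 2) * (M + 1) + s * (4 * Real.pi ^ 2) * 1282 with hC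
  have hC0 : 0 ≤ C := by positivity
  obtain ⟨b₀, hb₀, hb₀1, hsc⟩ := exists_scales hΛ (C / (Real.pi / 4 * c))
  refine ⟨b₀, hb₀, fun b hb hbb => ?_⟩
  have hb1 : b < 1 := hbb.trans_le hb₀1
  obtain ⟨D, hDpos, hDΛ, hDb, hLD⟩ := hsc b hb hbb
  set w : ℕ → ℝ := fun d => 1 / d with hw
  have hw0 : ∀ d ∈ D, 0 ≤ w d := fun d _ => by positivity
  set L := ∑ d ∈ D, w d with hL
  have hLC : C < Real.pi / 4 * c * L := by
    rwa [div_lt_iff₀' (by positivity)] at hLD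
  have hL0 : 0 < L := by
    have : 0 < Real.pi / 4 * c * L := hC0.trans_lt hLC
    exact pos_of_mul_pos_right this (by positivity)
  -- In fact the critical temperature is shown to be at least `b`.
  suffices hsuff : ∀ t : ℝ, 0 < t → t < b → NormalUnstable v μ s t b by
    refine (ENNReal.ofReal_pos.2 hb).trans_le (le_sSup fun t ht htb => hsuff t ht ?_)
    exact (ENNReal.ofReal_lt_ofReal_iff hb).1 htb
  intro T hT hTb
  refine ⟨exists_isNormalState hb hT hint (by rw [abs_lt] at hv1; exact hv1.1.le), fun γ k hN => ?_⟩
  obtain ⟨ν, hν, hγ, hB⟩ := hN.exists_levels hb hT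
  obtain ⟨hν1, hν2⟩ := density_fixedPoint_bounds hT hb (neg_nonneg.2 hint)
    (by rw [abs_lt] at hv1; linarith [hv1.1]) hν
  rw [abs_of_nonneg hμ] at hν2
  obtain ⟨n₀, hn1, hn2⟩ := exists_least_level hb (hμ.trans hν1)
  have hnM : b * ((2 * n₀ : ℕ) : ℝ) ≤ M := by
    push_cast
    linarith
  have hlow' := hlow b hb hb1.le (2 * n₀) hnM D w hw0 hDΛ
  -- Only pairs with both particles at energies not below `ν` are kept, where the occupations are at
  -- most `1/2`. The remainder `k₂` is estimated in norm.
  set P : PairIndex → Prop := fun q => n₀ ≤ q.2.1.1 ∧ n₀ ≤ q.2.1.2 with hP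
  have hpI : ∀ q : PairIndex, n₀ ≤ q.2.1.1 → 0 ≤ b * (2 * q.2.1.1 + 1) - ν := fun q hq => by
    have : (n₀ : ℝ) ≤ q.2.1.1 := by exact_mod_cast hq
    nlinarith
  have hpJ : ∀ q : PairIndex, n₀ ≤ q.2.1.2 → 0 ≤ b * (2 * q.2.1.2 + 1) - ν := fun q hq => by
    have : (n₀ : ℝ) ≤ q.2.1.2 := by exact_mod_cast hq
    nlinarith
  have hhalf : ∀ h : ℝ, 0 ≤ h → fermi T h ≤ 1 / 2 := fun h hh => by
    rw [fermi, ← one_div]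
    gcongr
    linarith [Real.one_le_exp (show 0 ≤ 2 * h / T by positivity)]
  set k₁ := pairKer ((relPairs (2 * n₀) D).filter P) PairIndex.fst PairIndex.snd
    (relCoeff b (2 * n₀) w) b with hk₁
  set k₂ := pairKer ((relPairs (2 * n₀) D).filter (fun q => ¬ P q)) PairIndex.fst PairIndex.snd
    (relCoeff b (2 * n₀) w) b with hk₂
  have hadd : ∀ p, k₁ p + k₂ p = (∑ d ∈ D, (w d : ℂ) * radial (b / 2) (2 * n₀ + d) (p.1 - p.2)) *
      gauss (b / 2) (p.1 + p.2) := fun p => by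
    rw [← pairKer_relPairs hb]
    exact Finset.sum_filter_add_sum_filter_not _ _ _
  have hpair := pairEnergy_le_of_add hv.1 hv0 hV (k := k₁) (k' := k₂) (memLp_pairKer hb _ _ _ _)
    (memLp_pairKer hb _ _ _ _)
  simp only [hadd] at hpair
  rw [integral_mul_radial_pair hb hvi (continuous_sum_radial (b / 2) D w (2 * n₀))
      (norm_sum_radial_le (half_pos hb) D hw0 (2 * n₀)), hk₂,
    integral_norm_sq_pairKer hb _ (fun q hq q' hq' => relPairs_inj q (Finset.mem_filter.1 hq).1 q'
      (Finset.mem_filter.1 hq').1)] at hpair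
  have hfar := sum_relCoeff_sq_far_le hb (2 * n₀) hDpos w (fun q => ¬ P q) (fun q hq hPq => by
    obtain ⟨hd, hn, -⟩ := mem_relPairs.1 hq
    have hn' : (q.2.1.1 : ℝ) + q.2.1.2 = 2 * n₀ + q.1 := by exact_mod_cast hn
    refine sq_le_sq_sub_of_add_eq hn' (Nat.cast_nonneg _) ((not_and_or.1 hPq).imp (fun h => ?_) fun h => ?_)
    · exact_mod_cast (not_le.1 h).le
    · exact_mod_cast (not_le.1 h).le)
  have hfar2 : ∑ d ∈ D, w d ^ 2 * (((2 * n₀ + d : ℕ) : ℝ) / (d : ℝ) ^ 2) ≤ (M + 1) * b * L := by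
    refine sum_inv_sq_mul_le hb (by positivity) hDpos (fun d hd => ?_) hDb
    push_cast at hnM ⊢
    linarith [hDΛ d hd]
  have hcost := sum_relCoeff_sq_mul_le hb (2 * n₀) D w P
    (fun q => T * (128 * (1 - Real.log (fermi T (b * (2 * q.fst.1 + 1) - ν))) + 2))
    (fun d => 770 * b + 512 * b * d) (fun d => by positivity) (fun q hq => by
      obtain ⟨hq1, hq2, hq3⟩ := Finset.mem_filter.1 hq
      obtain ⟨hd, hn, -⟩ := mem_relPairs.1 hq1
      have hn' : (q.2.1.1 : ℝ) + q.2.1.2 = 2 * n₀ + q.1 := by exact_mod_cast hn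
      have hq3' : (n₀ : ℝ) ≤ q.2.1.2 := by exact_mod_cast hq3
      exact cost_le hT hTb hn' hq3' hn2 (neg_log_fermi_le hT (hpI q hq2)))
  have hcost2 : ∑ d ∈ D, w d ^ 2 * (770 * b + 512 * b * d) ≤ 1282 * b * L := sum_inv_sq_mul_linear_le hb hDpos
  refine isEnergeticallyUnstable_of_pairKer hb (Q := (relPairs (2 * n₀) D).filter P)
    (I := PairIndex.fst) (J := PairIndex.snd) (a := relCoeff b (2 * n₀) w)
    (fun q hq q' hq' => relPairs_inj q (Finset.mem_filter.1 hq).1 q' (Finset.mem_filter.1 hq').1)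
    (pairKer_swap b (2 * n₀) D w P fun d n m => and_comm) hs hT hγ hB (fun i => fermi_pos _ _)
    (fermi_lt_one T (b - ν)) (fun i => fermi_anti hT (by nlinarith [i.1.cast_nonneg (α := ℝ)]))
    (fun q hq => hhalf _ (hpI q (Finset.mem_filter.1 hq).2.1))
    (fun q hq => hhalf _ (hpJ q (Finset.mem_filter.1 hq).2.2)) ?_
  have hcost' : s * T * ∑ q ∈ (relPairs (2 * n₀) D).filter P, relCoeff b (2 * n₀) w q ^ 2 *
      (128 * (1 - Real.log (fermi T (b * (2 * q.fst.1 + 1) - ν))) + 2) ≤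
        s * ((2 * Real.pi / b) ^ 2 * (1282 * b * L)) := by
    rw [mul_assoc]
    refine mul_le_mul_of_nonneg_left ?_ hs.le
    rw [Finset.mul_sum]
    refine le_trans (le_of_eq ?_) (hcost.trans (mul_le_mul_of_nonneg_left hcost2 (sq_nonneg _)))
    exact Finset.sum_congr rfl fun q _ => by ring
  have hmain := mul_le_mul_of_nonneg_left hlow' (show 0 ≤ Real.pi / b by positivity)
  have hfar3 := mul_le_mul_of_nonneg_left (hfar.trans (mul_le_mul_of_nonneg_left hfar2 (sq_nonneg _)))
    (show 0 ≤ V / 2 by positivity)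
  refine lt_of_le_of_lt (add_le_add hpair hcost') ?_
  -- The gain is quadratic in `L`, both losses are linear, and all carry the same power of `b`; so
  -- the choice of `L` decides the sign.
  have hfin : -(1 / 4) * (Real.pi / b * (c * L ^ 2)) + V / 2 * ((2 * Real.pi / b) ^ 2 * ((M + 1) * b * L)) +
      s * ((2 * Real.pi / b) ^ 2 * (1282 * b * L)) = (C - Real.pi / 4 * c * L) * L / b := by
    rw [hC]
    field_simp
    ring
  have hneg : (C - Real.pi / 4 * c * L) * L / b < 0 :=
    div_neg_of_neg_of_pos (mul_neg_of_neg_of_pos (by linarith) hL0) hb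
  linarith

end

end BdG

theorem mainTheorem8 :
    ∃ κ : ℝ, 0 < κ ∧
      ∀ (v : BdG.Plane → ℝ) (μ s : ℝ),
        MeasureTheory.Integrable v MeasureTheory.volume →
        MeasureTheory.MemLp v ⊤ MeasureTheory.volume →
        (∀ᵐ x, v (-x) = v x) →
        (∀ᵐ x, v x ≤ 0) →
        (¬ ∀ᵐ x, v x = 0) →
        |∫ x, v x| < κ →
        0 < s →
          (0 ≤ μ → ∃ b₀ : ℝ, 0 < b₀ ∧ ∀ b : ℝ, 0 < b → b < b₀ →
            0 < BdG.criticalTemp v μ s b) ∧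
          (∃ b₁ : ℝ, 0 < b₁ ∧ ∀ b : ℝ, b₁ < b → BdG.stabilityTemp v μ s b = 0) := by
  -- The value `1` is convenient rather than sharp: it serves only the scalar equation for `ν`,
  -- where it bounds the coupling `g`.
  refine ⟨1, one_pos, fun v μ s hvi hv _ hv0 hvn hv1 hs => ⟨fun hμ => ?_, ?_⟩⟩
  · exact BdG.exists_criticalTemp_pos hvi hv hv0 hvn hv1 hs hμ
  · exact BdG.exists_stabilityTemp_eq_zero hv hv0 hv1 hs
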